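/- **Setting.** Consider a star network with links $\mathcal S=\{1,\dots,N\}$, link capacities $C_i>0$ and, for each unordered pair $ij$ of distinct links, an arrival rate $\lambda_{ij}\ge 0$ and a size parameter $\mu_{ij}>0$. Let $\mathcal R=\{ij:\lambda_{ij}>0\}$ be the set of active routes. For $x\in\mathbb R_+^{\mathcal R}$ put $x_i=\sum_{j:\,ij\in\mathcal R}x_{ij}$ and $$\mu_{ij}(x)=\mu_{ij}\,x_{ij}\Bigl(\frac{C_i}{x_i}\wedge\frac{C_j}{x_j}\Bigr)\ \text{ if } x_{ij}>0,\qquad \mu_{ij}(x)=0\ \text{ if } x_{ij}=0,$$ $$\Lambda(x)=\{ij\in\mathcal R: x_{ij}>0\},\qquad \Lambda_1(x)=\{ij\in\mathcal R\setminus\Lambda(x): ij \text{ shares a link with some route in }\Lambda(x)\}.$$ For $D\in\mathbb R$, $\lambda>0$, $\mu\ge 0$ let $$l(D\|\lambda,\mu)=D\log\Bigl(\frac{D+\sqrt{D^2+4\lambda\mu}}{2\lambda}\Bigr)+\lambda+\mu-\sqrt{D^2+4\lambda\mu}\ \ge 0,$$ with $0\log 0=0$, and $l(D\|\lambda,0)=+\infty$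 for $D<0$. Let $$L(x,D)=\sum_{ij\in\Lambda(x)\cup\Lambda_1(x)}l\bigl(D_{ij}\,\|\,\lambda_{ij},\mu_{ij}(x)\bigr),\qquad x\in\mathbb R_+^{\mathcal R},\ D\in\mathbb R^{\mathcal R}.$$ Fix $T>0$. Let $D([0,T],\mathbb R_+^{\mathcal R})$ be the space of right continuous functions with left limits, with the Skorokhod metric $d_d$, and let $\mathcal C([0,T],\mathbb R_+^{\mathcal R})$ be the space of continuous functions with the uniform metric $d_c$. For $\varphi\in D([0,T],\mathbb R_+^{\mathcal R})$ let $$I_T(\varphi)=\int_0^T L(\varphi(t),\dot\varphi(t))\,dt\ \text{ if }\varphi\text{ is absolutely continuous},\qquad I_T(\varphi)=+\infty\ \text{ otherwise},$$ and let $\Phi_x(K)=\{\varphi\in D([0,T],\mathbb R_+^{\mathcal R}): I_T(\varphi)\le K,\ \varphi(0)=x\}$. Let $|\cdot|$ be the maximum norm on $\mathbb R^{\mathcal R}$. **Proposition 3.9.** The function $I_T$ has the following properties. (i) For all $K\ge 0$ and $\epsilon>0$ there is $\delta>0$ such that, for every $\varphi\in D([0,T],\mathbb R_+^{\mathcal R})$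 with $I_T(\varphi)\le K$ and every finite collection of nonoverlapping intervals $[a_k,b_k]\subset[0,T]$ with $\sum_k(b_k-a_k)\le\delta$, $$\sum_k|\varphi(b_k)-\varphi(a_k)|\le\epsilon.$$ (ii) $I_T$ is lower semicontinuous on $(D([0,T],\mathbb R_+^{\mathcal R}),d_d)$. (iii) For every compact $C\subset\mathbb R_+^{\mathcal R}$ and every $K\ge 0$, the set $\bigcup_{x\in C}\Phi_x(K)$ is contained in $\mathcal C([0,T],\mathbb R_+^{\mathcal R})$ and is compact there. (iv) For every absolutely continuous $\varphi:[0,T]\to\mathbb R_+^{\mathcal R}$ with $I_T(\varphi)<\infty$ and every $\epsilon>0$ there is a continuous piecewise linear $\varphi_\epsilon:[0,T]\to\mathbb R_+^{\mathcal R}$ (with finitely many pieces) such that $d_c(\varphi_\epsilon,\varphi)\le\epsilon$ and $I_T(\varphi_\epsilon)\le I_T(\varphi)+\epsilon$. -/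

import Mathlib

open Set Filter Topology MeasureTheory
open scoped NNReal ENNReal

/-- The data of a star network with links `Fin N`.  A (non-oriented) route of length two is an
unordered pair of distinct links; `arrival` gives the Poisson arrival rates, `size` the parameters
of the exponential document sizes, and `capacity` the bandwidths of the links. -/
structure StarNetwork (N : ℕ) where
  arrival : Sym2 (Fin N) → ℝ
  size : Sym2 (Fin N) → ℝ
  capacity : Fin N → ℝ
  arrival_nonneg : ∀ e, 0 ≤ arrival e
  size_pos : ∀ e, 0 < size e
  capacity_pos : ∀ i, 0 < capacity i

/-- The cost `l(D ‖ lam, mu)` for an M/M/1 queue with arrival rate `lam > 0` and service rate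
`mu ≥ 0`, far from the origin, to follow the drift `D`.  If `mu = 0` and `D < 0` the logarithm in
the formula is `log 0 = -∞`, and the cost is `+∞`.  In all other cases the real expression is
nonnegative (see `queueCost_formula_nonneg`), so that `ENNReal.ofReal` does not truncate it. -/
noncomputable def queueCost (D lam mu : ℝ) : ℝ≥0∞ :=
  open Classical in
  if mu = 0 ∧ D < 0 then ⊤
  else ENNReal.ofReal
    (D * Real.log ((D + √(D ^ 2 + 4 * lam * mu)) / (2 * lam)) + lam + mu
      - √(D ^ 2 + 4 * lam * mu))

theorem queueCost_formula_nonneg (D lam mu : ℝ) (hlam : 0 < lam) (hmu : 0 ≤ mu)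
    (h : ¬ (mu = 0 ∧ D < 0)) :
    0 ≤ D * Real.log ((D + √(D ^ 2 + 4 * lam * mu)) / (2 * lam)) + lam + mu
      - √(D ^ 2 + 4 * lam * mu) := by
  have hlm : 0 ≤ 4 * lam * mu := by positivity
  set s := √(D ^ 2 + 4 * lam * mu) with hs
  have hs2 : s ^ 2 = D ^ 2 + 4 * lam * mu := Real.sq_sqrt (by positivity)
  have hs0 : 0 ≤ s := Real.sqrt_nonneg _
  have hsD : |D| ≤ s := abs_le_of_sq_le_sq (by linarith) hs0
  have h1 := abs_le.mp hsD
  rcases eq_or_lt_of_le (show 0 ≤ D + s by linarith) with h0 | h0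
  · have hmu0 : mu = 0 := by
      have : 4 * lam * mu = 0 := by
        have : s = -D := by linarith
        rw [this] at hs2; linarith
      rcases mul_eq_zero.mp this with h2 | h2
      · linarith
      · exact h2
    have hD : 0 ≤ D := by
      by_contra hD
      exact h ⟨hmu0, not_le.mp hD⟩
    have hs' : s = 0 := by linarith
    have hD' : D = 0 := by linarith
    rw [hD', hs', hmu0]; simp; exact hlam.le
  · have hu : 0 < (D + s) / (2 * lam) := by positivity
    set u := (D + s) / (2 * lam) with hu'
    have hDs : D + s = 2 * lam * u := by rw [hu']; field_simp
    have hb : (s - D) * u = 2 * mu := by rw [hu']; field_simp; nlinarith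
    have e1 : 1 - u⁻¹ ≤ Real.log u := Real.one_sub_inv_le_log_of_pos hu
    have e2 : Real.log u ≤ u - 1 := Real.log_le_sub_one_of_pos hu
    have e3 : (D + s) * (1 - u⁻¹) ≤ (D + s) * Real.log u := by gcongr
    have e4 : (s - D) * Real.log u ≤ (s - D) * (u - 1) :=
      mul_le_mul_of_nonneg_left e2 (by linarith)
    have e5 : (D + s) * u⁻¹ = 2 * lam := by rw [hDs]; field_simp
    nlinarith

namespace StarNetwork

variable {N : ℕ}

/-- The set `𝓡` of active routes: unordered pairs of distinct links with positive arrival rate. -/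
abbrev Route (net : StarNetwork N) : Type :=
  {e : Sym2 (Fin N) // ¬ e.IsDiag ∧ 0 < net.arrival e}

noncomputable instance (net : StarNetwork N) : Fintype net.Route := Fintype.ofFinite _

/-- The orthant `ℝ₊^𝓡`, with the metric of the maximum norm. -/
abbrev State (net : StarNetwork N) : Type := net.Route → ℝ≥0

/-- `x_i = ∑_j x_ij`, the total load of link `i`. -/
noncomputable def load (net : StarNetwork N) (x : net.State) (i : Fin N) : ℝ :=
  open Classical in ∑ e : net.Route with i ∈ e.1, (x e : ℝ)

/-- The service rate `mu_ij(x) = mu_ij * x_ij * min (C_i / x_i) (C_j / x_j)` of the min policy;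
it vanishes when `x_ij = 0`. -/
noncomputable def serviceRate (net : StarNetwork N) (x : net.State) (e : net.Route) : ℝ :=
  net.size e.1 * ((x e : ℝ) *
    Sym2.lift ⟨fun i j => min (net.capacity i / net.load x i) (net.capacity j / net.load x j),
      fun _ _ => min_comm _ _⟩ e.1)

/-- The face `Λ(x)` of a point. -/
def face (net : StarNetwork N) (x : net.State) : Set net.Route := {e | 0 < x e}

/-- The set `Λ₁(x)` of the routes outside `Λ(x)` that share a link with a route in `Λ(x)`. -/
def jammed (net : StarNetwork N) (x : net.State) : Set net.Route :=
  {e | e ∉ net.face x ∧ ∃ f ∈ net.face x, ∃ i, i ∈ e.1 ∧ i ∈ f.1}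

/-- The local rate function
`L(x, D) = ∑_{ij ∈ Λ(x) ∪ Λ₁(x)} l(D_ij ‖ lam_ij, mu_ij(x))`. -/
noncomputable def localRate (net : StarNetwork N) (x : net.State) (D : net.Route → ℝ) : ℝ≥0∞ :=
  open Classical in
  ∑ e : net.Route with e ∈ net.face x ∪ net.jammed x,
    queueCost (D e) (net.arrival e.1) (net.serviceRate x e)

/-- `D([0,T], ℝ₊^𝓡)`: the right continuous functions with left limits. -/
structure CadlagPath (net : StarNetwork N) (T : ℝ) where
  toFun : Icc (0 : ℝ) T → net.State
  right_continuous : ∀ t, ContinuousWithinAt toFun (Ici t) t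
  left_limit : ∀ t, ∃ y, Tendsto toFun (𝓝[<] t) (𝓝 y)

variable {net : StarNetwork N} {T : ℝ}

instance : CoeFun (net.CadlagPath T) (fun _ => Icc (0 : ℝ) T → net.State) := ⟨CadlagPath.toFun⟩

/-- A continuous path, seen as an element of `D([0,T], ℝ₊^𝓡)`. -/
def ofContinuous (g : C(Icc (0 : ℝ) T, net.State)) : net.CadlagPath T where
  toFun := g
  right_continuous _ := g.continuous.continuousWithinAt
  left_limit t := ⟨g t, (g.continuous.tendsto t).mono_left nhdsWithin_le_nhds⟩

/-- The Skorokhod distance: the infimum, over all increasing bijections `s` of `[0,T]`, of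
`max (sup_t |s(t) - t|) (sup_t |φ(t) - ψ(s(t))|)`. -/
noncomputable def skorokhodEDist (φ ψ : net.CadlagPath T) : ℝ≥0∞ :=
  ⨅ s : Icc (0 : ℝ) T ≃o Icc (0 : ℝ) T,
    max (⨆ t, edist (s t) t) (⨆ t, edist (φ t) (ψ (s t)))

/-- `D([0,T], ℝ₊^𝓡)` carries the Skorokhod metric, hence the Skorokhod topology. -/
noncomputable instance : PseudoEMetricSpace (net.CadlagPath T) where
  edist := skorokhodEDist
  edist_self φ := by
    refine le_antisymm ?_ bot_le
    refine iInf_le_of_le (OrderIso.refl _) ?_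
    simp
  edist_comm := by
    have key : ∀ φ ψ : net.CadlagPath T, skorokhodEDist φ ψ ≤ skorokhodEDist ψ φ := by
      intro φ ψ
      refine le_iInf fun s => iInf_le_of_le s.symm ?_
      refine max_le_max (iSup_le fun t => ?_) (iSup_le fun t => ?_)
      · refine le_iSup_of_le (s.symm t) ?_
        rw [s.apply_symm_apply, edist_comm]
      · refine le_iSup_of_le (s.symm t) ?_
        rw [s.apply_symm_apply, edist_comm]
    exact fun φ ψ => le_antisymm (key φ ψ) (key ψ φ)
  edist_triangle φ ψ χ := by
    unfold skorokhodEDist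
    rw [ENNReal.iInf_add]
    refine le_iInf fun s => ?_
    rw [ENNReal.add_iInf]
    refine le_iInf fun r => iInf_le_of_le (s.trans r) (max_le ?_ ?_)
    · refine iSup_le fun t => ?_
      refine (edist_triangle (r (s t)) (s t) t).trans ?_
      rw [add_comm]
      exact add_le_add ((le_iSup (fun t => edist (s t) t) t).trans (le_max_left _ _))
        ((le_iSup (fun t => edist (r t) t) (s t)).trans (le_max_left _ _))
    · refine iSup_le fun t => ?_
      refine (edist_triangle (φ t) (ψ (s t)) (χ (r (s t)))).trans ?_
      exact add_le_add
        ((le_iSup (fun t => edist (φ t) (ψ (s t))) t).trans (le_max_right _ _))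
        ((le_iSup (fun t => edist (ψ t) (χ (r t))) (s t)).trans (le_max_right _ _))

/-- The path as a function of a real variable, extended by `0` outside `[0,T]`. -/
noncomputable def CadlagPath.extend (φ : net.CadlagPath T) : ℝ → net.State :=
  open Classical in fun t => if h : t ∈ Icc (0 : ℝ) T then φ ⟨t, h⟩ else 0

/-- Absolute continuity on `[0,T]` (for `0 ≤ T`). -/
def CadlagPath.IsAC (φ : net.CadlagPath T) : Prop :=
  AbsolutelyContinuousOnInterval φ.extend 0 T

/-- The coordinatewise time derivative of a path (an absolutely continuous path is differentiable
at almost every time, and only these times in the open interval matter). -/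
noncomputable def CadlagPath.velocity (φ : net.CadlagPath T) (t : ℝ) : net.Route → ℝ :=
  fun e => deriv (fun s => (φ.extend s e : ℝ)) t

/-- The sample path rate function `I_T`. -/
noncomputable def pathRate (φ : net.CadlagPath T) : ℝ≥0∞ :=
  open Classical in
  if φ.IsAC then ∫⁻ t in Icc 0 T, net.localRate (φ.extend t) (φ.velocity t) else ⊤

/-- The level set `Φ_x(K)`. -/
def levelSet (net : StarNetwork N) (T : ℝ) (K : ℝ≥0) (x : net.State) : Set (net.CadlagPath T) :=
  {φ | pathRate φ ≤ K ∧ ∀ h : (0 : ℝ) ∈ Icc 0 T, φ ⟨0, h⟩ = x}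

/-- A continuous path is piecewise linear if `[0,T]` has a finite subdivision on each interval of
which the path is affine. -/
def IsPiecewiseLinear (g : C(Icc (0 : ℝ) T, net.State)) : Prop :=
  ∃ (n : ℕ) (τ : ℕ → ℝ), Monotone τ ∧ τ 0 = 0 ∧ τ n = T ∧
    ∀ k < n, ∃ a v : net.Route → ℝ, ∀ t : Icc (0 : ℝ) T, τ k ≤ t → (t : ℝ) ≤ τ (k + 1) →
      ∀ e, (g t e : ℝ) = a e + t * v e

end StarNetwork

/-! The cost of one queue is the supremum over θ of θ D - lam (exp θ - 1) - mu (exp (-θ) - 1)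
(`queueCost_eq_dualCost`), hence lower semicontinuous and convex in the pair (D, mu). Each single θ
gives a usable lower bound, and integrating these bounds over time gives Jensen's inequality
(`ofReal_mul_dualCost_average_le`).

Uniform absolute continuity: θ = ±κ bounds κ |D| by the cost plus a constant, because all rates are
bounded. Routes that the local rate omits are empty, so they do not move (`mul_abs_deriv_le`).
Taking κ of order K / ε gives δ.

Lower semicontinuity: paths of bounded cost are equicontinuous, so Skorokhod convergence among them
is uniform. Velocities of a uniformly convergent sequence need not converge, but difference
quotients over windows that shrink slowly compared with the uniform error do. By Jensen and Fubini
the cost of these moving averages is at most the cost of the path. A route counts exactly when one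
of its links is loaded; this is an open condition, under which the service rate is continuous. So
the averaged costs have the right pointwise liminf (`le_liminf_averagedCost`), and Fatou's lemma
concludes. Compactness is then Arzelà–Ascoli.

Piecewise linear approximation: interpolation is harmless where rates vary little relative to their
size, and the difficulty is the boundary. By induction on the set S of links whose load may vanish
(`approximable_of_load_pos`), it suffices to treat short intervals at whose ends all loads in S
vanish. There the routes meeting S are emptied, the other routes are raised to a level η, and the
result is interpolated. A route with one link in S then pays lam per unit of time for blocking its
arrivals; the original path pays almost as much, being a loop with a small service rate
(`ofReal_mul_le_lintegral_of_loop`). A route with both links in S pays nothing. Time spent below the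
level η is treated in the same way (`lintegral_indicator_le_of_floor`). Pieces are glued by short
straight bridges, cheap because the cost of emptying a queue has only a logarithmic singularity
(`exists_join_bridge`). The bridges take time, so an approximation runs with a small delay
(`Approximable`) and is finally cut off at T. -/

/-! ### The cost of one queue as a Legendre transform. -/

/-- The Legendre transform of the log-moment generating function of the difference of two
independent Poisson variables with parameters `lam` and `mu`. -/
noncomputable def dualCost (lam D mu : ℝ) : ℝ≥0∞ :=
  ⨆ θ : ℝ, ENNReal.ofReal (θ * D - lam * (Real.exp θ - 1) - mu * (Real.exp (-θ) - 1))

theorem le_dualCost (lam D mu θ : ℝ) :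
    ENNReal.ofReal (θ * D - lam * (Real.exp θ - 1) - mu * (Real.exp (-θ) - 1))
      ≤ dualCost lam D mu :=
  le_iSup (fun θ : ℝ =>
    ENNReal.ofReal (θ * D - lam * (Real.exp θ - 1) - mu * (Real.exp (-θ) - 1))) θ

theorem dualCost_le {lam D mu : ℝ} {B : ℝ≥0∞}
    (h : ∀ θ : ℝ,
      ENNReal.ofReal (θ * D - lam * (Real.exp θ - 1) - mu * (Real.exp (-θ) - 1)) ≤ B) :
    dualCost lam D mu ≤ B :=
  iSup_le h

theorem dualCost_le_ofReal {lam D mu B : ℝ}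
    (h : ∀ θ : ℝ, θ * D - lam * (Real.exp θ - 1) - mu * (Real.exp (-θ) - 1) ≤ B) :
    dualCost lam D mu ≤ ENNReal.ofReal B :=
  iSup_le fun θ => ENNReal.ofReal_le_ofReal (h θ)

theorem dualCost_zero_left_top {lam D : ℝ} (hlam : 0 < lam) (hD : D < 0) :
    dualCost lam D 0 = ⊤ := by
  refine ENNReal.eq_top_of_forall_nnreal_le fun r => ?_
  refine le_trans ?_ (le_dualCost lam D 0 (r / D))
  have h1 : r / D * D = r := div_mul_cancel₀ _ hD.ne
  have h2 : Real.exp (r / D) ≤ 1 := by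
    rw [Real.exp_le_one_iff]
    exact div_nonpos_of_nonneg_of_nonpos r.2 hD.le
  rw [← ENNReal.ofReal_coe_nnreal]
  refine ENNReal.ofReal_le_ofReal ?_
  rw [h1]
  nlinarith

/-- The cost of a queue is a Legendre transform; in particular it is convex in `(D, mu)`. -/
theorem queueCost_eq_dualCost (D : ℝ) {lam mu : ℝ} (hlam : 0 < lam) (hmu : 0 ≤ mu) :
    queueCost D lam mu = dualCost lam D mu := by
  unfold queueCost
  split_ifs with h
  · rw [h.1, dualCost_zero_left_top hlam h.2]
  have hlm : 0 ≤ 4 * lam * mu := by positivity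
  set s := √(D ^ 2 + 4 * lam * mu) with hs
  have hs2 : s ^ 2 = D ^ 2 + 4 * lam * mu := Real.sq_sqrt (by positivity)
  have hs0 : 0 ≤ s := Real.sqrt_nonneg _
  have hsD : |D| ≤ s := abs_le_of_sq_le_sq (by linarith) hs0
  have h1 := abs_le.mp hsD
  rcases eq_or_lt_of_le (show 0 ≤ D + s by linarith) with h0 | h0
  · have hmu0 : mu = 0 := by
      have : 4 * lam * mu = 0 := by
        have : s = -D := by linarith
        rw [this] at hs2; linarith
      rcases mul_eq_zero.mp this with h2 | h2
      · linarith
      · exact h2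
    have hD : 0 ≤ D := by
      by_contra hD
      exact h ⟨hmu0, not_le.mp hD⟩
    have hs' : s = 0 := by linarith
    have hD' : D = 0 := by linarith
    rw [hs', hD', hmu0]
    refine le_antisymm ?_ ?_
    -- For D = mu = 0 the supremum is not attained; it is the limit as θ tends to -∞.
    · have key : ∀ θ : ℝ, ENNReal.ofReal (lam * (1 - Real.exp θ)) ≤ dualCost lam 0 0 := by
        intro θ
        refine le_trans (ENNReal.ofReal_le_ofReal ?_) (le_dualCost lam 0 0 θ)
        linarith
      have lim : Tendsto (fun θ : ℝ => ENNReal.ofReal (lam * (1 - Real.exp θ))) atBot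
          (𝓝 (ENNReal.ofReal (lam * (1 - 0)))) :=
        ENNReal.tendsto_ofReal ((tendsto_const_nhds.sub Real.tendsto_exp_atBot).const_mul lam)
      have := le_of_tendsto' lim key
      simpa using this
    · refine dualCost_le_ofReal fun θ => ?_
      have := Real.exp_pos θ
      simp
      nlinarith
  -- The maximiser is log u, where u is the positive root of lam u² - D u - mu = 0.
  · have hu : 0 < (D + s) / (2 * lam) := by positivity
    set u := (D + s) / (2 * lam) with hu'
    have hlu : lam * u = (D + s) / 2 := by rw [hu']; field_simp
    have hmu' : mu / u = (s - D) / 2 := by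
      rw [div_eq_iff hu.ne', hu']; field_simp; nlinarith
    refine le_antisymm ?_ ?_
    · refine le_trans (ENNReal.ofReal_le_ofReal ?_) (le_dualCost lam D mu (Real.log u))
      rw [Real.exp_neg, Real.exp_log hu, mul_sub, mul_sub, hlu, ← div_eq_mul_inv, hmu']
      linarith
    · refine dualCost_le_ofReal fun θ => ?_
      -- With w = exp θ / u, optimality of log u follows from 1 - 1/w ≤ log w ≤ w - 1, the two
      -- bounds being weighted by mu / u and lam u.
      have hw : 0 < Real.exp θ / u := by positivity
      have e1 : Real.log (Real.exp θ / u) ≤ Real.exp θ / u - 1 := Real.log_le_sub_one_of_pos hw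
      have e2 : 1 - (Real.exp θ / u)⁻¹ ≤ Real.log (Real.exp θ / u) :=
        Real.one_sub_inv_le_log_of_pos hw
      have e3 : Real.log (Real.exp θ / u) = θ - Real.log u := by
        rw [Real.log_div (Real.exp_pos θ).ne' hu.ne', Real.log_exp]
      have e4 : lam * Real.exp θ = (D + s) / 2 * (Real.exp θ / u) := by
        rw [← hlu]; field_simp
      have e5 : mu * Real.exp (-θ) = (s - D) / 2 * (Real.exp θ / u)⁻¹ := by
        rw [← hmu', Real.exp_neg]; field_simp
      rw [e3] at e1 e2
      set w := Real.exp θ / u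
      have f1 := mul_le_mul_of_nonneg_left e1 (show 0 ≤ (D + s) / 2 by linarith)
      have f2 := mul_le_mul_of_nonneg_left e2 (show 0 ≤ (s - D) / 2 by linarith)
      rw [mul_sub, mul_sub, e4, e5]
      nlinarith

theorem lowerSemicontinuous_dualCost (lam : ℝ) :
    LowerSemicontinuous fun p : ℝ × ℝ => dualCost lam p.1 p.2 := by
  unfold dualCost
  refine lowerSemicontinuous_iSup fun θ => Continuous.lowerSemicontinuous ?_
  refine ENNReal.continuous_ofReal.comp ?_
  fun_prop

theorem measurable_dualCost (lam : ℝ) :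
    Measurable fun p : ℝ × ℝ => dualCost lam p.1 p.2 :=
  (lowerSemicontinuous_dualCost lam).measurable

theorem dualCost_zero_le {lam mu : ℝ} (hlam : 0 ≤ lam) (hmu : 0 ≤ mu) :
    dualCost lam 0 mu ≤ ENNReal.ofReal (lam + mu) := by
  refine dualCost_le_ofReal fun θ => ?_
  have := Real.exp_pos θ
  have := Real.exp_pos (-θ)
  nlinarith

/-- The cost controls every multiple of the speed. -/
theorem mul_abs_le_dualCost_add {lam D mu κ : ℝ} (hlam : 0 ≤ lam) (hmu : 0 ≤ mu) (hκ : 0 ≤ κ) :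
    ENNReal.ofReal (κ * |D|)
      ≤ dualCost lam D mu + ENNReal.ofReal ((lam + mu) * Real.exp κ) := by
  have key : ∃ θ : ℝ, θ * D = κ * |D| ∧ Real.exp θ ≤ Real.exp κ ∧
      Real.exp (-θ) ≤ Real.exp κ := by
    rcases le_total 0 D with h | h
    · refine ⟨κ, by rw [abs_of_nonneg h], le_rfl, Real.exp_le_exp.mpr (by linarith)⟩
    · refine ⟨-κ, by rw [abs_of_nonpos h]; ring, Real.exp_le_exp.mpr (by linarith), by simp⟩
  obtain ⟨θ, h1, h2, h3⟩ := key
  refine le_trans (ENNReal.ofReal_le_ofReal ?_)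
    (ENNReal.ofReal_add_le.trans (add_le_add_left (le_dualCost lam D mu θ) _))
  rw [h1]
  nlinarith

/-- Dependence of the cost on the service rate. -/
theorem dualCost_le_add {lam D m m' : ℝ} (hlam : 0 ≤ lam) (hm : 0 < m) (hm' : 0 < m')
    {κ : ℝ} (hκ : 0 ≤ κ) (h1 : m ≤ (1 + κ) * m') (h2 : m' ≤ (1 + κ) * m) :
    dualCost lam D m
      ≤ dualCost lam D m' + ENNReal.ofReal (κ * |D| + κ * lam + κ * m') := by
  refine dualCost_le fun θ => ?_
  have key : ∃ θ' : ℝ, θ * D - lam * (Real.exp θ - 1) - m * (Real.exp (-θ) - 1) ≤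
      (θ' * D - lam * (Real.exp θ' - 1) - m' * (Real.exp (-θ') - 1))
        + (κ * |D| + κ * lam + κ * m') := by
    have hD := abs_nonneg D
    have hκD : 0 ≤ κ * |D| := by positivity
    have hκl : 0 ≤ κ * lam := by positivity
    have hκm : 0 ≤ κ * m' := by positivity
    rcases le_total m' m with h | h
    · refine ⟨θ, ?_⟩
      have := Real.exp_pos (-θ)
      nlinarith
    · rcases le_total 0 θ with h0 | h0
      · refine ⟨θ, ?_⟩
        have : Real.exp (-θ) ≤ 1 := by rw [Real.exp_le_one_iff]; linarith
        nlinarith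
      -- The term with exp (-θ) is unbounded here, so θ is shifted until m' exp (-θ') = m exp (-θ).
      -- The shift is at most κ and only affects the terms in D and lam.
      · refine ⟨θ + Real.log (m' / m), ?_⟩
        have hr : 0 < m' / m := by positivity
        have hr1 : 1 ≤ m' / m := by rw [le_div_iff₀ hm]; linarith
        have hr2 : m' / m ≤ 1 + κ := by rw [div_le_iff₀ hm]; linarith
        have hl0 : 0 ≤ Real.log (m' / m) := Real.log_nonneg hr1
        have hl1 : Real.log (m' / m) ≤ κ := by
          have := Real.log_le_sub_one_of_pos hr; linarith
        have e1 : Real.exp (θ + Real.log (m' / m)) = Real.exp θ * (m' / m) := by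
          rw [Real.exp_add, Real.exp_log hr]
        have e2 : m' * Real.exp (-(θ + Real.log (m' / m))) = m * Real.exp (-θ) := by
          rw [Real.exp_neg, e1, Real.exp_neg]; field_simp
        have e3 : -(Real.log (m' / m) * D) ≤ κ * |D| := by
          have : -(Real.log (m' / m) * D) ≤ Real.log (m' / m) * |D| := by
            have := neg_abs_le D
            nlinarith
          exact this.trans (mul_le_mul_of_nonneg_right hl1 hD)
        have e4 : Real.exp θ ≤ 1 := by rw [Real.exp_le_one_iff]; linarith
        have e5 : lam * (Real.exp θ * (m' / m) - Real.exp θ) ≤ κ * lam := by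
          have : Real.exp θ * (m' / m) - Real.exp θ ≤ κ := by
            have := Real.exp_pos θ
            nlinarith
          nlinarith
        rw [e1]
        nlinarith
  obtain ⟨θ', h⟩ := key
  exact (ENNReal.ofReal_le_ofReal h).trans
    (ENNReal.ofReal_add_le.trans (add_le_add_left (le_dualCost lam D m' θ') _))

/-- Cost of a slow motion; `s` is the remaining time before an empty queue may be reached. -/
theorem dualCost_le_of_abs_le_one {lam D mu c s : ℝ} (hlam : 0 < lam) (hmu : 0 ≤ mu)
    (hD : |D| ≤ 1) (hc : 0 < c) (hs : 0 < s) (h : c * (-D) * s ≤ mu) :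
    dualCost lam D mu
      ≤ ENNReal.ofReal (lam + mu + |Real.log lam| + |Real.log (c * s)|) := by
  refine dualCost_le_ofReal fun θ => ?_
  -- The function x - a exp x is maximal at x = -log a.
  have hexp : ∀ (a x : ℝ), 0 < a → x - a * Real.exp x ≤ |Real.log a| := by
    intro a x ha
    have h1 := Real.log_le_sub_one_of_pos (show 0 < a * Real.exp x by positivity)
    rw [Real.log_mul ha.ne' (Real.exp_pos x).ne', Real.log_exp] at h1
    have := neg_abs_le (Real.log a)
    linarith
  have hp := Real.exp_pos θ
  have hp' := Real.exp_pos (-θ)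
  have a1 := abs_nonneg (Real.log lam)
  have a2 := abs_nonneg (Real.log (c * s))
  obtain ⟨hD1, hD2⟩ := abs_le.mp hD
  rcases le_total 0 θ with h0 | h0
  · have h1 := hexp lam θ hlam
    have : θ * D ≤ θ := by nlinarith
    nlinarith
  · have h1 : 1 ≤ Real.exp (-θ) := Real.one_le_exp (by linarith)
    rcases le_total 0 D with hD0 | hD0
    · have : θ * D ≤ 0 := mul_nonpos_of_nonpos_of_nonneg h0 hD0
      nlinarith
    -- The lower bound for mu is proportional to -D, so -D ≤ 1 factors out of the unbounded terms
    -- and leaves a logarithm of c s.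
    · have h2 := hexp (c * s) (-θ) (by positivity)
      have h3 : c * (-D) * s * Real.exp (-θ) ≤ mu * Real.exp (-θ) :=
        mul_le_mul_of_nonneg_right h hp'.le
      have h4 : (-D) * (-θ - c * s * Real.exp (-θ)) ≤ |Real.log (c * s)| := by
        refine (mul_le_mul_of_nonneg_left h2 (by linarith)).trans ?_
        nlinarith
      nlinarith

attribute [irreducible] dualCost

/-! ### Coordinates, continuity and measurability of absolutely continuous paths. -/

theorem AbsolutelyContinuousOnInterval.coe_apply {ι : Type*} [Fintype ι] {f : ℝ → ι → ℝ≥0}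
    {a b : ℝ} (h : AbsolutelyContinuousOnInterval f a b) (e : ι) :
    AbsolutelyContinuousOnInterval (fun t => (f t e : ℝ)) a b := by
  rw [absolutelyContinuousOnInterval_iff] at h ⊢
  intro ε hε
  obtain ⟨δ, hδ, hE⟩ := h ε hε
  refine ⟨δ, hδ, fun E hmem hlt => lt_of_le_of_lt ?_ (hE E hmem hlt)⟩
  exact Finset.sum_le_sum fun i _ => dist_le_pi_dist (f (E.2 i).1) (f (E.2 i).2) e

theorem AbsolutelyContinuousOnInterval.continuousOn_pi {ι : Type*} [Fintype ι]
    {f : ℝ → ι → ℝ≥0} {a b : ℝ} (h : AbsolutelyContinuousOnInterval f a b) :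
    ContinuousOn f (uIcc a b) := by
  refine _root_.continuousOn_pi.2 fun e => ?_
  have h1 : ContinuousOn (fun t => ((f t e : ℝ≥0) : ℝ)) (uIcc a b) :=
    (h.coe_apply e).continuousOn
  exact NNReal.isEmbedding_coe.continuousOn_iff.2 h1
theorem measurable_of_continuousOn_of_eqOn_zero {X : Type*} [TopologicalSpace X]
    [MeasurableSpace X] [BorelSpace X] [Zero X] {f : ℝ → X} {s : Set ℝ} (hs : MeasurableSet s)
    (hf : ContinuousOn f s) (h0 : ∀ t ∉ s, f t = 0) : Measurable f := by
  refine measurable_of_restrict_of_restrict_compl hs hf.domRestrict.measurable ?_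
  have : sᶜ.domRestrict f = fun _ => 0 := funext fun t => h0 t t.2
  rw [this]
  exact measurable_const

namespace StarNetwork

variable {N : ℕ} (net : StarNetwork N)

/-! ### Loads, active routes and service rates. -/

section LoadsAndRates

theorem load_nonneg (x : net.State) (i : Fin N) : 0 ≤ net.load x i :=
  Finset.sum_nonneg fun _ _ => NNReal.coe_nonneg _

theorem coe_le_load (x : net.State) {e : net.Route} {i : Fin N} (h : i ∈ e.1) :
    (x e : ℝ) ≤ net.load x i := by
  classical
  unfold load
  exact Finset.single_le_sum (f := fun e => (x e : ℝ)) (fun _ _ => NNReal.coe_nonneg _)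
    (by simpa using h)

theorem continuous_load (i : Fin N) : Continuous fun x : net.State => net.load x i := by
  unfold load
  fun_prop

/-- The number of routes bounds the Lipschitz constant of the loads. -/
theorem abs_load_sub_le (x y : net.State) (i : Fin N) {r : ℝ} (hr : 0 ≤ r)
    (h : ∀ e, i ∈ e.1 → |(x e : ℝ) - y e| ≤ r) :
    |net.load x i - net.load y i| ≤ Fintype.card net.Route * r := by
  classical
  unfold load
  rw [← Finset.sum_sub_distrib]
  refine (Finset.abs_sum_le_sum_abs _ _).trans ?_
  refine (Finset.sum_le_card_nsmul _ _ r fun e he => h e (by simpa using he)).trans ?_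
  rw [nsmul_eq_mul]
  gcongr
  exact_mod_cast Finset.card_le_univ _

theorem load_pos_iff (x : net.State) (i : Fin N) :
    0 < net.load x i ↔ ∃ f : net.Route, i ∈ f.1 ∧ 0 < x f := by
  classical
  constructor
  · intro h
    by_contra! hc
    have : net.load x i = 0 := by
      unfold load
      refine Finset.sum_eq_zero fun e he => ?_
      have := hc e (by simpa using he)
      simpa using this
    exact h.ne' this
  · rintro ⟨f, hf, hx⟩
    exact lt_of_lt_of_le (by exact_mod_cast hx) (net.coe_le_load x hf)

/-- A route is active if one of its links carries some load. -/
def Active (e : net.Route) (x : net.State) : Prop := ∃ i ∈ e.1, 0 < net.load x i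

/-- Turns membership in the face or its jammed neighbours into a condition on the loads, which is
open and so stable under perturbation of the state. -/
theorem mem_face_union_jammed_iff (x : net.State) (e : net.Route) :
    e ∈ net.face x ∪ net.jammed x ↔ net.Active e x := by
  have hne : ∃ i, i ∈ e.1 := ⟨_, e.1.out_fst_mem⟩
  unfold Active
  simp only [load_pos_iff]
  constructor
  · rintro (h | ⟨_, f, hf, i, hi, hi'⟩)
    · exact hne.elim fun i hi => ⟨i, hi, e, hi, h⟩
    · exact ⟨i, hi, f, hi', hf⟩
  · rintro ⟨i, hi, f, hf, hx⟩
    by_cases h : e ∈ net.face x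
    · exact Or.inl h
    · exact Or.inr ⟨h, f, hx, i, hi, hf⟩

theorem active_of_pos {e : net.Route} {x : net.State} (h : 0 < x e) : net.Active e x := by
  rw [← mem_face_union_jammed_iff]
  exact Or.inl h

theorem isOpen_setOf_active (e : net.Route) : IsOpen {x | net.Active e x} := by
  have : {x | net.Active e x} = ⋃ i ∈ e.1, {x | 0 < net.load x i} := by
    ext x; simp [Active]
  rw [this]
  exact isOpen_biUnion fun i _ => isOpen_lt continuous_const (net.continuous_load i)

theorem exists_serviceRate_eq (e : net.Route) :
    ∃ i j, i ∈ e.1 ∧ j ∈ e.1 ∧ (∀ k ∈ e.1, k = i ∨ k = j) ∧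
      ∀ x : net.State, net.serviceRate x e = net.size e.1 * ((x e : ℝ) *
        min (net.capacity i / net.load x i) (net.capacity j / net.load x j)) := by
  obtain ⟨e, he⟩ := e
  induction e using Sym2.ind with
  | _ i j =>
    refine ⟨i, j, by simp, by simp, by simp, fun x => ?_⟩
    simp [serviceRate]

theorem serviceRate_nonneg (x : net.State) (e : net.Route) : 0 ≤ net.serviceRate x e := by
  obtain ⟨i, j, -, -, -, h⟩ := net.exists_serviceRate_eq e
  rw [h]
  have h1 := net.size_pos e.1
  have h2 := net.load_nonneg x i
  have h3 := net.load_nonneg x j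
  have h4 := net.capacity_pos i
  have h5 := net.capacity_pos j
  have : 0 ≤ min (net.capacity i / net.load x i) (net.capacity j / net.load x j) :=
    le_min (by positivity) (by positivity)
  positivity

theorem serviceRate_eq_zero {x : net.State} {e : net.Route} (h : x e = 0) :
    net.serviceRate x e = 0 := by
  simp [serviceRate, h]

/-- A common bound for the arrival rates and for the service rates. -/
noncomputable def rateBound : ℝ :=
  1 + ∑ e : net.Route, (net.arrival e.1 + ∑ i, net.size e.1 * net.capacity i)

theorem size_mul_capacity_le (e : net.Route) (i : Fin N) :
    net.size e.1 * net.capacity i ≤ net.rateBound := by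
  have h0 : ∀ (f : net.Route) (k : Fin N), 0 ≤ net.size f.1 * net.capacity k := fun f k =>
    (mul_pos (net.size_pos _) (net.capacity_pos _)).le
  have h1 := Finset.single_le_sum (f := fun k => net.size e.1 * net.capacity k)
    (fun k _ => h0 e k) (Finset.mem_univ i)
  have h2 := Finset.single_le_sum
    (f := fun f : net.Route => net.arrival f.1 + ∑ k, net.size f.1 * net.capacity k)
    (fun f _ => add_nonneg (net.arrival_nonneg _) (Finset.sum_nonneg fun k _ => h0 f k))
    (Finset.mem_univ e)
  have h3 := net.arrival_nonneg e.1
  unfold rateBound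
  linarith

theorem arrival_le (e : net.Route) : net.arrival e.1 ≤ net.rateBound := by
  have h0 : ∀ (f : net.Route) (k : Fin N), 0 ≤ net.size f.1 * net.capacity k := fun f k =>
    (mul_pos (net.size_pos _) (net.capacity_pos _)).le
  have h1 : 0 ≤ ∑ k, net.size e.1 * net.capacity k := Finset.sum_nonneg fun k _ => h0 e k
  have h2 := Finset.single_le_sum
    (f := fun f : net.Route => net.arrival f.1 + ∑ k, net.size f.1 * net.capacity k)
    (fun f _ => add_nonneg (net.arrival_nonneg _) (Finset.sum_nonneg fun k _ => h0 f k))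
    (Finset.mem_univ e)
  unfold rateBound
  linarith

theorem one_le_rateBound : 1 ≤ net.rateBound := by
  have h0 : ∀ (f : net.Route) (k : Fin N), 0 ≤ net.size f.1 * net.capacity k := fun f k =>
    (mul_pos (net.size_pos _) (net.capacity_pos _)).le
  have : 0 ≤ ∑ e : net.Route, (net.arrival e.1 + ∑ i, net.size e.1 * net.capacity i) :=
    Finset.sum_nonneg fun f _ =>
      add_nonneg (net.arrival_nonneg _) (Finset.sum_nonneg fun k _ => h0 f k)
  unfold rateBound
  linarith

theorem rateBound_pos : 0 < net.rateBound := lt_of_lt_of_le one_pos net.one_le_rateBound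

/-- The minimum is at most C_i / x_i for either link i of the route. So one loaded link suffices to
make the rate small when the route is nearly empty. -/
theorem serviceRate_mul_load_le (x : net.State) {e : net.Route} {i : Fin N} (hi : i ∈ e.1) :
    net.serviceRate x e * net.load x i ≤ net.rateBound * x e := by
  obtain ⟨j, k, -, -, hjk, h⟩ := net.exists_serviceRate_eq e
  rcases eq_or_lt_of_le (net.load_nonneg x i) with h0 | h0
  · rw [← h0, mul_zero]
    exact mul_nonneg net.rateBound_pos.le (NNReal.coe_nonneg _)
  have hmin : min (net.capacity j / net.load x j) (net.capacity k / net.load x k)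
      ≤ net.capacity i / net.load x i := by
    rcases hjk i hi with rfl | rfl
    · exact min_le_left _ _
    · exact min_le_right _ _
  have hx := NNReal.coe_nonneg (x e)
  have hs := net.size_pos e.1
  calc net.serviceRate x e * net.load x i
      ≤ net.size e.1 * ((x e : ℝ) * (net.capacity i / net.load x i)) * net.load x i := by
        rw [h]; gcongr
    _ = net.size e.1 * net.capacity i * x e := by field_simp
    _ ≤ net.rateBound * x e := by
        gcongr
        exact net.size_mul_capacity_le e i

theorem serviceRate_le (x : net.State) (e : net.Route) :
    net.serviceRate x e ≤ net.rateBound := by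
  have hi := e.1.out_fst_mem
  set i := e.1.out.1
  have h1 := net.coe_le_load x hi
  rcases eq_or_lt_of_le (NNReal.coe_nonneg (x e)) with h0 | h0
  · rw [net.serviceRate_eq_zero (by exact_mod_cast h0.symm)]
    exact net.rateBound_pos.le
  · have h2 := net.serviceRate_mul_load_le x hi
    have h3 : net.rateBound * x e ≤ net.rateBound * net.load x i :=
      mul_le_mul_of_nonneg_left h1 net.rateBound_pos.le
    exact le_of_mul_le_mul_right (h2.trans h3) (h0.trans_le h1)

theorem measurable_serviceRate (e : net.Route) :
    Measurable fun x : net.State => net.serviceRate x e := by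
  obtain ⟨i, j, -, -, -, h⟩ := net.exists_serviceRate_eq e
  simp only [h]
  have hi := (net.continuous_load i).measurable
  have hj := (net.continuous_load j).measurable
  fun_prop

/-- Lower bound for the service rate in a bounded region. -/
theorem exists_mul_le_serviceRate (R : ℝ) :
    ∃ c : ℝ, 0 < c ∧ ∀ (x : net.State) (e : net.Route), (∀ f, (x f : ℝ) ≤ R) →
      c * x e ≤ net.serviceRate x e := by
  have key : ∀ e : net.Route, ∃ c : ℝ, 0 < c ∧ ∀ x : net.State, (∀ f, (x f : ℝ) ≤ R) →
      c * x e ≤ net.serviceRate x e := by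
    intro e
    obtain ⟨i, j, hi, hj, -, h⟩ := net.exists_serviceRate_eq e
    set M : ℝ := Fintype.card net.Route * |R| + 1
    have hM : 0 < M := by positivity
    have hci := net.capacity_pos i
    have hcj := net.capacity_pos j
    have hs := net.size_pos e.1
    refine ⟨net.size e.1 * min (net.capacity i / M) (net.capacity j / M), by positivity,
      fun x hx => ?_⟩
    have hload : ∀ k, net.load x k ≤ M := by
      intro k
      have := net.abs_load_sub_le x 0 k (abs_nonneg R) (fun f _ => by
        simpa using (hx f).trans (le_abs_self R))
      have h0 : net.load (0 : net.State) k = 0 := by simp [load]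
      rw [h0, sub_zero] at this
      exact (le_abs_self _).trans (this.trans (by simp [M]))
    rcases eq_or_lt_of_le (NNReal.coe_nonneg (x e)) with h0 | h0
    · rw [← h0, mul_zero]; exact net.serviceRate_nonneg x e
    have hli := h0.trans_le (net.coe_le_load x hi)
    have hlj := h0.trans_le (net.coe_le_load x hj)
    have hi2 := hload i
    have hj2 := hload j
    rw [h, mul_assoc, mul_comm (min _ _)]
    gcongr
  choose c hc h using key
  rcases isEmpty_or_nonempty net.Route with hE | hE
  · exact ⟨1, one_pos, fun x e => (hE.false e).elim⟩
  · refine ⟨Finset.univ.inf' Finset.univ_nonempty c, ?_, fun x e hx => ?_⟩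
    · rw [Finset.lt_inf'_iff]
      exact fun e _ => hc e
    · refine le_trans ?_ (h e x hx)
      gcongr
      exact Finset.inf'_le _ (Finset.mem_univ e)

/-- Comparison of the service rates at two neighbouring points. -/
theorem serviceRate_le_mul {x y : net.State} {e : net.Route} {κ : ℝ} (hκ : 0 ≤ κ)
    (hxy : (x e : ℝ) ≤ (1 + κ) * y e) (hx : ∀ i ∈ e.1, 0 < net.load x i)
    (hy : ∀ i ∈ e.1, 0 < net.load y i)
    (h : ∀ i ∈ e.1, net.load y i ≤ (1 + κ) * net.load x i) :
    net.serviceRate x e ≤ (1 + κ) ^ 2 * net.serviceRate y e := by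
  obtain ⟨i, j, hi, hj, -, heq⟩ := net.exists_serviceRate_eq e
  have key : ∀ k ∈ e.1, net.capacity k / net.load x k
      ≤ (1 + κ) * (net.capacity k / net.load y k) := by
    intro k hk
    have h1 := hx k hk
    have h2 := hy k hk
    have h3 := net.capacity_pos k
    rw [div_le_iff₀ h1, mul_assoc, div_mul_eq_mul_div, mul_div_assoc', le_div_iff₀ h2]
    nlinarith [h k hk]
  have hmin : min (net.capacity i / net.load x i) (net.capacity j / net.load x j) ≤
      (1 + κ) * min (net.capacity i / net.load y i) (net.capacity j / net.load y j) := by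
    rw [mul_min_of_nonneg _ _ (by linarith)]
    exact min_le_min (key i hi) (key j hj)
  have hs := net.size_pos e.1
  have hx0 := NNReal.coe_nonneg (x e)
  have hy0 := NNReal.coe_nonneg (y e)
  have hm : 0 ≤ min (net.capacity i / net.load x i) (net.capacity j / net.load x j) :=
    le_min (div_pos (net.capacity_pos i) (hx i hi)).le (div_pos (net.capacity_pos j) (hx j hj)).le
  rw [heq, heq]
  calc net.size e.1 * ((x e : ℝ) *
        min (net.capacity i / net.load x i) (net.capacity j / net.load x j))
      ≤ net.size e.1 * (((1 + κ) * y e) * ((1 + κ) *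
        min (net.capacity i / net.load y i) (net.capacity j / net.load y j))) := by gcongr
    _ = _ := by ring

/-- If the route is empty but some link i is loaded, the rate nearby is at most a constant times y e
divided by the load of i, which tends to 0. If both links are empty the rate does jump, so activity
cannot be dropped. -/
theorem continuousAt_serviceRate {e : net.Route} {x : net.State} (h : net.Active e x) :
    ContinuousAt (fun y : net.State => net.serviceRate y e) x := by
  have hxe : Continuous fun y : net.State => ((y e : ℝ≥0) : ℝ) := by fun_prop
  by_cases hx : x e = 0
  · obtain ⟨i, hi, hl⟩ := h
    have h0 : net.serviceRate x e = 0 := net.serviceRate_eq_zero hx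
    have hlim : Tendsto (fun y : net.State => net.rateBound * y e / net.load y i) (𝓝 x)
        (𝓝 (net.rateBound * x e / net.load x i)) :=
      ((hxe.tendsto x).const_mul _).div ((net.continuous_load i).tendsto x) hl.ne'
    rw [ContinuousAt, h0]
    rw [hx] at hlim
    refine tendsto_of_tendsto_of_tendsto_of_le_of_le' tendsto_const_nhds
      (by simpa using hlim) (Eventually.of_forall fun y => net.serviceRate_nonneg y e) ?_
    filter_upwards [(net.continuous_load i).tendsto x |>.eventually (lt_mem_nhds hl)] with y hy
    rw [le_div_iff₀ hy]
    exact net.serviceRate_mul_load_le y hi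
  · obtain ⟨i, j, hi, hj, -, heq⟩ := net.exists_serviceRate_eq e
    have hpos : (0 : ℝ) < x e := by
      have := pos_iff_ne_zero.mpr hx
      exact_mod_cast this
    simp only [heq]
    refine ContinuousAt.mul continuousAt_const (hxe.continuousAt.mul (Filter.Tendsto.min ?_ ?_))
    · exact continuousAt_const.div (net.continuous_load i).continuousAt
        (hpos.trans_le (net.coe_le_load x hi)).ne'
    · exact continuousAt_const.div (net.continuous_load j).continuousAt
        (hpos.trans_le (net.coe_le_load x hj)).ne'

end LoadsAndRates

/-! ### The cost of a path per unit of time, route by route. -/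

section Densities

/-- The contribution of the route `e` to the cost of the path `ψ` at time `t`. -/
noncomputable def routeDensity (ψ : ℝ → net.State) (e : net.Route) (t : ℝ) : ℝ≥0∞ :=
  open Classical in
  if net.Active e (ψ t) then
    dualCost (net.arrival e.1) (deriv (fun s => (ψ s e : ℝ)) t) (net.serviceRate (ψ t) e)
  else 0

/-- The cost of the path `ψ` per unit of time. -/
noncomputable def density (ψ : ℝ → net.State) (t : ℝ) : ℝ≥0∞ :=
  net.localRate (ψ t) fun e => deriv (fun s => (ψ s e : ℝ)) t

theorem density_eq_sum (ψ : ℝ → net.State) (t : ℝ) :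
    net.density ψ t = ∑ e, net.routeDensity ψ e t := by
  classical
  unfold density localRate routeDensity
  rw [Finset.sum_filter]
  refine Finset.sum_congr rfl fun e _ => ?_
  by_cases h : net.Active e (ψ t)
  · rw [if_pos h, if_pos ((net.mem_face_union_jammed_iff _ _).2 h),
      queueCost_eq_dualCost _ e.2.2 (net.serviceRate_nonneg _ _)]
  · rw [if_neg h, if_neg (mt (net.mem_face_union_jammed_iff _ _).1 h)]

theorem routeDensity_le_density (ψ : ℝ → net.State) (e : net.Route) (t : ℝ) :
    net.routeDensity ψ e t ≤ net.density ψ t := by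
  rw [density_eq_sum]
  exact Finset.single_le_sum (f := fun e => net.routeDensity ψ e t) (fun _ _ => zero_le)
    (Finset.mem_univ e)

theorem measurableSet_active {ψ : ℝ → net.State} (hψ : Measurable ψ) (e : net.Route) :
    MeasurableSet {t | net.Active e (ψ t)} :=
  hψ (net.isOpen_setOf_active e).measurableSet

theorem measurable_routeCost {ψ : ℝ → net.State} (hψ : Measurable ψ) (e : net.Route) :
    Measurable fun t => dualCost (net.arrival e.1) (deriv (fun s => (ψ s e : ℝ)) t)
      (net.serviceRate (ψ t) e) := by
  have h1 : Measurable fun t => net.serviceRate (ψ t) e :=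
    (net.measurable_serviceRate e).comp hψ
  have h2 : Measurable (deriv fun s => (ψ s e : ℝ)) := measurable_deriv _
  have h3 := h2.prodMk h1
  exact (measurable_dualCost (net.arrival e.1)).comp h3

theorem routeDensity_eq_indicator (ψ : ℝ → net.State) (e : net.Route) :
    net.routeDensity ψ e = {t | net.Active e (ψ t)}.indicator fun t =>
      dualCost (net.arrival e.1) (deriv (fun s => (ψ s e : ℝ)) t) (net.serviceRate (ψ t) e) := by
  funext t
  by_cases h : net.Active e (ψ t)
  · rw [routeDensity, if_pos h, indicator_of_mem (show t ∈ {t | net.Active e (ψ t)} from h)]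
  · rw [routeDensity, if_neg h, indicator_of_notMem (show t ∉ {t | net.Active e (ψ t)} from h)]

theorem measurable_routeDensity {ψ : ℝ → net.State} (hψ : Measurable ψ) (e : net.Route) :
    Measurable (net.routeDensity ψ e) := by
  rw [routeDensity_eq_indicator]
  exact (net.measurable_routeCost hψ e).indicator (net.measurableSet_active hψ e)

theorem measurable_density {ψ : ℝ → net.State} (hψ : Measurable ψ) :
    Measurable (net.density ψ) := by
  have : net.density ψ = fun t => ∑ e, net.routeDensity ψ e t :=
    funext fun t => net.density_eq_sum ψ t
  rw [this]
  exact Finset.measurable_sum _ fun e _ => net.measurable_routeDensity hψ e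

/-- A nonnegative function has a minimum at each of its zeros. -/
theorem deriv_eq_zero_of_eq_zero {ψ : ℝ → net.State} {e : net.Route} {t : ℝ} (h : ψ t e = 0) :
    deriv (fun s => (ψ s e : ℝ)) t = 0 := by
  refine IsLocalMin.deriv_eq_zero (Eventually.of_forall fun s => ?_)
  simp [h]

/-- An active route is controlled by its own cost, and an inactive one is empty, so its velocity is
0. Hence the cost controls all coordinates although the local rate omits some of them. -/
theorem mul_abs_deriv_le (ψ : ℝ → net.State) (e : net.Route) (t : ℝ) {κ : ℝ} (hκ : 0 ≤ κ) :
    ENNReal.ofReal (κ * |deriv (fun s => (ψ s e : ℝ)) t|)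
      ≤ net.routeDensity ψ e t + ENNReal.ofReal (2 * net.rateBound * Real.exp κ) := by
  by_cases h : net.Active e (ψ t)
  · rw [routeDensity, if_pos h]
    refine (mul_abs_le_dualCost_add (net.arrival_nonneg e.1)
      (net.serviceRate_nonneg (ψ t) e) hκ).trans ?_
    gcongr
    have := net.arrival_le e
    have := net.serviceRate_le (ψ t) e
    linarith
  · have h0 : ψ t e = 0 := by
      by_contra hc
      exact h (net.active_of_pos (pos_iff_ne_zero.mpr hc))
    rw [net.deriv_eq_zero_of_eq_zero h0]
    simp

end Densities

variable {net} {T : ℝ}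

theorem pathRate_eq_of_isAC {φ : net.CadlagPath T} (h : φ.IsAC) :
    pathRate φ = ∫⁻ t in Icc 0 T, net.density φ.extend t := by
  rw [pathRate, if_pos h]; rfl

theorem isAC_of_pathRate_lt_top {φ : net.CadlagPath T} (h : pathRate φ < ⊤) : φ.IsAC := by
  by_contra hc
  rw [pathRate, if_neg hc] at h
  exact lt_irrefl _ h

theorem CadlagPath.extend_apply (φ : net.CadlagPath T) {t : ℝ} (h : t ∈ Icc (0 : ℝ) T) :
    φ.extend t = φ ⟨t, h⟩ := dif_pos h

theorem CadlagPath.extend_coe (φ : net.CadlagPath T) (t : Icc (0 : ℝ) T) :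
    φ.extend t = φ t := dif_pos t.2

theorem CadlagPath.IsAC.measurable_extend {φ : net.CadlagPath T} (h : φ.IsAC) (hT : 0 ≤ T) :
    Measurable φ.extend := by
  refine measurable_of_continuousOn_of_eqOn_zero (s := Icc 0 T) measurableSet_Icc ?_
    (fun t ht => dif_neg ht)
  have := AbsolutelyContinuousOnInterval.continuousOn_pi (f := φ.extend) h
  rwa [uIcc_of_le hT] at this

end StarNetwork

/-! ### Integrated Fenchel–Young and Jensen inequalities. -/

theorem ofReal_integral_le_lintegral_ofReal {α : Type*} [MeasurableSpace α] {μ : Measure α}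
    {f : α → ℝ} (hf : Integrable f μ) :
    ENNReal.ofReal (∫ x, f x ∂μ) ≤ ∫⁻ x, ENNReal.ofReal (f x) ∂μ := by
  rw [integral_eq_lintegral_pos_part_sub_lintegral_neg_part hf]
  refine (ENNReal.ofReal_le_ofReal (sub_le_self _ ENNReal.toReal_nonneg)).trans ?_
  exact ENNReal.ofReal_toReal_le

theorem AbsolutelyContinuousOnInterval.subinterval {X : Type*} [PseudoMetricSpace X]
    {f : ℝ → X} {a b c d : ℝ} (hf : AbsolutelyContinuousOnInterval f a b) (hac : a ≤ c)
    (hcd : c ≤ d) (hdb : d ≤ b) : AbsolutelyContinuousOnInterval f c d := by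
  refine hf.mono ?_
  rw [uIcc_of_le hcd, uIcc_of_le (hac.trans (hcd.trans hdb))]
  exact Icc_subset_Icc hac hdb

/-- Integrated form of the inequality of Fenchel and Young for the cost of a queue. -/
theorem ofReal_le_lintegral_dualCost {f m : ℝ → ℝ} {a b : ℝ} (lam θ : ℝ) (hab : a ≤ b)
    (hf : AbsolutelyContinuousOnInterval f a b) (hm : IntervalIntegrable m volume a b) :
    ENNReal.ofReal (θ * (f b - f a) - lam * (Real.exp θ - 1) * (b - a)
        - (Real.exp (-θ) - 1) * ∫ t in a..b, m t)
      ≤ ∫⁻ t in Icc a b, dualCost lam (deriv f t) (m t) := by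
  have hd := hf.intervalIntegrable_deriv
  have e1 : θ * (f b - f a) - lam * (Real.exp θ - 1) * (b - a)
        - (Real.exp (-θ) - 1) * ∫ t in a..b, m t =
      ∫ t in a..b, (θ * deriv f t - lam * (Real.exp θ - 1) - m t * (Real.exp (-θ) - 1)) := by
    rw [intervalIntegral.integral_sub, intervalIntegral.integral_sub,
      intervalIntegral.integral_const_mul,
      intervalIntegral.integral_mul_const (Real.exp (-θ) - 1), intervalIntegral.integral_const, hf.integral_deriv_eq_sub, smul_eq_mul]
    · ring
    · exact hd.const_mul θ
    · exact intervalIntegrable_const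
    · exact (hd.const_mul θ).sub intervalIntegrable_const
    · exact hm.mul_const _
  have hi : IntervalIntegrable
      (fun t => θ * deriv f t - lam * (Real.exp θ - 1) - m t * (Real.exp (-θ) - 1))
      volume a b := ((hd.const_mul θ).sub intervalIntegrable_const).sub (hm.mul_const _)
  rw [intervalIntegrable_iff_integrableOn_Ioc_of_le hab] at hi
  rw [e1, intervalIntegral.integral_of_le hab]
  refine (ofReal_integral_le_lintegral_ofReal hi).trans ?_
  refine (lintegral_mono fun t => le_dualCost lam (deriv f t) (m t) θ).trans ?_
  exact lintegral_mono_set Ioc_subset_Icc_self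

/-- Jensen's inequality for the cost of a queue. -/
theorem ofReal_mul_dualCost_average_le {f m : ℝ → ℝ} {a b : ℝ} (lam : ℝ) (hab : a < b)
    (hf : AbsolutelyContinuousOnInterval f a b) (hm : IntervalIntegrable m volume a b) :
    ENNReal.ofReal (b - a) *
        dualCost lam ((f b - f a) / (b - a)) ((∫ t in a..b, m t) / (b - a))
      ≤ ∫⁻ t in Icc a b, dualCost lam (deriv f t) (m t) := by
  have hba : 0 < b - a := sub_pos.2 hab
  rw [mul_comm, ← ENNReal.le_div_iff_mul_le (Or.inl (by simpa using hba)) (Or.inl (by simp))]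
  -- For a fixed θ the claim is the integrated Fenchel–Young inequality divided by b - a.
  refine dualCost_le fun θ => ?_
  rw [ENNReal.le_div_iff_mul_le (Or.inl (by simpa using hba)) (Or.inl (by simp)),
    ← ENNReal.ofReal_mul' hba.le]
  refine le_trans (ENNReal.ofReal_le_ofReal (le_of_eq ?_))
    (ofReal_le_lintegral_dualCost lam θ hab.le hf hm)
  field_simp

/-! ### Uniform absolute continuity of paths of bounded cost. -/

namespace StarNetwork

variable {N : ℕ} {net : StarNetwork N}

/-- The coordinates of `ψ` are absolutely continuous on `[a, b]`. -/
def CoordAC (ψ : ℝ → net.State) (a b : ℝ) : Prop :=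
  ∀ e, AbsolutelyContinuousOnInterval (fun t => (ψ t e : ℝ)) a b

theorem CoordAC.subinterval {ψ : ℝ → net.State} {a b c d : ℝ} (h : CoordAC ψ a b)
    (hac : a ≤ c) (hcd : c ≤ d) (hdb : d ≤ b) : CoordAC ψ c d :=
  fun e => (h e).subinterval hac hcd hdb

theorem CadlagPath.IsAC.coordAC {T : ℝ} {φ : net.CadlagPath T} (h : φ.IsAC) :
    CoordAC φ.extend 0 T :=
  fun e => AbsolutelyContinuousOnInterval.coe_apply (f := φ.extend) h e

/-- The displacement of a path is controlled by its cost. -/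
theorem mul_dist_le_lintegral_density {ψ : ℝ → net.State} {a b : ℝ} (hab : a ≤ b)
    (hψ : CoordAC ψ a b) {κ : ℝ} (hκ : 0 < κ) :
    ENNReal.ofReal (κ * dist (ψ b) (ψ a)) ≤
      ∫⁻ t in Ioo a b,
        (net.density ψ t + ENNReal.ofReal (2 * net.rateBound * Real.exp κ)) := by
  set R := ∫⁻ t in Ioo a b,
        (net.density ψ t + ENNReal.ofReal (2 * net.rateBound * Real.exp κ))
  have key : ∀ e, ENNReal.ofReal (κ * |(ψ b e : ℝ) - ψ a e|) ≤ R := by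
    intro e
    have hd := (hψ e).intervalIntegrable_deriv
    rw [← (hψ e).integral_deriv_eq_sub, ← abs_of_pos hκ, ← abs_mul,
      ← intervalIntegral.integral_const_mul, intervalIntegral.integral_of_le hab,
      integral_Ioc_eq_integral_Ioo]
    rw [intervalIntegrable_iff_integrableOn_Ioo_of_le hab] at hd
    refine (ENNReal.ofReal_le_ofReal abs_integral_le_integral_abs).trans ?_
    refine (ofReal_integral_le_lintegral_ofReal (hd.const_mul _).abs).trans ?_
    refine lintegral_mono fun t => ?_
    simp only
    rw [abs_mul, abs_of_pos hκ]
    refine (net.mul_abs_deriv_le ψ e t hκ.le).trans ?_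
    gcongr
    exact net.routeDensity_le_density ψ e t
  rcases eq_or_ne R ⊤ with h | h
  · rw [h]; exact le_top
  · rw [ENNReal.ofReal_le_iff_le_toReal h, mul_comm, ← le_div_iff₀ hκ,
      dist_pi_le_iff (div_nonneg ENNReal.toReal_nonneg hκ.le)]
    intro e
    have := key e
    rw [ENNReal.ofReal_le_iff_le_toReal h] at this
    rw [NNReal.dist_eq, le_div_iff₀ hκ, mul_comm]
    exact this

/-- Paths of bounded cost are uniformly absolutely continuous. -/
theorem exists_forall_sum_dist_le (net : StarNetwork N) (K : ℝ≥0) {ε : ℝ} (hε : 0 < ε) :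
    ∃ δ : ℝ, 0 < δ ∧ ∀ (T : ℝ) (φ : net.CadlagPath T), pathRate φ ≤ K →
        ∀ (n : ℕ) (a b : Fin n → Set.Icc (0 : ℝ) T), (∀ i, a i ≤ b i) →
          (Pairwise fun i j => Disjoint (Set.Ioo (a i : ℝ) (b i)) (Set.Ioo (a j : ℝ) (b j))) →
          ∑ i, ((b i : ℝ) - a i) ≤ δ →
          ∑ i, dist (φ (b i)) (φ (a i)) ≤ ε := by
  -- Here κ ε = K + 1: the cost contributes at most K, and δ = 1 / C makes the exponential
  -- correction at most 1.
  set κ : ℝ := (K + 1) / ε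
  have hκ : 0 < κ := by positivity
  set C : ℝ := 2 * net.rateBound * Real.exp κ
  have hB := net.rateBound_pos
  have hC : 0 < C := by positivity
  refine ⟨1 / C, by positivity, fun T φ hφ n a b hab hdis hsum => ?_⟩
  have hAC := isAC_of_pathRate_lt_top (hφ.trans_lt ENNReal.coe_lt_top)
  have hco := hAC.coordAC
  have h1 : ∀ i, ENNReal.ofReal (κ * dist (φ (b i)) (φ (a i))) ≤
      ∫⁻ t in Ioo (a i : ℝ) (b i), (net.density φ.extend t + ENNReal.ofReal C) := by
    intro i
    have := mul_dist_le_lintegral_density (ψ := φ.extend) (a := a i) (b := b i) (hab i)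
      (hco.subinterval (a i).2.1 (hab i) (b i).2.2) hκ
    rwa [φ.extend_coe, φ.extend_coe] at this
  have h2 : ENNReal.ofReal (∑ i, κ * dist (φ (b i)) (φ (a i))) ≤ K + 1 := by
    rw [ENNReal.ofReal_sum_of_nonneg fun i _ => by positivity]
    refine (Finset.sum_le_sum fun i _ => h1 i).trans ?_
    simp_rw [lintegral_add_right _ measurable_const, setLIntegral_const]
    rw [Finset.sum_add_distrib]
    refine add_le_add ?_ ?_
    · rw [← tsum_fintype (L := .unconditional _),
        ← lintegral_iUnion (fun i => measurableSet_Ioo) hdis]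
      refine (lintegral_mono_set (iUnion_subset fun i => ?_)).trans
        ((pathRate_eq_of_isAC hAC).symm.le.trans hφ)
      exact Ioo_subset_Icc_self.trans (Icc_subset_Icc (a i).2.1 (b i).2.2)
    · simp_rw [Real.volume_Ioo]
      rw [← Finset.mul_sum, ← ENNReal.ofReal_sum_of_nonneg
        (fun i _ => sub_nonneg.2 (hab i)), ← ENNReal.ofReal_mul hC.le, ← ENNReal.ofReal_one]
      refine ENNReal.ofReal_le_ofReal ?_
      calc C * ∑ i, ((b i : ℝ) - a i) ≤ C * (1 / C) := by gcongr
        _ = 1 := by field_simp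
  rw [← Finset.mul_sum] at h2
  have h3 : κ * ∑ i, dist (φ (b i)) (φ (a i)) ≤ K + 1 := by
    have : (K : ℝ≥0∞) + 1 = ENNReal.ofReal (K + 1) := by
      rw [ENNReal.ofReal_add K.coe_nonneg zero_le_one]; simp
    rw [this] at h2
    exact (ENNReal.ofReal_le_ofReal_iff (by positivity)).1 h2
  have h4 : (K + 1 : ℝ) = κ * ε := by simp only [κ]; field_simp
  rw [h4] at h3
  exact le_of_mul_le_mul_left h3 hκ

theorem exists_forall_dist_le (net : StarNetwork N) (K : ℝ≥0) {ε : ℝ} (hε : 0 < ε) :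
    ∃ δ : ℝ, 0 < δ ∧ ∀ (T : ℝ) (φ : net.CadlagPath T), pathRate φ ≤ K →
      ∀ a b : Set.Icc (0 : ℝ) T, dist a b ≤ δ → dist (φ a) (φ b) ≤ ε := by
  obtain ⟨δ, hδ, h⟩ := net.exists_forall_sum_dist_le K hε
  refine ⟨δ, hδ, fun T φ hφ a b hab => ?_⟩
  wlog hle : a ≤ b generalizing a b
  · rw [dist_comm]
    exact this b a (by rwa [dist_comm]) (le_of_not_ge hle)
  have := h T φ hφ 1 (fun _ => a) (fun _ => b) (fun _ => hle)
    (fun i j hij => (hij (Subsingleton.elim i j)).elim) (by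
      rw [dist_comm, Subtype.dist_eq, Real.dist_eq] at hab
      simpa using (le_abs_self _).trans hab)
  rw [dist_comm]
  simpa using this

end StarNetwork

/-! ### Moving averages and their cost. -/

theorem setLIntegral_Icc_eq_comp_add (d : ℝ → ℝ≥0∞) (a b t : ℝ) :
    ∫⁻ s in Icc (t + a) (t + b), d s = ∫⁻ u in Icc a b, d (t + u) := by
  have := (measurePreserving_add_left volume t).setLIntegral_comp_emb
    (measurableEmbedding_addLeft t) d (Icc a b)
  simp only [image_const_add_Icc] at this
  exact this.symm

/-- By Fubini: each time s lies in the window starting at t only for a set of t of length at most h.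
-/
theorem lintegral_average_le {d : ℝ → ℝ≥0∞} (hd : Measurable d) {T h : ℝ} :
    ∫⁻ t in Icc 0 (T - h), ∫⁻ s in Icc t (t + h), d s
      ≤ ENNReal.ofReal h * ∫⁻ s in Icc 0 T, d s := by
  have e1 : ∀ t : ℝ, ∫⁻ s in Icc t (t + h), d s = ∫⁻ u in Icc 0 h, d (t + u) := fun t => by
    rw [← setLIntegral_Icc_eq_comp_add, add_zero]
  simp_rw [e1]
  rw [lintegral_lintegral_swap (by fun_prop)]
  calc ∫⁻ u in Icc 0 h, ∫⁻ t in Icc 0 (T - h), d (t + u)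
      ≤ ∫⁻ _ in Icc 0 h, ∫⁻ s in Icc 0 T, d s := by
        refine setLIntegral_mono measurable_const fun u hu => ?_
        simp_rw [add_comm _ u]
        rw [← setLIntegral_Icc_eq_comp_add]
        refine lintegral_mono_set (Icc_subset_Icc ?_ ?_)
        · linarith [hu.1]
        · linarith [hu.2]
    _ = _ := by
        rw [setLIntegral_const, Real.volume_Icc, sub_zero, mul_comm]

namespace StarNetwork

variable {N : ℕ} {net : StarNetwork N} {T : ℝ}

theorem intervalIntegrable_serviceRate {ψ : ℝ → net.State} (hψ : Measurable ψ) (e : net.Route)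
    (a b : ℝ) : IntervalIntegrable (fun s => net.serviceRate (ψ s) e) volume a b := by
  have hm : Measurable fun s => net.serviceRate (ψ s) e :=
    (net.measurable_serviceRate e).comp hψ
  refine (intervalIntegrable_const (c := net.rateBound)).mono_fun
    hm.aestronglyMeasurable (Eventually.of_forall fun s => ?_)
  simp only
  rw [Real.norm_of_nonneg (net.serviceRate_nonneg _ _),
    Real.norm_of_nonneg net.rateBound_pos.le]
  exact net.serviceRate_le _ _

/-- The cost of the moving average of a path, restricted to the times in `W`. -/
noncomputable def averagedCost (ψ : ℝ → net.State) (e : net.Route) (h : ℝ) (W : Set ℝ) :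
    ℝ → ℝ≥0∞ :=
  W.indicator fun t => dualCost (net.arrival e.1) (((ψ (t + h) e : ℝ) - ψ t e) / h)
    ((∫ s in t..(t + h), net.serviceRate (ψ s) e) / h)

theorem measurable_averagedCost {ψ : ℝ → net.State} (hψ : Measurable ψ) (e : net.Route)
    (h : ℝ) {W : Set ℝ} (hW : MeasurableSet W) : Measurable (averagedCost ψ e h W) := by
  refine Measurable.indicator ?_ hW
  have hc : Continuous fun t => ∫ s in (0 : ℝ)..t, net.serviceRate (ψ s) e :=
    intervalIntegral.continuous_primitive (fun a b => intervalIntegrable_serviceRate hψ e a b) 0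
  have h1 : Measurable fun t => (∫ s in t..(t + h), net.serviceRate (ψ s) e) / h := by
    have : (fun t => (∫ s in t..(t + h), net.serviceRate (ψ s) e) / h) = fun t =>
        ((∫ s in (0 : ℝ)..(t + h), net.serviceRate (ψ s) e)
          - ∫ s in (0 : ℝ)..t, net.serviceRate (ψ s) e) / h := by
      funext t
      rw [intervalIntegral.integral_interval_sub_left
        (intervalIntegrable_serviceRate hψ e _ _) (intervalIntegrable_serviceRate hψ e _ _)]
    rw [this]
    have hc' : Continuous fun t => ∫ s in (0 : ℝ)..(t + h), net.serviceRate (ψ s) e :=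
      hc.comp (continuous_add_const h)
    exact ((hc'.sub hc).div_const h).measurable
  have hψe : Measurable fun t => (ψ t e : ℝ) :=
    measurable_coe_nnreal_real.comp ((measurable_pi_apply e).comp hψ)
  have h2 : Measurable fun t => ((ψ (t + h) e : ℝ) - ψ t e) / h :=
    ((hψe.comp (measurable_add_const h)).sub hψe).div_const h
  exact (measurable_dualCost (net.arrival e.1)).comp (h2.prodMk h1)

/-- Jensen's inequality on the window starting at t. The route has to be active during the whole
window, since its density is set to 0 wherever it is not. -/
theorem averagedCost_le {ψ : ℝ → net.State} (hψ : Measurable ψ) (hAC : CoordAC ψ 0 T)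
    {e : net.Route} {h : ℝ} (hh : 0 < h) {W : Set ℝ} (hW : W ⊆ Icc 0 (T - h))
    (hact : ∀ t ∈ W, ∀ s ∈ Icc t (t + h), net.Active e (ψ s)) {t : ℝ} :
    ENNReal.ofReal h * averagedCost ψ e h W t ≤ ∫⁻ s in Icc t (t + h), net.routeDensity ψ e s := by
  by_cases ht : t ∈ W
  · rw [averagedCost, indicator_of_mem ht]
    have h1 := hW ht
    have h2 := ofReal_mul_dualCost_average_le (net.arrival e.1) (show t < t + h by linarith)
      ((hAC e).subinterval h1.1 (by linarith) (by linarith [h1.2]))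
      (intervalIntegrable_serviceRate hψ e t (t + h))
    rw [add_sub_cancel_left] at h2
    refine h2.trans ?_
    refine setLIntegral_mono (net.measurable_routeDensity hψ e) fun s hs => ?_
    rw [routeDensity, if_pos (hact t ht s hs)]
  · rw [averagedCost, indicator_of_notMem ht, mul_zero]
    exact zero_le

theorem lintegral_sum_averagedCost_le {ψ : ℝ → net.State} (hψ : Measurable ψ)
    (hAC : CoordAC ψ 0 T) {h : ℝ} (hh : 0 < h) {W : net.Route → Set ℝ}
    (hW : ∀ e, W e ⊆ Icc 0 (T - h))
    (hact : ∀ e, ∀ t ∈ W e, ∀ s ∈ Icc t (t + h), net.Active e (ψ s)) :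
    ∫⁻ t, ∑ e, averagedCost ψ e h (W e) t ≤ ∫⁻ t in Icc 0 T, net.density ψ t := by
  have h0 : ENNReal.ofReal h ≠ 0 := by simpa using hh
  rw [← ENNReal.mul_le_mul_iff_right h0 ENNReal.ofReal_ne_top]
  refine le_trans ?_ (lintegral_average_le (net.measurable_density hψ) (h := h))
  have e1 : ∫⁻ t, ∑ e, averagedCost ψ e h (W e) t
      = ∫⁻ t in Icc 0 (T - h), ∑ e, averagedCost ψ e h (W e) t := by
    rw [← lintegral_indicator measurableSet_Icc]
    congr 1
    funext t
    by_cases ht : t ∈ Icc 0 (T - h)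
    · rw [indicator_of_mem ht]
    · rw [indicator_of_notMem ht]
      refine Finset.sum_eq_zero fun e _ => indicator_of_notMem (fun hc => ht (hW e hc)) _
  rw [e1, ← lintegral_const_mul' _ _ ENNReal.ofReal_ne_top]
  refine lintegral_mono fun t => ?_
  simp only
  rw [Finset.mul_sum]
  simp_rw [density_eq_sum]
  rw [lintegral_finsetSum _ fun e _ => net.measurable_routeDensity hψ e]
  exact Finset.sum_le_sum fun e _ => averagedCost_le hψ hAC hh (hW e) (hact e)

end StarNetwork

/-! ### Lower semicontinuity along uniformly convergent sequences. -/

namespace StarNetwork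

variable {N : ℕ} {net : StarNetwork N} {T : ℝ}

theorem abs_load_sub_le_mul_dist (x y : net.State) (i : Fin N) :
    |net.load x i - net.load y i| ≤ Fintype.card net.Route * dist x y :=
  net.abs_load_sub_le x y i dist_nonneg fun e _ => by
    rw [← NNReal.dist_eq]
    exact dist_le_pi_dist x y e

/-- The error h k * r k is small compared with the window, so difference quotients of `u k` converge
to the derivative of ψ; averaged service rates converge because the rate is continuous at active
states. Lower semicontinuity of the cost in the pair then applies. Routes inactive at ψ t add
nothing on the left and something nonnegative on the right. -/
theorem le_liminf_averagedCost {ψ : ℝ → net.State} {u : ℕ → ℝ → net.State} {h : ℕ → ℝ}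
    {W : ℕ → net.Route → Set ℝ} {t : ℝ} (hh : ∀ k, 0 < h k) (hh0 : Tendsto h atTop (𝓝 0))
    (hd : ∀ e, DifferentiableAt ℝ (fun s => (ψ s e : ℝ)) t) {r : ℕ → ℝ}
    (hr : Tendsto r atTop (𝓝 0))
    (hu : ∀ᶠ k in atTop, ∀ s ∈ Icc t (t + h k), dist (u k s) (ψ t) ≤ r k)
    (hu2 : ∀ᶠ k in atTop, ∀ s ∈ Icc t (t + h k), dist (u k s) (ψ s) ≤ h k * r k)
    (hum : ∀ k, Measurable (u k))
    (hW : ∀ e, net.Active e (ψ t) → ∀ᶠ k in atTop, t ∈ W k e) :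
    net.density ψ t ≤ liminf (fun k => ∑ e, averagedCost (u k) e (h k) (W k e) t) atTop := by
  classical
  set A : Finset net.Route := {e | net.Active e (ψ t)}
  have hsum : net.density ψ t = ∑ e ∈ A, dualCost (net.arrival e.1)
      (deriv (fun s => (ψ s e : ℝ)) t) (net.serviceRate (ψ t) e) := by
    rw [density_eq_sum, Finset.sum_filter]
    rfl
  have hlsc : LowerSemicontinuous fun p : net.Route → ℝ × ℝ =>
      ∑ e ∈ A, dualCost (net.arrival e.1) (p e).1 (p e).2 :=
    lowerSemicontinuous_sum fun e _ =>
      LowerSemicontinuous.comp (lowerSemicontinuous_dualCost (net.arrival e.1))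
        (continuous_apply e)
  -- Inactive routes are given the value 0 in both `q` and `p`, since their averaged service rates
  -- need not converge.
  set q : ℕ → net.Route → ℝ × ℝ := fun k e => if e ∈ A then
    (((u k (t + h k) e : ℝ) - u k t e) / h k,
      (∫ s in t..(t + h k), net.serviceRate (u k s) e) / h k) else 0
  set p : net.Route → ℝ × ℝ := fun e => if e ∈ A then
    (deriv (fun s => (ψ s e : ℝ)) t, net.serviceRate (ψ t) e) else 0
  have hlim : Tendsto q atTop (𝓝 p) := by
    refine tendsto_pi_nhds.2 fun e => ?_
    by_cases heA : e ∈ A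
    swap
    · simp only [q, p, if_neg heA]; exact tendsto_const_nhds
    have he : net.Active e (ψ t) := by simpa [A] using heA
    simp only [q, p, if_pos heA]
    refine Tendsto.prodMk_nhds ?_ ?_
    · have h1 : Tendsto (fun k => (h k)⁻¹ • ((ψ (t + h k) e : ℝ) - ψ t e)) atTop
          (𝓝 (deriv (fun s => (ψ s e : ℝ)) t)) := by
        refine (hasDerivAt_iff_tendsto_slope_zero.1 (hd e).hasDerivAt).comp ?_
        exact tendsto_nhdsWithin_iff.2 ⟨hh0, Eventually.of_forall fun k => (hh k).ne'⟩
      have h2 : Tendsto (fun k => ((u k (t + h k) e : ℝ) - u k t e) / h k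
          - (h k)⁻¹ • ((ψ (t + h k) e : ℝ) - ψ t e)) atTop (𝓝 0) := by
        have hr2 : Tendsto (fun k => 2 * r k) atTop (𝓝 0) := by simpa using hr.const_mul 2
        refine squeeze_zero_norm' ?_ hr2
        filter_upwards [hu2] with k hk
        have hk0 := hh k
        have b1 : |(u k (t + h k) e : ℝ) - ψ (t + h k) e| ≤ h k * r k := by
          rw [← NNReal.dist_eq]
          exact (dist_le_pi_dist _ _ e).trans (hk (t + h k) ⟨by linarith, le_rfl⟩)
        have b2 : |(u k t e : ℝ) - ψ t e| ≤ h k * r k := by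
          rw [← NNReal.dist_eq]
          exact (dist_le_pi_dist _ _ e).trans (hk t ⟨le_rfl, by linarith⟩)
        have e1 : ((u k (t + h k) e : ℝ) - u k t e) / h k
          - (h k)⁻¹ • ((ψ (t + h k) e : ℝ) - ψ t e) =
          (((u k (t + h k) e : ℝ) - ψ (t + h k) e) - ((u k t e : ℝ) - ψ t e)) / h k := by
          rw [smul_eq_mul]; field_simp; ring
        rw [e1, Real.norm_eq_abs, abs_div, abs_of_pos hk0, div_le_iff₀ hk0]
        refine (abs_sub _ _).trans ?_
        linarith
      simpa using h2.add h1
    · rw [Metric.tendsto_nhds]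
      intro ε hε
      obtain ⟨ρ, hρ, hc⟩ := Metric.continuousAt_iff.1 (net.continuousAt_serviceRate he) (ε / 2)
        (half_pos hε)
      filter_upwards [hu, hr.eventually (gt_mem_nhds hρ)] with k hk hkρ
      have hk0 := hh k
      have hint := intervalIntegrable_serviceRate (hum k) e t (t + h k)
      have e1 : (∫ s in t..(t + h k), net.serviceRate (u k s) e) / h k - net.serviceRate (ψ t) e
          = (∫ s in t..(t + h k), (net.serviceRate (u k s) e - net.serviceRate (ψ t) e)) / h k := by
        rw [intervalIntegral.integral_sub hint intervalIntegrable_const,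
          intervalIntegral.integral_const, smul_eq_mul]
        field_simp
        ring
      have e2 : ‖∫ s in t..(t + h k), (net.serviceRate (u k s) e - net.serviceRate (ψ t) e)‖
          ≤ ε / 2 * |t + h k - t| := by
        refine intervalIntegral.norm_integral_le_of_norm_le_const fun s hs => ?_
        rw [uIoc_of_le (by linarith)] at hs
        exact (hc ((hk s (Ioc_subset_Icc_self hs)).trans_lt hkρ)).le
      rw [Real.dist_eq, e1, abs_div, abs_of_pos hk0, div_lt_iff₀ hk0]
      rw [Real.norm_eq_abs, add_sub_cancel_left, abs_of_pos hk0] at e2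
      nlinarith
  have hW' : ∀ᶠ k in atTop, ∀ e ∈ A, t ∈ W k e := by
    rw [Filter.eventually_all_finset]
    exact fun e he => hW e (by simpa [A] using he)
  refine le_of_forall_lt fun y hy => ?_
  obtain ⟨z, hyz, hz⟩ := exists_between hy
  refine hyz.trans_le (le_liminf_of_le (by isBoundedDefault) ?_)
  have hz' : z < ∑ e ∈ A, dualCost (net.arrival e.1) (p e).1 (p e).2 := by
    refine hz.trans_eq (hsum.trans (Finset.sum_congr rfl fun e he => ?_))
    simp only [p, if_pos he]
  filter_upwards [hlim.eventually (hlsc p z hz'), hW'] with k hk hkW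
  refine hk.le.trans ?_
  calc ∑ e ∈ A, dualCost (net.arrival e.1) (q k e).1 (q k e).2
      = ∑ e ∈ A, averagedCost (u k) e (h k) (W k e) t := by
        refine Finset.sum_congr rfl fun e he => ?_
        rw [averagedCost, indicator_of_mem (hkW e he)]
        simp only [q, if_pos he]
    _ ≤ _ := Finset.sum_le_sum_of_subset (Finset.subset_univ A)

/-- Lower semicontinuity of the rate function along uniformly convergent sequences. -/
theorem pathRate_le_of_uniform_limit (hT : 0 < T) {φ : net.CadlagPath T} (hφ : φ.IsAC)
    {u : ℕ → net.CadlagPath T} {K : ℝ≥0∞} (hu : ∀ n, (u n).IsAC) (hK : ∀ n, pathRate (u n) ≤ K)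
    (hlim : ∀ ε : ℝ, 0 < ε → ∃ n, ∀ t, dist (u n t) (φ t) ≤ ε) : pathRate φ ≤ K := by
  set ψ := φ.extend with hψdef
  set M : ℝ := Fintype.card net.Route + 1
  have hM : 0 < M := by positivity
  have hcont : ContinuousOn ψ (Icc 0 T) := by
    have := AbsolutelyContinuousOnInterval.continuousOn_pi (f := ψ) hφ
    rwa [uIcc_of_le hT.le] at this
  have huc := isCompact_Icc.uniformContinuousOn_of_continuous hcont
  -- The window h comes first, from the modulus of continuity of ψ; the index n comes second, so
  -- that the uniform error is small even relative to h. Dividing by M turns a distance between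
  -- states into a bound for the change of the loads.
  have hex : ∀ k : ℕ, ∃ (h : ℝ) (n : ℕ), 0 < h ∧ h ≤ 1 / (k + 1 : ℝ) ∧
      (∀ s ∈ Icc 0 T, ∀ t ∈ Icc 0 T, |s - t| ≤ h →
        dist ((u n).extend s) (ψ t) ≤ 1 / (k + 1 : ℝ) / M) ∧
      ∀ s ∈ Icc 0 T, dist ((u n).extend s) (ψ s) ≤ h * (1 / (k + 1 : ℝ)) := by
    intro k
    set r : ℝ := 1 / (k + 1 : ℝ)
    have hr : 0 < r := by positivity
    obtain ⟨δ, hδ, hδ'⟩ := Metric.uniformContinuousOn_iff.1 huc (r / M / 2) (by positivity)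
    set h : ℝ := min r (δ / 2)
    have hh : 0 < h := lt_min hr (by positivity)
    obtain ⟨n, hn⟩ := hlim (min (r / M / 2) (h * r)) (lt_min (by positivity) (by positivity))
    have hn' : ∀ s ∈ Icc 0 T, dist ((u n).extend s) (ψ s) ≤ min (r / M / 2) (h * r) := by
      intro s hs
      rw [hψdef, CadlagPath.extend_apply _ hs, CadlagPath.extend_apply _ hs]
      exact hn _
    refine ⟨h, n, hh, min_le_left _ _, fun s hs t ht hst => ?_, fun s hs =>
      (hn' s hs).trans (min_le_right _ _)⟩
    have h1 := (hn' s hs).trans (min_le_left _ _)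
    have h2 := (hδ' s hs t ht (by
      rw [Real.dist_eq]
      refine hst.trans_lt ((min_le_right _ _).trans_lt (by linarith)))).le
    refine (dist_triangle _ (ψ s) _).trans ?_
    linarith
  choose h n hh hh1 hclose hclose2 using hex
  have hr0 : Tendsto (fun k : ℕ => 1 / (k + 1 : ℝ)) atTop (𝓝 0) :=
    tendsto_one_div_add_atTop_nhds_zero_nat
  have hh0 : Tendsto h atTop (𝓝 0) :=
    squeeze_zero (fun k => (hh k).le) hh1 hr0
  have hψm : Measurable ψ := hφ.measurable_extend hT.le
  have hum : ∀ k, Measurable (u (n k)).extend := fun k => (hu (n k)).measurable_extend hT.le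
  -- A load of at least 1 / (k + 1) for the limit exceeds the change of load between ψ t and the
  -- approximating path on the window, so the route remains active there.
  set W : ℕ → net.Route → Set ℝ := fun k e =>
    Icc 0 (T - h k) ∩ {t | ∃ i ∈ e.1, 1 / (k + 1 : ℝ) ≤ net.load (ψ t) i} with hWdef
  have hWm : ∀ k e, MeasurableSet (W k e) := by
    intro k e
    refine measurableSet_Icc.inter ?_
    have : {t | ∃ i ∈ e.1, 1 / (k + 1 : ℝ) ≤ net.load (ψ t) i}
        = ⋃ i ∈ {i | i ∈ e.1}, {t | 1 / (k + 1 : ℝ) ≤ net.load (ψ t) i} := by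
      ext t; simp
    rw [this]
    refine MeasurableSet.biUnion (Set.to_countable _) fun i _ => ?_
    exact measurableSet_le measurable_const ((net.continuous_load i).measurable.comp hψm)
  have hWact : ∀ k e, ∀ t ∈ W k e, ∀ s ∈ Icc t (t + h k),
      net.Active e ((u (n k)).extend s) := by
    rintro k e t ⟨ht, i, hi, hti⟩ s hs
    refine ⟨i, hi, ?_⟩
    have hsT : s ∈ Icc 0 T := ⟨ht.1.trans hs.1, by linarith [hs.2, ht.2]⟩
    have htT : t ∈ Icc 0 T := ⟨ht.1, by linarith [ht.2, hh k]⟩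
    have hd := hclose k s hsT t htT (by rw [abs_of_nonneg (by linarith [hs.1])]; linarith [hs.2])
    have hl := abs_load_sub_le_mul_dist ((u (n k)).extend s) (ψ t) i
    have hk : (0 : ℝ) < 1 / (k + 1 : ℝ) := by positivity
    have : Fintype.card net.Route * dist ((u (n k)).extend s) (ψ t) < 1 / (k + 1 : ℝ) := by
      calc Fintype.card net.Route * dist ((u (n k)).extend s) (ψ t)
          ≤ Fintype.card net.Route * (1 / (k + 1 : ℝ) / M) := by gcongr
        _ < M * (1 / (k + 1 : ℝ) / M) := by
            gcongr
            simp [M]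
        _ = 1 / (k + 1 : ℝ) := by field_simp
    have := (abs_le.1 hl).1
    linarith
  set F : ℕ → ℝ → ℝ≥0∞ := fun k t => ∑ e, averagedCost (u (n k)).extend e (h k) (W k e) t
  have hFm : ∀ k, Measurable (F k) := fun k =>
    Finset.measurable_sum _ fun e _ => measurable_averagedCost (hum k) e (h k) (hWm k e)
  have hFint : ∀ k, ∫⁻ t, F k t ≤ K := by
    intro k
    refine (lintegral_sum_averagedCost_le (hum k) (hu (n k)).coordAC (hh k)
      (fun e => inter_subset_left) (hWact k)).trans ?_
    rw [← pathRate_eq_of_isAC (hu (n k))]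
    exact hK _
  rw [pathRate_eq_of_isAC hφ, ← restrict_Ioo_eq_restrict_Icc]
  have hae : ∀ᵐ t ∂(volume.restrict (Ioo 0 T)), net.density ψ t ≤ liminf (fun k => F k t) atTop := by
    have hdiff : ∀ᵐ t : ℝ, ∀ e, t ∈ uIcc 0 T → DifferentiableAt ℝ (fun s => (ψ s e : ℝ)) t :=
      ae_all_iff.2 fun e => (hφ.coordAC e).ae_differentiableAt
    filter_upwards [ae_restrict_of_ae hdiff, ae_restrict_mem measurableSet_Ioo] with t hd ht
    have htT : t ∈ Icc 0 T := Ioo_subset_Icc_self ht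
    have hsmall : ∀ᶠ k in atTop, h k < T - t :=
      hh0.eventually (gt_mem_nhds (sub_pos.2 ht.2))
    have hrM : Tendsto (fun k : ℕ => 1 / (k + 1 : ℝ) * max 1 (1 / M)) atTop (𝓝 0) := by
      simpa using hr0.mul_const (max 1 (1 / M))
    refine le_liminf_averagedCost hh hh0 (fun e => hd e (by rwa [uIcc_of_le hT.le])) hrM
      ?_ ?_ hum ?_
    · filter_upwards [hsmall] with k hk s hs
      refine (hclose k s ⟨htT.1.trans hs.1, by linarith [hs.2]⟩ t htT (by
        rw [abs_of_nonneg (by linarith [hs.1])]; linarith [hs.2])).trans ?_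
      rw [div_eq_mul_one_div _ M]
      gcongr
      exact le_max_right _ _
    · filter_upwards [hsmall] with k hk s hs
      refine (hclose2 k s ⟨htT.1.trans hs.1, by linarith [hs.2]⟩).trans ?_
      have := hh k
      gcongr
      exact le_mul_of_one_le_right (by positivity) (le_max_left _ _)
    · rintro e ⟨i, hi, hl⟩
      filter_upwards [hsmall, hr0.eventually (gt_mem_nhds hl)] with k hk hkl
      exact ⟨⟨htT.1, by linarith⟩, i, hi, hkl.le⟩
  calc ∫⁻ t in Ioo 0 T, net.density ψ t
      ≤ ∫⁻ t in Ioo 0 T, liminf (fun k => F k t) atTop := lintegral_mono_ae hae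
    _ ≤ ∫⁻ t, liminf (fun k => F k t) atTop := setLIntegral_le_lintegral _ _
    _ ≤ liminf (fun k => ∫⁻ t, F k t) atTop := lintegral_liminf_le hFm
    _ ≤ K := by
        refine liminf_le_of_le (by isBoundedDefault) fun b hb => ?_
        obtain ⟨k, hk⟩ := hb.exists
        exact hk.trans (hFint k)

end StarNetwork

/-! ### Skorokhod semicontinuity and compactness of level sets. -/

namespace StarNetwork

variable {N : ℕ} {net : StarNetwork N} {T : ℝ}

/-- `AbsolutelyContinuousOnInterval` allows unordered endpoints and asks for a strict inequality;
sorting by min and max and using ε / 2 handles both. -/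
theorem CadlagPath.isAC_of_forall_sum_dist_le (hT : 0 ≤ T) {φ : net.CadlagPath T}
    (h : ∀ ε : ℝ, 0 < ε → ∃ δ : ℝ, 0 < δ ∧
        ∀ (n : ℕ) (a b : Fin n → Set.Icc (0 : ℝ) T), (∀ i, a i ≤ b i) →
          (Pairwise fun i j => Disjoint (Set.Ioo (a i : ℝ) (b i)) (Set.Ioo (a j : ℝ) (b j))) →
          ∑ i, ((b i : ℝ) - a i) ≤ δ →
          ∑ i, dist (φ (b i)) (φ (a i)) ≤ ε) : φ.IsAC := by
  refine (absolutelyContinuousOnInterval_iff φ.extend 0 T).2 fun ε hε => ?_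
  obtain ⟨δ, hδ, h⟩ := h (ε / 2) (half_pos hε)
  refine ⟨δ, hδ, fun E hE hlt => ?_⟩
  obtain ⟨hmem, hdis⟩ := hE
  rw [uIcc_of_le hT] at hmem
  have hm : ∀ i : Fin E.1, (E.2 i).1 ∈ Icc 0 T ∧ (E.2 i).2 ∈ Icc 0 T := fun i =>
    hmem i (Finset.mem_range.2 i.2)
  have hsum := h E.1
    (fun i => ⟨min (E.2 i).1 (E.2 i).2, le_min (hm i).1.1 (hm i).2.1,
      (min_le_left _ _).trans (hm i).1.2⟩)
    (fun i => ⟨max (E.2 i).1 (E.2 i).2, (hm i).1.1.trans (le_max_left _ _),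
      max_le (hm i).1.2 (hm i).2.2⟩)
    (fun i => Subtype.mk_le_mk.2 min_le_max) (fun i j hij => ?_) ?_
  · rw [Finset.sum_range]
    refine lt_of_le_of_lt (le_trans (le_of_eq ?_) hsum) (half_lt_self hε)
    refine Finset.sum_congr rfl fun i _ => ?_
    rw [CadlagPath.extend_apply _ (hm i).1, CadlagPath.extend_apply _ (hm i).2]
    rcases le_total (E.2 i).1 (E.2 i).2 with hle | hle
    · simp only [min_eq_left hle, max_eq_right hle]
      exact dist_comm _ _
    · simp only [min_eq_right hle, max_eq_left hle]
  · have := hdis (x := (i : ℕ)) (by simp) (y := (j : ℕ)) (by simp)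
      (fun hc => hij (Fin.ext hc))
    exact this.mono Ioo_subset_Ioc_self Ioo_subset_Ioc_self
  · refine le_of_eq_of_le ?_ hlt.le
    rw [Finset.sum_range]
    refine Finset.sum_congr rfl fun i _ => ?_
    rw [Real.dist_eq, max_sub_min_eq_abs, abs_sub_comm]

/-- The rate function is lower semicontinuous for the uniform distance. -/
theorem pathRate_le_of_forall_exists (hT : 0 < T) {φ : net.CadlagPath T} {K : ℝ≥0}
    (h : ∀ ε : ℝ, 0 < ε → ∃ u : net.CadlagPath T, pathRate u ≤ K ∧ ∀ t, dist (u t) (φ t) ≤ ε) :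
    pathRate φ ≤ K := by
  have hAC : φ.IsAC := by
    refine CadlagPath.isAC_of_forall_sum_dist_le hT.le fun ε hε => ?_
    obtain ⟨δ, hδ, hδ'⟩ := net.exists_forall_sum_dist_le K hε
    refine ⟨δ, hδ, fun n a b hab hdis hsum => le_of_forall_pos_le_add fun η hη => ?_⟩
    -- The modulus δ is common to all paths of cost at most K. Approximation errors at the two
    -- endpoints of n intervals add up to less than η.
    obtain ⟨u, hu, hd⟩ := h (η / (2 * (n + 1))) (by positivity)
    have h1 := hδ' T u hu n a b hab hdis hsum
    have h2 : ∀ i, dist (φ (b i)) (φ (a i)) ≤ dist (u (b i)) (u (a i)) + η / (n + 1) := by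
      intro i
      have t1 := dist_triangle4 (φ (b i)) (u (b i)) (u (a i)) (φ (a i))
      have t2 := hd (b i)
      have t3 := hd (a i)
      rw [dist_comm] at t2
      have : η / (n + 1) = η / (2 * (n + 1)) + η / (2 * (n + 1)) := by field_simp; norm_num
      linarith
    refine (Finset.sum_le_sum fun i _ => h2 i).trans ?_
    rw [Finset.sum_add_distrib]
    refine add_le_add h1 ?_
    simp only [Finset.sum_const, Finset.card_univ, Fintype.card_fin, nsmul_eq_mul]
    rw [mul_div_assoc', div_le_iff₀ (by positivity)]
    nlinarith
  choose u hu hd using fun n : ℕ => h (1 / (n + 1 : ℝ)) (by positivity)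
  refine pathRate_le_of_uniform_limit hT hAC
    (fun n => isAC_of_pathRate_lt_top ((hu n).trans_lt ENNReal.coe_lt_top)) hu fun ε hε => ?_
  obtain ⟨n, hn⟩ := exists_nat_one_div_lt hε
  exact ⟨n, fun t => (hd n t).trans hn.le⟩

/-- The rate function is lower semicontinuous for the Skorokhod distance. -/
theorem lowerSemicontinuous_pathRate (hT : 0 < T) :
    LowerSemicontinuous fun φ : net.CadlagPath T => pathRate φ := by
  intro φ y hy
  by_contra hc
  have hfreq : ∃ᶠ u in 𝓝 φ, pathRate u ≤ y := by
    rw [Filter.not_eventually] at hc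
    exact hc.mono fun u hu => not_lt.1 hu
  have hytop : y ≠ ⊤ := (hy.trans_le le_top).ne
  lift y to ℝ≥0 using hytop
  refine hy.not_ge (pathRate_le_of_forall_exists hT fun ε hε => ?_)
  -- Equicontinuity of the paths of cost at most y absorbs the time change, so a small Skorokhod
  -- distance gives a small uniform distance.
  obtain ⟨δ, hδ, hδ'⟩ := net.exists_forall_dist_le y (half_pos hε)
  have hpos : 0 < min δ (ε / 2) := lt_min hδ (half_pos hε)
  obtain ⟨u, hu, hd⟩ := (hfreq.and_eventually
    (Metric.eball_mem_nhds φ (ENNReal.ofReal_pos.2 hpos))).exists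
  refine ⟨u, hu, fun t => ?_⟩
  have hd' : skorokhodEDist u φ < ENNReal.ofReal (min δ (ε / 2)) := hd
  obtain ⟨s, hs⟩ := iInf_lt_iff.1 hd'
  obtain ⟨hs1, hs2⟩ := max_lt_iff.1 hs
  have h1 : dist (s (s.symm t)) (s.symm t) < min δ (ε / 2) := by
    have := (le_iSup (fun t => edist (s t) t) (s.symm t)).trans_lt hs1
    rwa [edist_dist, ENNReal.ofReal_lt_ofReal_iff hpos] at this
  have h2 : dist (u (s.symm t)) (φ (s (s.symm t))) < min δ (ε / 2) := by
    have := (le_iSup (fun t => edist (u t) (φ (s t))) (s.symm t)).trans_lt hs2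
    rwa [edist_dist, ENNReal.ofReal_lt_ofReal_iff hpos] at this
  rw [OrderIso.apply_symm_apply] at h1 h2
  have h3 := hδ' T u hu t (s.symm t) (h1.le.trans (min_le_left _ _))
  have h4 := h2.le.trans (min_le_right _ _)
  have := dist_triangle (u t) (u (s.symm t)) (φ t)
  linarith

theorem CadlagPath.IsAC.continuous {φ : net.CadlagPath T} (hT : 0 ≤ T) (h : φ.IsAC) :
    Continuous φ.toFun := by
  have h1 := AbsolutelyContinuousOnInterval.continuousOn_pi (f := φ.extend) h
  rw [uIcc_of_le hT] at h1
  have h2 := h1.domRestrict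
  have : (Icc 0 T).domRestrict φ.extend = φ.toFun := funext fun t => φ.extend_coe t
  rwa [this] at h2

/-- The displacement bound with κ = 1; it supplies the boundedness in Arzelà–Ascoli. -/
theorem dist_start_le (hT : 0 < T) {φ : net.CadlagPath T} {K : ℝ≥0} (h : pathRate φ ≤ K)
    (t : Icc (0 : ℝ) T) :
    dist (φ t) (φ ⟨0, le_rfl, hT.le⟩) ≤ K + 2 * net.rateBound * Real.exp 1 * T := by
  have hAC := isAC_of_pathRate_lt_top (h.trans_lt ENNReal.coe_lt_top)
  have hB := net.rateBound_pos
  have h1 := mul_dist_le_lintegral_density t.2.1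
    (hAC.coordAC.subinterval le_rfl t.2.1 t.2.2) one_pos
  rw [one_mul, φ.extend_coe, CadlagPath.extend_apply φ (⟨le_rfl, hT.le⟩ : (0 : ℝ) ∈ Icc 0 T),
    lintegral_add_right _ measurable_const, setLIntegral_const, Real.volume_Ioo, sub_zero,
    ← ENNReal.ofReal_mul (by positivity)] at h1
  have h2 : ∫⁻ s in Ioo 0 (t : ℝ), net.density φ.extend s ≤ K :=
    (lintegral_mono_set (Ioo_subset_Icc_self.trans (Icc_subset_Icc_right t.2.2))).trans
      ((pathRate_eq_of_isAC hAC).symm.le.trans h)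
  have h3 := h1.trans (add_le_add_left h2 _)
  rw [← ENNReal.ofReal_coe_nnreal, ← ENNReal.ofReal_add K.coe_nonneg
    (mul_nonneg (by positivity) t.2.1)] at h3
  have h4 := (ENNReal.ofReal_le_ofReal_iff (add_nonneg K.coe_nonneg
    (mul_nonneg (by positivity) t.2.1))).1 h3
  refine h4.trans ?_
  have := t.2.2
  gcongr

theorem iUnion_levelSet_subset_range (hT : 0 < T) (K : ℝ≥0) (C : Set net.State) :
    (⋃ x ∈ C, net.levelSet T K x) ⊆ Set.range ofContinuous := by
  intro φ hφ
  simp only [mem_iUnion] at hφ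
  obtain ⟨x, -, hφ, -⟩ := hφ
  have hAC := isAC_of_pathRate_lt_top (hφ.trans_lt ENNReal.coe_lt_top)
  exact ⟨⟨φ.toFun, hAC.continuous hT.le⟩, rfl⟩

theorem mem_preimage_levelSet_iff (hT : 0 < T) {K : ℝ≥0} {C : Set net.State}
    {g : C(Icc (0 : ℝ) T, net.State)} :
    g ∈ (ofContinuous ⁻¹' (⋃ x ∈ C, net.levelSet T K x) : Set C(Icc (0 : ℝ) T, net.State)) ↔
      pathRate (ofContinuous g) ≤ K ∧ g ⟨0, le_rfl, hT.le⟩ ∈ C := by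
  simp only [mem_preimage, mem_iUnion, levelSet]
  constructor
  · rintro ⟨x, hx, h1, h2⟩
    refine ⟨h1, ?_⟩
    have := h2 ⟨le_rfl, hT.le⟩
    change g _ = x at this
    rwa [this]
  · rintro ⟨h1, h2⟩
    exact ⟨_, h2, h1, fun _ => rfl⟩

/-- Arzelà–Ascoli: closedness is lower semicontinuity together with evaluation at time 0,
equicontinuity comes from the common modulus, and values stay in a fixed ball around 0. -/
theorem isCompact_preimage_levelSet (hT : 0 < T) (K : ℝ≥0) {C : Set net.State}
    (hC : IsCompact C) :
    IsCompact (ofContinuous ⁻¹' (⋃ x ∈ C, net.levelSet T K x) :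
        Set C(Icc (0 : ℝ) T, net.State)) := by
  set A : Set C(Icc (0 : ℝ) T, net.State) := ofContinuous ⁻¹' (⋃ x ∈ C, net.levelSet T K x)
  have hclosed : IsClosed A := by
    refine isClosed_of_closure_subset fun g hg => (mem_preimage_levelSet_iff hT).2 ⟨?_, ?_⟩
    · refine pathRate_le_of_forall_exists hT fun ε hε => ?_
      obtain ⟨f, hf, hfg⟩ := Metric.mem_closure_iff.1 hg ε hε
      refine ⟨ofContinuous f, ((mem_preimage_levelSet_iff hT).1 hf).1, fun t => ?_⟩
      exact (ContinuousMap.dist_apply_le_dist t).trans (by rw [dist_comm]; exact hfg.le)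
    · have hev : Continuous fun f : C(Icc (0 : ℝ) T, net.State) => f ⟨0, le_rfl, hT.le⟩ :=
        continuous_eval_const _
      refine hC.isClosed.closure_subset (map_mem_closure (f := fun f :
        C(Icc (0 : ℝ) T, net.State) => f ⟨0, le_rfl, hT.le⟩) hev hg fun f hf => ?_)
      exact ((mem_preimage_levelSet_iff hT).1 hf).2
  obtain ⟨R, hR⟩ := hC.isBounded.subset_closedBall (0 : net.State)
  set R' : ℝ := R + (K + 2 * net.rateBound * Real.exp 1 * T)
  have hball : ∀ g ∈ A, ∀ t, g t ∈ Metric.closedBall (0 : net.State) R' := by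
    intro g hg t
    obtain ⟨h1, h2⟩ := (mem_preimage_levelSet_iff hT).1 hg
    have h3 := dist_start_le hT h1 t
    have h4 := hR h2
    rw [Metric.mem_closedBall] at h4 ⊢
    change dist (g t) (g ⟨0, le_rfl, hT.le⟩) ≤ _ at h3
    have := dist_triangle (g t) (g ⟨0, le_rfl, hT.le⟩) 0
    simp only [R']
    linarith
  have hequi : ∀ ε : ℝ, 0 < ε → ∃ δ : ℝ, 0 < δ ∧ ∀ g ∈ A, ∀ a b, dist a b ≤ δ →
      dist (g a) (g b) ≤ ε := by
    intro ε hε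
    obtain ⟨δ, hδ, h⟩ := net.exists_forall_dist_le K hε
    exact ⟨δ, hδ, fun g hg a b hab =>
      h T (ofContinuous g) ((mem_preimage_levelSet_iff hT).1 hg).1 a b hab⟩
  let I := ContinuousMap.isometryEquivBoundedOfCompact (Icc (0 : ℝ) T) net.State
  have hcomp : IsCompact (I.symm ⁻¹' A) := by
    refine BoundedContinuousFunction.arzela_ascoli₂ _
      (isCompact_closedBall (0 : net.State) R') _ (hclosed.preimage I.symm.continuous)
      (fun f x hf => hball _ hf x) ?_
    refine UniformEquicontinuous.equicontinuous (Metric.uniformEquicontinuous_iff.2 fun ε hε => ?_)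
    obtain ⟨δ, hδ, h⟩ := hequi (ε / 2) (half_pos hε)
    exact ⟨δ, hδ, fun x y hxy f => (h _ f.2 x y hxy.le).trans_lt (half_lt_self hε)⟩
  have := hcomp.image I.symm.continuous
  rwa [image_preimage_eq _ I.symm.surjective] at this

end StarNetwork

/-! ### Piecewise affine paths, gluing and bridges. -/

theorem setLIntegral_Icc_add_le (d : ℝ → ℝ≥0∞) {a b c : ℝ} (hab : a ≤ b) (hbc : b ≤ c) :
    (∫⁻ t in Icc a b, d t) + ∫⁻ t in Icc b c, d t = ∫⁻ t in Icc a c, d t := by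
  rw [← restrict_Ioc_eq_restrict_Icc (a := a) (b := b),
    ← restrict_Ioc_eq_restrict_Icc (a := b) (b := c),
    ← restrict_Ioc_eq_restrict_Icc (a := a) (b := c), ← Ioc_union_Ioc_eq_Ioc hab hbc,
    lintegral_union measurableSet_Ioc]
  exact Ioc_disjoint_Ioc_of_le le_rfl

namespace StarNetwork

variable {N : ℕ} {net : StarNetwork N}

/-- All coordinates of `ψ` are affine on `[a, b]`. -/
def AffineOn (ψ : ℝ → net.State) (a b : ℝ) : Prop :=
  ∃ p v : net.Route → ℝ, ∀ t ∈ Icc a b, ∀ e, (ψ t e : ℝ) = p e + t * v e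

/-- `ψ` is piecewise affine on `[a, b]`, with finitely many pieces. -/
inductive PiecewiseAffineOn (ψ : ℝ → net.State) : ℝ → ℝ → Prop
  | single {a b : ℝ} (hab : a ≤ b) (h : AffineOn ψ a b) : PiecewiseAffineOn ψ a b
  | append {a b c : ℝ} (h₁ : PiecewiseAffineOn ψ a b) (h₂ : PiecewiseAffineOn ψ b c) :
      PiecewiseAffineOn ψ a c

namespace PiecewiseAffineOn

variable {ψ ψ' : ℝ → net.State} {a b c : ℝ}

theorem le (h : PiecewiseAffineOn ψ a b) : a ≤ b := by
  induction h with
  | single hab _ => exact hab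
  | append _ _ h₁ h₂ => exact h₁.trans h₂

theorem congr (h : PiecewiseAffineOn ψ a b) (heq : EqOn ψ ψ' (Icc a b)) :
    PiecewiseAffineOn ψ' a b := by
  induction h with
  | single hab h =>
    obtain ⟨p, v, hpv⟩ := h
    exact single hab ⟨p, v, fun t ht e => by rw [← heq ht, hpv t ht e]⟩
  | append g₁ g₂ h₁ h₂ =>
    exact append (h₁ (heq.mono (Icc_subset_Icc_right g₂.le)))
      (h₂ (heq.mono (Icc_subset_Icc_left g₁.le)))

theorem initial (h : PiecewiseAffineOn ψ a b) (hac : a ≤ c) (hcb : c ≤ b) :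
    PiecewiseAffineOn ψ a c := by
  induction h with
  | single hab h =>
    obtain ⟨p, v, hpv⟩ := h
    exact single hac ⟨p, v, fun t ht e => hpv t (Icc_subset_Icc_right hcb ht) e⟩
  | @append a m b g₁ g₂ h₁ h₂ =>
    rcases le_total c m with hm | hm
    · exact h₁ hac hm
    · exact append g₁ (h₂ hm hcb)

theorem shift (h : PiecewiseAffineOn ψ a b) (s : ℝ) :
    PiecewiseAffineOn (fun t => ψ (t - s)) (a + s) (b + s) := by
  induction h with
  | single hab h =>
    obtain ⟨p, v, hpv⟩ := h
    refine single (by linarith) ⟨fun e => p e - s * v e, v, fun t ht e => ?_⟩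
    rw [hpv (t - s) ⟨by linarith [ht.1], by linarith [ht.2]⟩ e]
    ring
  | append g₁ g₂ h₁ h₂ => exact append h₁ h₂

theorem exists_lipschitz (h : PiecewiseAffineOn ψ a b) :
    ∃ L : ℝ, 0 ≤ L ∧ ∀ s ∈ Icc a b, ∀ t ∈ Icc a b, dist (ψ s) (ψ t) ≤ L * |s - t| := by
  induction h with
  | single hab h =>
    obtain ⟨p, v, hpv⟩ := h
    refine ⟨∑ e, |v e|, Finset.sum_nonneg fun e _ => abs_nonneg _, fun s hs t ht => ?_⟩
    refine (dist_pi_le_iff (mul_nonneg (Finset.sum_nonneg fun e _ => abs_nonneg _)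
      (abs_nonneg _))).2 fun e => ?_
    rw [NNReal.dist_eq, hpv s hs, hpv t ht, add_sub_add_left_eq_sub, ← sub_mul, abs_mul, mul_comm]
    gcongr
    exact Finset.single_le_sum (f := fun e => |v e|) (fun _ _ => abs_nonneg _) (Finset.mem_univ e)
  | @append a m b g₁ g₂ h₁ h₂ =>
    obtain ⟨L₁, hL₁, h₁⟩ := h₁
    obtain ⟨L₂, hL₂, h₂⟩ := h₂
    have key : ∀ s ∈ Icc a b, ∀ t ∈ Icc a b, s ≤ t →
        dist (ψ s) (ψ t) ≤ (L₁ + L₂) * |s - t| := by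
      intro s hs t ht hst
      have hm₁ : m ∈ Icc a m := ⟨g₁.le, le_rfl⟩
      have hm₂ : m ∈ Icc m b := ⟨le_rfl, g₂.le⟩
      rw [abs_sub_comm, abs_of_nonneg (by linarith)]
      rcases le_total t m with htm | htm
      · have := h₁ s ⟨hs.1, hst.trans htm⟩ t ⟨ht.1, htm⟩
        rw [abs_sub_comm, abs_of_nonneg (by linarith)] at this
        nlinarith
      rcases le_total m s with hms | hms
      · have := h₂ s ⟨hms, hs.2⟩ t ⟨htm, ht.2⟩
        rw [abs_sub_comm, abs_of_nonneg (by linarith)] at this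
        nlinarith
      · have e1 := h₁ s ⟨hs.1, hms⟩ m hm₁
        have e2 := h₂ m hm₂ t ⟨htm, ht.2⟩
        rw [abs_sub_comm, abs_of_nonneg (by linarith)] at e1 e2
        refine (dist_triangle _ (ψ m) _).trans ?_
        nlinarith
    refine ⟨L₁ + L₂, add_nonneg hL₁ hL₂, fun s hs t ht => ?_⟩
    rcases le_total s t with hst | hst
    · exact key s hs t ht hst
    · rw [dist_comm, abs_sub_comm]
      exact key t ht s hs hst

theorem exists_subdivision (h : PiecewiseAffineOn ψ a b) :
    ∃ (n : ℕ) (τ : ℕ → ℝ), Monotone τ ∧ τ 0 = a ∧ τ n = b ∧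
      ∀ k < n, AffineOn ψ (τ k) (τ (k + 1)) := by
  induction h with
  | @single a b hab h =>
    refine ⟨1, fun k => if k = 0 then a else b, ?_, by simp, by simp, ?_⟩
    · refine monotone_nat_of_le_succ fun k => ?_
      rcases Nat.eq_zero_or_pos k with rfl | hk
      · simpa using hab
      · simp [hk.ne']
    · intro k hk
      obtain rfl : k = 0 := by omega
      simpa using h
  | @append a m b g₁ g₂ h₁ h₂ =>
    obtain ⟨n₁, τ₁, hm₁, h0₁, hn₁, hA₁⟩ := h₁
    obtain ⟨n₂, τ₂, hm₂, h0₂, hn₂, hA₂⟩ := h₂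
    set τ : ℕ → ℝ := fun k => if k ≤ n₁ then τ₁ k else τ₂ (k - n₁)
    have e1 : ∀ k, k ≤ n₁ → τ k = τ₁ k := fun k hk => if_pos hk
    have e2 : ∀ k, n₁ ≤ k → τ k = τ₂ (k - n₁) := by
      intro k hk
      rcases hk.eq_or_lt with rfl | hk
      · rw [e1 _ le_rfl, Nat.sub_self, h0₂, hn₁]
      · exact if_neg (by omega)
    refine ⟨n₁ + n₂, τ, ?_, ?_, ?_, ?_⟩
    · refine monotone_nat_of_le_succ fun k => ?_
      rcases lt_or_ge k n₁ with hk | hk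
      · rw [e1 k hk.le, e1 (k + 1) hk]
        exact hm₁ (Nat.le_succ k)
      · rw [e2 k hk, e2 (k + 1) (by omega)]
        exact hm₂ (by omega)
    · rw [e1 0 (Nat.zero_le _), h0₁]
    · rw [e2 _ (Nat.le_add_right _ _), Nat.add_sub_cancel_left, hn₂]
    · intro k hk
      rcases lt_or_ge k n₁ with hk' | hk'
      · rw [e1 k hk'.le, e1 (k + 1) hk']
        exact hA₁ k hk'
      · rw [e2 k hk', e2 (k + 1) (by omega), show k + 1 - n₁ = k - n₁ + 1 by omega]
        exact hA₂ _ (by omega)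

end PiecewiseAffineOn

/-- The cost of a path on a time interval. -/
noncomputable def pathCost (ψ : ℝ → net.State) (a b : ℝ) : ℝ≥0∞ :=
  ∫⁻ t in Icc a b, net.density ψ t

theorem density_congr {ψ ψ' : ℝ → net.State} {t : ℝ} (h : ψ =ᶠ[𝓝 t] ψ') :
    net.density ψ t = net.density ψ' t := by
  have h1 : (fun e => deriv (fun s => (ψ s e : ℝ)) t) = fun e => deriv (fun s => (ψ' s e : ℝ)) t := by
    funext e
    refine Filter.EventuallyEq.deriv_eq ?_
    filter_upwards [h] with s hs
    rw [hs]
  rw [density, density, h1, h.eq_of_nhds]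

/-- Inside the open interval the paths agree near each time, so their derivatives agree as well; the
endpoints are negligible. -/
theorem pathCost_congr {ψ ψ' : ℝ → net.State} {a b : ℝ} (h : EqOn ψ ψ' (Ioo a b)) :
    pathCost ψ a b = pathCost ψ' a b := by
  unfold pathCost
  rw [← restrict_Ioo_eq_restrict_Icc]
  refine setLIntegral_congr_fun measurableSet_Ioo fun t ht => density_congr ?_
  filter_upwards [isOpen_Ioo.mem_nhds ht] with s hs
  exact h hs

theorem pathCost_shift (ψ : ℝ → net.State) (a b s : ℝ) :
    pathCost (fun t => ψ (t - s)) (a + s) (b + s) = pathCost ψ a b := by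
  have h : ∀ t, net.density (fun t => ψ (t - s)) t = net.density ψ (t - s) := by
    intro t
    unfold density
    congr 1
    funext e
    exact deriv_comp_sub_const (fun s => (ψ s e : ℝ)) s t
  unfold pathCost
  simp_rw [h]
  rw [add_comm a, add_comm b, setLIntegral_Icc_eq_comp_add]
  simp

/-- There is a piecewise affine path from `y` at time `u` to `y'` at time `v`, of cost at most `R`,
whose graph satisfies `G`. -/
def Join (G : ℝ → net.State → Prop) (u : ℝ) (y : net.State) (v : ℝ) (y' : net.State)
    (R : ℝ≥0∞) : Prop :=
  ∃ ψ : ℝ → net.State, PiecewiseAffineOn ψ u v ∧ ψ u = y ∧ ψ v = y' ∧ pathCost ψ u v ≤ R ∧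
    ∀ t ∈ Icc u v, G t (ψ t)

namespace Join

variable {G : ℝ → net.State → Prop} {u v w : ℝ} {y y' y'' : net.State} {R R' : ℝ≥0∞}

theorem mono (h : Join G u y v y' R) {G' : ℝ → net.State → Prop}
    (hG : ∀ t ∈ Icc u v, ∀ z, G t z → G' t z) (hR : R ≤ R') : Join G' u y v y' R' := by
  obtain ⟨ψ, h1, h2, h3, h4, h5⟩ := h
  exact ⟨ψ, h1, h2, h3, h4.trans hR, fun t ht => hG t ht _ (h5 t ht)⟩

theorem refl (h : G u y) : Join G u y u y 0 := by
  refine ⟨fun _ => y, .single le_rfl ⟨fun e => y e, 0, fun t _ e => by simp⟩, rfl, rfl, ?_, ?_⟩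
  · simp [pathCost]
  · rintro t ht
    obtain rfl : t = u := le_antisymm ht.2 ht.1
    exact h

theorem trans (h₁ : Join G u y v y' R) (h₂ : Join G v y' w y'' R') :
    Join G u y w y'' (R + R') := by
  obtain ⟨ψ₁, a1, a2, a3, a4, a5⟩ := h₁
  obtain ⟨ψ₂, b1, b2, b3, b4, b5⟩ := h₂
  set ψ : ℝ → net.State := fun t => if t ≤ v then ψ₁ t else ψ₂ t
  have e1 : ∀ t, t ≤ v → ψ t = ψ₁ t := fun t ht => if_pos ht
  have e2 : ∀ t, v ≤ t → ψ t = ψ₂ t := by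
    intro t ht
    rcases ht.eq_or_lt with rfl | ht
    · rw [e1 _ le_rfl, a3, b2]
    · exact if_neg (not_le.2 ht)
  refine ⟨ψ, .append (a1.congr fun t ht => (e1 t ht.2).symm)
    (b1.congr fun t ht => (e2 t ht.1).symm), ?_, ?_, ?_, ?_⟩
  · rw [e1 u a1.le, a2]
  · rw [e2 w b1.le, b3]
  · have : pathCost ψ u w = pathCost ψ u v + pathCost ψ v w :=
      (setLIntegral_Icc_add_le _ a1.le b1.le).symm
    rw [this, pathCost_congr (ψ' := ψ₁) fun t ht => e1 t ht.2.le,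
      pathCost_congr (ψ' := ψ₂) fun t ht => e2 t ht.1.le]
    exact add_le_add a4 b4
  · intro t ht
    rcases le_total t v with h | h
    · rw [e1 t h]; exact a5 t ⟨ht.1, h⟩
    · rw [e2 t h]; exact b5 t ⟨h, ht.2⟩

theorem shift (h : Join G u y v y' R) (s : ℝ) :
    Join (fun t z => G (t - s) z) (u + s) y (v + s) y' R := by
  obtain ⟨ψ, a1, a2, a3, a4, a5⟩ := h
  refine ⟨fun t => ψ (t - s), a1.shift s, by simpa using a2, by simpa using a3,
    (pathCost_shift ψ u v s).le.trans a4, fun t ht => a5 _ ⟨?_, ?_⟩⟩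
  · linarith [ht.1]
  · linarith [ht.2]

end Join

/-- Straight segments as joining paths. -/
theorem join_segment {G : ℝ → net.State → Prop} {u v : ℝ} {y y' : net.State}
    {B : net.Route → ℝ → ℝ≥0∞} (huv : u < v)
    (hG : ∀ t ∈ Icc u v, ∀ z : net.State,
      (∀ e, (z e : ℝ) = y e + (t - u) * (((y' e : ℝ) - y e) / (v - u))) → G t z)
    (hB : ∀ t ∈ Ioo u v, ∀ z : net.State,
      (∀ e, (z e : ℝ) = y e + (t - u) * (((y' e : ℝ) - y e) / (v - u))) →
      ∀ e, net.Active e z → dualCost (net.arrival e.1) (((y' e : ℝ) - y e) / (v - u))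
        (net.serviceRate z e) ≤ B e t) :
    Join G u y v y' (∫⁻ t in Icc u v, ∑ e, B e t) := by
  have hvu : 0 < v - u := sub_pos.2 huv
  set f : net.Route → ℝ → ℝ := fun e t => y e + (t - u) * (((y' e : ℝ) - y e) / (v - u))
  -- On the interval the coordinates are convex combinations of nonnegative numbers, so this
  -- truncation changes nothing there.
  set ψ : ℝ → net.State := fun t e => Real.toNNReal (f e t)
  have hf : ∀ t ∈ Icc u v, ∀ e, (ψ t e : ℝ) = f e t := by
    intro t ht e
    refine Real.coe_toNNReal _ ?_
    have e1 : f e t = ((v - t) * y e + (t - u) * y' e) / (v - u) := by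
      simp only [f]; field_simp; ring
    rw [e1]
    have := (y e).coe_nonneg
    have := (y' e).coe_nonneg
    have h1 := sub_nonneg.2 ht.1
    have h2 := sub_nonneg.2 ht.2
    positivity
  refine ⟨ψ, .single huv.le ⟨fun e => y e - u * (((y' e : ℝ) - y e) / (v - u)),
    fun e => ((y' e : ℝ) - y e) / (v - u), fun t ht e => ?_⟩, ?_, ?_, ?_, fun t ht =>
    hG t ht _ (hf t ht)⟩
  · rw [hf t ht]; simp only [f]; ring
  · funext e
    refine NNReal.coe_injective ?_
    rw [hf u ⟨le_rfl, huv.le⟩]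
    simp [f]
  · funext e
    refine NNReal.coe_injective ?_
    rw [hf v ⟨huv.le, le_rfl⟩]
    simp only [f]
    field_simp
    ring
  · unfold pathCost
    rw [← restrict_Ioo_eq_restrict_Icc]
    refine setLIntegral_mono' measurableSet_Ioo fun t ht => ?_
    rw [density_eq_sum]
    refine Finset.sum_le_sum fun e _ => ?_
    unfold routeDensity
    split_ifs with hact
    · have hd : deriv (fun s => (ψ s e : ℝ)) t = ((y' e : ℝ) - y e) / (v - u) := by
        have h1 : (fun s => (ψ s e : ℝ)) =ᶠ[𝓝 t] f e := by
          filter_upwards [isOpen_Ioo.mem_nhds ht] with s hs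
          exact hf s (Ioo_subset_Icc_self hs) e
        rw [h1.deriv_eq]
        have h2 : HasDerivAt (f e) (1 * (((y' e : ℝ) - y e) / (v - u))) t :=
          (((hasDerivAt_id t).sub_const u).mul_const _).const_add _
        rw [h2.deriv, one_mul]
      rw [hd]
      exact hB t ht _ (hf t (Ioo_subset_Icc_self ht)) e hact
    · exact zero_le

/-- Applying log x ≤ x - 1 to x = s^(-1/2) bounds the logarithmic singularity by an integrable
power. -/
theorem abs_log_le_rpow {s : ℝ} (hs : 0 < s) (hs1 : s ≤ 1) :
    |Real.log s| ≤ 2 * s ^ (-(1 / 2) : ℝ) := by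
  rw [abs_of_nonpos (Real.log_nonpos hs.le hs1)]
  have h1 := Real.log_le_sub_one_of_pos (Real.rpow_pos_of_pos hs (-(1 / 2) : ℝ))
  rw [Real.log_rpow hs] at h1
  linarith

theorem lintegral_rpow_sub_eq {u τ : ℝ} (hτ : 0 ≤ τ) :
    ∫⁻ t in Icc u (u + τ), ENNReal.ofReal ((u + τ - t) ^ (-(1 / 2) : ℝ))
      = ENNReal.ofReal (2 * √τ) := by
  have hint : IntervalIntegrable (fun t : ℝ => (u + τ - t) ^ (-(1 / 2) : ℝ)) volume u (u + τ) := by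
    have := (intervalIntegral.intervalIntegrable_rpow' (a := τ) (b := 0)
      (r := (-(1 / 2) : ℝ)) (by norm_num)).comp_sub_left (u + τ)
    simpa using this
  have hv : ∫ t in u..(u + τ), (u + τ - t) ^ (-(1 / 2) : ℝ) = 2 * √τ := by
    rw [intervalIntegral.integral_comp_sub_left (fun s => s ^ (-(1 / 2) : ℝ)) (u + τ), sub_self,
      add_sub_cancel_left, integral_rpow (Or.inl (by norm_num)), Real.sqrt_eq_rpow]
    norm_num
    ring
  rw [← hv, intervalIntegral.integral_of_le (by linarith), ← restrict_Ioc_eq_restrict_Icc]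
  rw [intervalIntegrable_iff_integrableOn_Ioc_of_le (by linarith)] at hint
  refine (ofReal_integral_eq_lintegral_ofReal hint ?_).symm
  filter_upwards [ae_restrict_mem measurableSet_Ioc] with t ht
  exact Real.rpow_nonneg (by linarith [ht.2]) _

/-- Short displacements have a small cost, uniformly on bounded sets of states. -/
theorem exists_join_bridge (net : StarNetwork N) (R : ℝ) :
    ∃ C : ℝ, 0 < C ∧ ∀ (y y' : net.State) (u τ : ℝ), (∀ e, (y e : ℝ) ≤ R) →
      (∀ e, (y' e : ℝ) ≤ R) → 0 < τ → τ ≤ 1 → dist y y' ≤ τ →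
      Join (fun _ z => dist z y ≤ τ) u y (u + τ) y' (ENNReal.ofReal (C * √τ)) := by
  obtain ⟨c, hc, hcR⟩ := net.exists_mul_le_serviceRate R
  have hBpos := net.rateBound_pos
  set A : ℝ := 2 * net.rateBound + ∑ e : net.Route, |Real.log (net.arrival e.1)| + |Real.log c| + 2
  have hsum : 0 ≤ ∑ e : net.Route, |Real.log (net.arrival e.1)| :=
    Finset.sum_nonneg fun _ _ => abs_nonneg _
  have hA : 0 < A := by positivity
  refine ⟨(Fintype.card net.Route + 1) * (A * 2), by positivity, ?_⟩
  intro y y' u τ hy hy' hτ hτ1 hd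
  have hcoord : ∀ e, |(y' e : ℝ) - y e| ≤ τ := fun e => by
    rw [← NNReal.dist_eq, dist_comm]
    exact (dist_le_pi_dist y y' e).trans hd
  have hseg := join_segment (net := net) (G := fun _ z => dist z y ≤ τ) (u := u) (v := u + τ)
    (y := y) (y' := y')
    (B := fun _ t => ENNReal.ofReal (A * (u + τ - t) ^ (-(1 / 2) : ℝ)))
    (by linarith) ?_ ?_
  · refine hseg.mono (fun _ _ _ h => h) ?_
    simp only [Finset.sum_const, nsmul_eq_mul, Finset.card_univ]
    simp_rw [ENNReal.ofReal_mul hA.le]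
    rw [lintegral_const_mul' _ _ (ENNReal.natCast_ne_top _),
      lintegral_const_mul' _ _ ENNReal.ofReal_ne_top, lintegral_rpow_sub_eq hτ.le,
      ← ENNReal.ofReal_natCast, ← ENNReal.ofReal_mul hA.le, ← ENNReal.ofReal_mul (by positivity)]
    refine ENNReal.ofReal_le_ofReal ?_
    have := Real.sqrt_nonneg τ
    have h2 : 0 ≤ A * 2 * √τ := by positivity
    nlinarith
  · intro t ht z hz
    refine (dist_pi_le_iff hτ.le).2 fun e => ?_
    rw [NNReal.dist_eq, hz e, add_sub_cancel_left, add_sub_cancel_left, abs_mul, abs_div,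
      abs_of_pos hτ, abs_of_nonneg (by linarith [ht.1])]
    have h1 : |(y' e : ℝ) - y e| / τ ≤ 1 := (div_le_one hτ).2 (hcoord e)
    have h2 : 0 ≤ |(y' e : ℝ) - y e| / τ := by positivity
    have h3 : t - u ≤ τ := by linarith [ht.2]
    have h4 : 0 ≤ t - u := by linarith [ht.1]
    nlinarith
  · intro t ht z hz e _
    rw [add_sub_cancel_left] at hz ⊢
    have hs : 0 < u + τ - t := by linarith [ht.2]
    have hs1 : u + τ - t ≤ 1 := by linarith [ht.1]
    have hzle : ∀ f, (z f : ℝ) ≤ R := by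
      intro f
      have e1 : (z f : ℝ) = ((u + τ - t) * y f + (t - u) * y' f) / τ := by
        rw [hz]; field_simp; ring
      rw [e1, div_le_iff₀ hτ]
      have h1 := mul_le_mul_of_nonneg_left (hy f) hs.le
      have h2 := mul_le_mul_of_nonneg_left (hy' f) (show 0 ≤ t - u by linarith [ht.1])
      linarith
    -- The segment ends at a nonnegative value, so a decreasing coordinate is at least its speed
    -- times the remaining time. This bounds the service rate from below and leaves only a
    -- logarithmic singularity at the end.
    have hlow : c * (-(((y' e : ℝ) - y e) / τ)) * (u + τ - t) ≤ net.serviceRate z e := by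
      refine le_trans ?_ (hcR z e hzle)
      rw [mul_assoc]
      refine mul_le_mul_of_nonneg_left ?_ hc.le
      have e1 : (z e : ℝ) = -(((y' e : ℝ) - y e) / τ) * (u + τ - t) + y' e := by
        rw [hz]; field_simp; ring
      rw [e1]
      linarith [(y' e).coe_nonneg]
    refine (dualCost_le_of_abs_le_one e.2.2 (net.serviceRate_nonneg z e) ?_ hc hs hlow).trans ?_
    · rw [abs_div, abs_of_pos hτ]
      exact (div_le_one hτ).2 (hcoord e)
    · refine ENNReal.ofReal_le_ofReal ?_
      have h1 : (1 : ℝ) ≤ (u + τ - t) ^ (-(1 / 2) : ℝ) :=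
        Real.one_le_rpow_of_pos_of_le_one_of_nonpos hs hs1 (by norm_num)
      have h2 := abs_log_le_rpow hs hs1
      have h3 : |Real.log (c * (u + τ - t))| ≤ |Real.log c| + |Real.log (u + τ - t)| := by
        rw [Real.log_mul hc.ne' hs.ne']
        exact abs_add_le _ _
      have h4 := net.arrival_le e
      have h5 := net.serviceRate_le z e
      have h6 := Finset.single_le_sum (f := fun e : net.Route => |Real.log (net.arrival e.1)|)
        (fun _ _ => abs_nonneg _) (Finset.mem_univ e)
      have h7 := abs_nonneg (Real.log c)
      set P := (u + τ - t) ^ (-(1 / 2) : ℝ)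
      have h8 : (2 * net.rateBound + ∑ e : net.Route, |Real.log (net.arrival e.1)| + |Real.log c|)
          ≤ (2 * net.rateBound + ∑ e : net.Route, |Real.log (net.arrival e.1)| + |Real.log c|) * P :=
        le_mul_of_one_le_right (by positivity) h1
      have h9 : A * P = (2 * net.rateBound + ∑ e : net.Route, |Real.log (net.arrival e.1)|
          + |Real.log c|) * P + 2 * P := by simp only [A]; ring
      rw [h9]
      linarith

end StarNetwork

/-! ### Approximation with a small delay: concatenation and localisation. -/

namespace StarNetwork

variable {N : ℕ} {net : StarNetwork N}

/-- On `[a, b]` the path `φ` can be approximated, with an arbitrarily small delay and endpoints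
arbitrarily close to those of `φ`, by piecewise affine paths at a distance essentially `σ` whose
cost exceeds that of `φ` by a factor `1 + σ` and a rate `σ` per unit of time. -/
def Approximable (φ : ℝ → net.State) (σ a b : ℝ) : Prop :=
  ∀ ε : ℝ, 0 < ε → ∃ (h : ℝ) (y y' : net.State), b - a ≤ h ∧ h ≤ b - a + ε ∧
    dist y (φ a) ≤ ε ∧ dist y' (φ b) ≤ ε ∧
    Join (fun t z => ∃ s ∈ Icc a b, |s - a - t| ≤ ε ∧ dist z (φ s) ≤ σ + ε) 0 y h y'
      (ENNReal.ofReal (1 + σ) * pathCost φ a b + ENNReal.ofReal (σ * (b - a) + ε))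

theorem Join.translate {G : ℝ → net.State → Prop} {u h : ℝ} {y y' : net.State} {R : ℝ≥0∞}
    (hj : Join G 0 y h y' R) : Join (fun t z => G (t - u) z) u y (u + h) y' R := by
  have := hj.shift u
  rwa [zero_add, add_comm h] at this

namespace Approximable

variable {φ : ℝ → net.State} {σ a b c : ℝ}

theorem refl (φ : ℝ → net.State) (hσ : 0 ≤ σ) (a : ℝ) : Approximable φ σ a a := by
  intro ε hε
  refine ⟨0, φ a, φ a, by simp, by simpa using hε.le, by simpa using hε.le, by simpa using hε.le,
    (Join.refl ⟨a, ⟨le_rfl, le_rfl⟩, by simpa using hε.le, ?_⟩).mono (fun _ _ _ h => h) zero_le⟩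
  rw [dist_self]; positivity

/-- The bridge cost is of order √η and so tends to 0. The length 2 η is the distance between two
states that are both η-close to a third one. -/
theorem exists_bridge_bound (R : ℝ) {ε : ℝ} (hε : 0 < ε) (net : StarNetwork N) :
    ∃ η : ℝ, 0 < η ∧ η ≤ 1 ∧ η ≤ ε ∧ ∀ (y y' : net.State) (u : ℝ), (∀ e, (y e : ℝ) ≤ R) →
      (∀ e, (y' e : ℝ) ≤ R) → dist y y' ≤ 2 * η →
      Join (fun _ z => dist z y ≤ 2 * η) u y (u + 2 * η) y' (ENNReal.ofReal ε) := by
  obtain ⟨C, hC, hj⟩ := exists_join_bridge net R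
  have hlim : Tendsto (fun η : ℝ => C * √(2 * η)) (𝓝[>] 0) (𝓝 0) := by
    have : Continuous fun η : ℝ => C * √(2 * η) := by fun_prop
    have h0 := (this.tendsto 0).mono_left (nhdsWithin_le_nhds (s := Ioi 0))
    simpa using h0
  have hev : ∀ᶠ η : ℝ in 𝓝[>] 0, C * √(2 * η) < ε ∧ η < min (1 / 2) ε ∧ 0 < η :=
    (hlim.eventually (gt_mem_nhds hε)).and
      (((gt_mem_nhds (lt_min one_half_pos hε)).filter_mono nhdsWithin_le_nhds).and
        self_mem_nhdsWithin)
  obtain ⟨η, h1, h2, h3⟩ := hev.exists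
  have h4 := h2.trans_le (min_le_left _ _)
  have h5 := h2.trans_le (min_le_right _ _)
  refine ⟨η, h3, by linarith, h5.le, fun y y' u hy hy' hd => ?_⟩
  exact (hj y y' u (2 * η) hy hy' (by linarith) (by linarith) hd).mono (fun _ _ _ h => h)
    (ENNReal.ofReal_le_ofReal h1.le)

theorem coe_le_of_dist_le {y z : net.State} {R δ : ℝ} (hz : ∀ e, (z e : ℝ) ≤ R)
    (hd : dist y z ≤ δ) (e : net.Route) : (y e : ℝ) ≤ R + δ := by
  have h1 := (dist_le_pi_dist y z e).trans hd
  rw [NNReal.dist_eq] at h1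
  have := (abs_le.1 h1).2
  linarith [hz e]

/-- Approximations on adjacent intervals can be concatenated. -/
theorem trans (hσ : 0 ≤ σ) {R : ℝ} (hR : ∀ t e, (φ t e : ℝ) ≤ R) (hab : a ≤ b) (hbc : b ≤ c)
    (h₁ : Approximable φ σ a b) (h₂ : Approximable φ σ b c) : Approximable φ σ a c := by
  intro ε hε
  -- The delays add up to 4 η: η for each piece and 2 η for the bridge.
  obtain ⟨η, hη, hη1, hηε, hbridge⟩ :=
    exists_bridge_bound (R + 1) (show (0 : ℝ) < ε / 4 by positivity) net
  obtain ⟨k, x, x', a1, a2, a3, a4, a5⟩ := h₁ η hη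
  obtain ⟨l, y, y', b1, b2, b3, b4, b5⟩ := h₂ η hη
  have hd : dist x' y ≤ 2 * η := by
    refine (dist_triangle_right _ _ (φ b)).trans ?_
    linarith
  have hx' : ∀ e, (x' e : ℝ) ≤ R + 1 := fun e =>
    (coe_le_of_dist_le (hR b) a4 e).trans (by linarith)
  have hy : ∀ e, (y e : ℝ) ≤ R + 1 := fun e =>
    (coe_le_of_dist_le (hR b) b3 e).trans (by linarith)
  refine ⟨k + 2 * η + l, x, y', by linarith, by linarith, by linarith, by linarith, ?_⟩
  have j1 := a5.mono (G' := fun t z => ∃ s ∈ Icc a c, |s - a - t| ≤ ε ∧ dist z (φ s) ≤ σ + ε)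
    (fun t ht z hz => by
      obtain ⟨s, hs, hst, hzs⟩ := hz
      exact ⟨s, ⟨hs.1, hs.2.trans hbc⟩, by linarith, by linarith⟩) le_rfl
  have j2 := (hbridge x' y k hx' hy hd).mono
    (G' := fun t z => ∃ s ∈ Icc a c, |s - a - t| ≤ ε ∧ dist z (φ s) ≤ σ + ε)
    (fun t ht z hz => by
      refine ⟨b, ⟨hab, hbc⟩, ?_, ?_⟩
      · rw [abs_le]; constructor <;> linarith [ht.1, ht.2]
      · have := dist_triangle z x' (φ b)
        linarith) le_rfl
  have j3 := (b5.translate (u := k + 2 * η)).mono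
    (G' := fun t z => ∃ s ∈ Icc a c, |s - a - t| ≤ ε ∧ dist z (φ s) ≤ σ + ε)
    (fun t ht z hz => by
      obtain ⟨s, hs, hst, hzs⟩ := hz
      refine ⟨s, ⟨hab.trans hs.1, hs.2⟩, ?_, by linarith⟩
      rw [abs_le] at hst ⊢
      constructor <;> linarith [hst.1, hst.2]) le_rfl
  refine ((j1.trans j2).trans j3).mono (fun _ _ _ h => h) ?_
  have hcost : pathCost φ a b + pathCost φ b c = pathCost φ a c :=
    setLIntegral_Icc_add_le _ hab hbc
  rw [← hcost, mul_add]
  have e1 : ENNReal.ofReal (σ * (b - a) + η) + ENNReal.ofReal (ε / 4)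
      + ENNReal.ofReal (σ * (c - b) + η) ≤ ENNReal.ofReal (σ * (c - a) + ε) := by
    have h1 : 0 ≤ σ * (b - a) := mul_nonneg hσ (by linarith)
    have h2 : 0 ≤ σ * (c - b) := mul_nonneg hσ (by linarith)
    rw [← ENNReal.ofReal_add (by positivity) (by positivity),
      ← ENNReal.ofReal_add (by positivity) (by positivity)]
    exact ENNReal.ofReal_le_ofReal (by linarith)
  refine le_trans (le_of_eq ?_) (add_le_add_right e1 _)
  ring

/-- It suffices to approximate on the compact subintervals of the open interval. -/
theorem of_forall_subinterval (hσ : 0 ≤ σ) {R : ℝ} (hR : ∀ t e, (φ t e : ℝ) ≤ R) (hab : a ≤ b)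
    (hcont : ContinuousOn φ (Icc a b))
    (h : ∀ s t, a < s → s ≤ t → t < b → Approximable φ σ s t) : Approximable φ σ a b := by
  rcases hab.eq_or_lt with rfl | hlt
  · exact refl φ hσ a
  intro ε hε
  -- Two bridges of length 2 η and the delay η of the inner piece give 5 η.
  obtain ⟨η, hη, hη1, hηε, hbridge⟩ :=
    exists_bridge_bound (R + 1) (show (0 : ℝ) < ε / 5 by positivity) net
  obtain ⟨δ, hδ, hδ'⟩ := Metric.uniformContinuousOn_iff.1
    (isCompact_Icc.uniformContinuousOn_of_continuous hcont) η hη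
  -- The condition ρ ≤ η makes the bridges at least as long as the end pieces they replace, so the
  -- total duration is at least b - a.
  set ρ : ℝ := min (min (δ / 2) η) ((b - a) / 3)
  have hρ : 0 < ρ := lt_min (lt_min (by positivity) hη) (by linarith)
  have hρδ : ρ < δ := lt_of_le_of_lt ((min_le_left _ _).trans (min_le_left _ _)) (by linarith)
  have hρη : ρ ≤ η := (min_le_left _ _).trans (min_le_right _ _)
  have hρab : ρ ≤ (b - a) / 3 := min_le_right _ _
  have da : dist (φ (a + ρ)) (φ a) ≤ η := (hδ' _ ⟨by linarith, by linarith⟩ _ ⟨le_rfl, hab⟩ (by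
    rw [Real.dist_eq, add_sub_cancel_left, abs_of_pos hρ]; exact hρδ)).le
  have db : dist (φ (b - ρ)) (φ b) ≤ η := (hδ' _ ⟨by linarith, by linarith⟩ _ ⟨hab, le_rfl⟩ (by
    rw [Real.dist_eq, sub_sub_cancel_left, abs_neg, abs_of_pos hρ]; exact hρδ)).le
  obtain ⟨k, y, y', a1, a2, a3, a4, a5⟩ := h (a + ρ) (b - ρ) (by linarith) (by linarith)
    (by linarith) η hη
  have hy : ∀ e, (y e : ℝ) ≤ R + 1 := fun e =>
    (coe_le_of_dist_le (hR (a + ρ)) a3 e).trans (by linarith)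
  have hy' : ∀ e, (y' e : ℝ) ≤ R + 1 := fun e =>
    (coe_le_of_dist_le (hR (b - ρ)) a4 e).trans (by linarith)
  have hR1 : ∀ t e, (φ t e : ℝ) ≤ R + 1 := fun t e => (hR t e).trans (by linarith)
  have d1 : dist (φ a) y ≤ 2 * η := by
    have := dist_triangle y (φ (a + ρ)) (φ a)
    rw [dist_comm]; linarith
  have d2 : dist y' (φ b) ≤ 2 * η := by
    have := dist_triangle y' (φ (b - ρ)) (φ b)
    linarith
  refine ⟨2 * η + k + 2 * η, φ a, φ b, by linarith, by linarith, by simpa using hε.le,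
    by simpa using hε.le, ?_⟩
  have j1 := (hbridge (φ a) y 0 (hR1 a) hy d1).mono
    (G' := fun t z => ∃ s ∈ Icc a b, |s - a - t| ≤ ε ∧ dist z (φ s) ≤ σ + ε)
    (fun t ht z hz => by
      refine ⟨a, ⟨le_rfl, hab⟩, ?_, by linarith⟩
      rw [abs_le]; constructor <;> linarith [ht.1, ht.2]) le_rfl
  rw [zero_add] at j1
  have j2 := (a5.translate (u := 2 * η)).mono
    (G' := fun t z => ∃ s ∈ Icc a b, |s - a - t| ≤ ε ∧ dist z (φ s) ≤ σ + ε)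
    (fun t ht z hz => by
      obtain ⟨s, hs, hst, hzs⟩ := hz
      refine ⟨s, ⟨by linarith [hs.1], by linarith [hs.2]⟩, ?_, by linarith⟩
      rw [abs_le] at hst ⊢
      constructor <;> linarith [hst.1, hst.2]) le_rfl
  have j3 := (hbridge y' (φ b) (2 * η + k) hy' (hR1 b) d2).mono
    (G' := fun t z => ∃ s ∈ Icc a b, |s - a - t| ≤ ε ∧ dist z (φ s) ≤ σ + ε)
    (fun t ht z hz => by
      refine ⟨b, ⟨hab, le_rfl⟩, ?_, ?_⟩
      · rw [abs_le]; constructor <;> linarith [ht.1, ht.2]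
      · have := dist_triangle z y' (φ b)
        linarith) le_rfl
  refine ((j1.trans j2).trans j3).mono (fun _ _ _ h => h) ?_
  have hcost : pathCost φ (a + ρ) (b - ρ) ≤ pathCost φ a b :=
    lintegral_mono_set (Icc_subset_Icc (by linarith) (by linarith))
  have e1 : ENNReal.ofReal (ε / 5) + ENNReal.ofReal (σ * (b - ρ - (a + ρ)) + η)
      + ENNReal.ofReal (ε / 5) ≤ ENNReal.ofReal (σ * (b - a) + ε) := by
    have h1 : 0 ≤ σ * (b - ρ - (a + ρ)) := mul_nonneg hσ (by linarith)
    have h2 : σ * (b - ρ - (a + ρ)) ≤ σ * (b - a) :=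
      mul_le_mul_of_nonneg_left (by linarith) hσ
    rw [← ENNReal.ofReal_add (by positivity) (by positivity),
      ← ENNReal.ofReal_add (by positivity) (by positivity)]
    exact ENNReal.ofReal_le_ofReal (by linarith)
  refine le_trans (le_of_eq ?_) (add_le_add (mul_le_mul_right hcost (ENNReal.ofReal (1 + σ))) e1)
  ring

/-- Approximability is a local property. -/
theorem of_local (hσ : 0 ≤ σ) {R : ℝ} (hR : ∀ t e, (φ t e : ℝ) ≤ R) (hab : a ≤ b)
    (h : ∀ t ∈ Icc a b, ∃ ρ : ℝ, 0 < ρ ∧ ∀ u v, a ≤ u → u ≤ v → v ≤ b → t - ρ < u → v < t + ρ →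
      Approximable φ σ u v) : Approximable φ σ a b := by
  choose! ρ hρ hloc using h
  obtain ⟨τ, h0, hmono, ⟨m, hm⟩, hcov⟩ := exists_monotone_Icc_subset_open_cover_Icc hab
    (c := fun t : Icc a b => {s : Icc a b | (t : ℝ) - ρ t < s ∧ (s : ℝ) < t + ρ t})
    (fun t => (isOpen_lt continuous_const continuous_subtype_val).inter
      (isOpen_lt continuous_subtype_val continuous_const))
    (fun t _ => mem_iUnion.2 ⟨t, by
      have := hρ t t.2
      constructor <;> linarith⟩)
  have key : ∀ n, Approximable φ σ a (τ n) := by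
    intro n
    induction n with
    | zero => rw [h0]; exact refl φ hσ a
    | succ n ih =>
      have hle : τ n ≤ τ (n + 1) := hmono (Nat.le_succ n)
      refine trans hσ hR (τ n).2.1 hle ih ?_
      obtain ⟨t, ht⟩ := hcov n
      have h1 := ht (left_mem_Icc.2 hle)
      have h2 := ht (right_mem_Icc.2 hle)
      exact hloc t t.2 _ _ (τ n).2.1 hle (τ (n + 1)).2.2 h1.1 h2.2
  have := key m
  rw [hm m le_rfl] at this
  exact this

end Approximable

end StarNetwork

/-! ### Truncations, and the price of keeping a queue short. -/

theorem AbsolutelyContinuousOnInterval.max_const {f : ℝ → ℝ} {a b : ℝ}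
    (hf : AbsolutelyContinuousOnInterval f a b) (η : ℝ) :
    AbsolutelyContinuousOnInterval (fun t => max (f t) η) a b := by
  rw [absolutelyContinuousOnInterval_iff] at hf ⊢
  intro ε hε
  obtain ⟨δ, hδ, hE⟩ := hf ε hε
  refine ⟨δ, hδ, fun E hmem hlt => lt_of_le_of_lt ?_ (hE E hmem hlt)⟩
  exact Finset.sum_le_sum fun i _ => abs_max_sub_max_le_abs _ _ _

theorem AbsolutelyContinuousOnInterval.min_const {f : ℝ → ℝ} {a b : ℝ}
    (hf : AbsolutelyContinuousOnInterval f a b) (η : ℝ) :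
    AbsolutelyContinuousOnInterval (fun t => min (f t) η) a b := by
  have h := (hf.neg.max_const (-η)).neg
  have e : (fun t => min (f t) η) = -fun t => max ((-f) t) (-η) := by
    funext t
    simp only [Pi.neg_apply]
    rw [max_neg_neg, neg_neg]
  rw [e]
  exact h

/-- Derivatives of the truncations of an absolutely continuous function. -/
theorem AbsolutelyContinuousOnInterval.ae_deriv_truncation {f : ℝ → ℝ} {a b : ℝ}
    (hf : AbsolutelyContinuousOnInterval f a b) (η : ℝ) :
    ∀ᵐ t : ℝ, t ∈ uIcc a b →
      (f t ≤ η → deriv (fun s => max (f s) η) t = 0 ∧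
        deriv (fun s => min (f s) η) t = deriv f t) ∧
      (η < f t → deriv (fun s => max (f s) η) t = deriv f t ∧
        deriv (fun s => min (f s) η) t = 0) := by
  filter_upwards [(hf.max_const η).ae_differentiableAt, (hf.min_const η).ae_differentiableAt]
    with t h1 h2 ht
  -- Since f = max + min - η, it suffices that one truncation has an extremum at t: its derivative
  -- vanishes and the other carries the derivative of f.
  have e1 : deriv f t = deriv (fun s => max (f s) η) t + deriv (fun s => min (f s) η) t := by
    have : f = fun s => max (f s) η + min (f s) η - η := by
      funext s
      rw [max_add_min]
      ring
    conv_lhs => rw [this]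
    rw [deriv_sub_const]
    exact deriv_fun_add (h1 ht) (h2 ht)
  constructor
  · intro hle
    have h0 : deriv (fun s => max (f s) η) t = 0 := by
      refine IsLocalMin.deriv_eq_zero (Eventually.of_forall fun s => ?_)
      simp only [max_eq_right hle]
      exact le_max_right _ _
    exact ⟨h0, by rw [e1, h0, zero_add]⟩
  · intro hlt
    have h0 : deriv (fun s => min (f s) η) t = 0 := by
      refine IsLocalMax.deriv_eq_zero (Eventually.of_forall fun s => ?_)
      simp only [min_eq_right hlt.le]
      exact min_le_right _ _
    exact ⟨by rw [e1, h0, add_zero], h0⟩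

/-- A queue with a small service rate that returns to its initial length pays at least the price
of blocking the arrivals. -/
theorem ofReal_mul_le_lintegral_of_loop {f m : ℝ → ℝ} {p q lam A M : ℝ} (hpq : p ≤ q)
    (hf : AbsolutelyContinuousOnInterval f p q) (hm : IntervalIntegrable m volume p q)
    (hm0 : ∀ t, 0 ≤ m t) (hA : ∀ t ∈ Icc p q, m t ≤ A) (hloop : f q = f p) :
    ENNReal.ofReal (lam * (q - p)) ≤ (∫⁻ t in Icc p q, dualCost lam (deriv f t) (m t))
      + ENNReal.ofReal ((lam * Real.exp (-M) + A * Real.exp M) * (q - p)) := by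
  -- At θ = -M the displacement term vanishes on a loop; what remains is lam up to errors in exp
  -- (-M) and A exp M, small once M is large and then A small.
  have h := ofReal_le_lintegral_dualCost lam (-M) hpq hf hm
  refine le_trans ?_ (add_le_add_left h _)
  refine le_trans (ENNReal.ofReal_le_ofReal ?_) ENNReal.ofReal_add_le
  have hint0 : 0 ≤ ∫ t in p..q, m t := intervalIntegral.integral_nonneg hpq fun t _ => hm0 t
  have hint : ∫ t in p..q, m t ≤ A * (q - p) := by
    have := intervalIntegral.integral_mono_on hpq hm intervalIntegrable_const hA
    rwa [intervalIntegral.integral_const, smul_eq_mul, mul_comm] at this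
  rw [hloop, neg_neg]
  have h1 : Real.exp M * ∫ t in p..q, m t ≤ Real.exp M * (A * (q - p)) :=
    mul_le_mul_of_nonneg_left hint (Real.exp_pos M).le
  nlinarith

/-- The price of blocking the arrivals is paid while a queue stays below a small level. -/
theorem lintegral_indicator_le_of_floor {f m : ℝ → ℝ} {p q lam A M η : ℝ} (hpq : p ≤ q)
    (hlam : 0 ≤ lam) (hf : AbsolutelyContinuousOnInterval f p q) (hfm : Measurable f)
    (hM : 0 ≤ M) (hf0 : ∀ t, 0 ≤ f t) (hη : 0 ≤ η) (hm0 : ∀ t, 0 ≤ m t) (hA0 : 0 ≤ A)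
    (hA : ∀ t ∈ Icc p q, f t ≤ η → m t ≤ A) :
    ∫⁻ t in Icc p q, {t | f t ≤ η}.indicator (fun _ => ENNReal.ofReal lam) t
      ≤ (∫⁻ t in Icc p q, {t | f t ≤ η}.indicator (fun t => dualCost lam (deriv f t) (m t)) t)
        + ENNReal.ofReal ((lam * Real.exp (-M) + A * Real.exp M) * (q - p) + M * η) := by
  set E : Set ℝ := {t | f t ≤ η} with hE
  have hEm : MeasurableSet E := measurableSet_le hfm measurable_const
  set k : ℝ := lam * Real.exp (-M) + A * Real.exp M
  have hk : 0 ≤ k := by positivity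
  -- The truncation takes values in [0, η], so the boundary term costs at most M η however often f
  -- crosses the level.
  set ζ : ℝ → ℝ := fun s => min (f s) η
  have hζ : AbsolutelyContinuousOnInterval ζ p q := hf.min_const η
  set v : ℝ := (volume (E ∩ Icc p q)).toReal
  have hvfin : volume (E ∩ Icc p q) ≠ ⊤ :=
    ((measure_mono inter_subset_right).trans_lt (by simp)).ne
  have hv : v ≤ q - p := by
    have h1 : volume (E ∩ Icc p q) ≤ ENNReal.ofReal (q - p) := by
      rw [← Real.volume_Icc]; exact measure_mono inter_subset_right
    exact ENNReal.toReal_le_of_le_ofReal (by linarith) h1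
  have hv0 : 0 ≤ v := ENNReal.toReal_nonneg
  have hL : ∫⁻ t in Icc p q, E.indicator (fun _ => ENNReal.ofReal lam) t
      = ENNReal.ofReal (lam * v) := by
    rw [lintegral_indicator hEm, lintegral_const, Measure.restrict_restrict hEm,
      Measure.restrict_apply_univ, ENNReal.ofReal_mul hlam, ENNReal.ofReal_toReal hvfin]
  -- Below the level `g` is a lower bound for the cost, given by θ = -M; above it `g` vanishes
  -- almost everywhere, because the derivative of ζ does.
  set g : ℝ → ℝ := fun t => E.indicator (fun _ => lam - k) t - M * deriv ζ t
  have hdζ : IntegrableOn (deriv ζ) (Icc p q) volume := by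
    have := hζ.intervalIntegrable_deriv
    rwa [intervalIntegrable_iff_integrableOn_Icc_of_le hpq] at this
  have hi1 : IntegrableOn (E.indicator fun _ => lam - k) (Icc p q) volume :=
    (integrableOn_const (by simp)).indicator hEm
  have hg : IntegrableOn g (Icc p q) volume := hi1.sub (hdζ.const_mul M)
  have hgint : ∫ t in Icc p q, g t = (lam - k) * v - M * (ζ q - ζ p) := by
    rw [integral_sub hi1 (hdζ.const_mul M), integral_const_mul, integral_indicator hEm,
      setIntegral_const, measureReal_restrict_apply hEm, smul_eq_mul, mul_comm]
    congr 2
    rw [← hζ.integral_deriv_eq_sub, intervalIntegral.integral_of_le hpq,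
      integral_Icc_eq_integral_Ioc]
  have hpt : ∀ᵐ t ∂(volume.restrict (Icc p q)), ENNReal.ofReal (g t)
      ≤ E.indicator (fun t => dualCost lam (deriv f t) (m t)) t := by
    filter_upwards [ae_restrict_of_ae (hf.ae_deriv_truncation η),
      ae_restrict_mem measurableSet_Icc] with t ht htm
    have ht' := ht (by rwa [uIcc_of_le hpq])
    by_cases htE : t ∈ E
    · have h1 := (ht'.1 htE).2
      simp only [g]
      rw [indicator_of_mem htE, indicator_of_mem htE, h1]
      refine le_trans (ENNReal.ofReal_le_ofReal ?_) (le_dualCost lam (deriv f t) (m t) (-M))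
      have h2 := hA t htm htE
      have h3 := hm0 t
      have h4 := Real.exp_pos M
      have h5 : m t * Real.exp M ≤ A * Real.exp M := mul_le_mul_of_nonneg_right h2 h4.le
      simp only [k, neg_neg]
      nlinarith
    · have h1 := (ht'.2 (not_le.1 htE)).2
      simp only [g]
      rw [indicator_of_notMem htE, indicator_of_notMem htE, h1]
      simp
  rw [hL]
  have h1 : ENNReal.ofReal (∫ t in Icc p q, g t)
      ≤ ∫⁻ t in Icc p q, E.indicator (fun t => dualCost lam (deriv f t) (m t)) t :=
    (ofReal_integral_le_lintegral_ofReal hg).trans (lintegral_mono_ae hpt)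
  refine le_trans ?_ (add_le_add_left h1 _)
  refine le_trans (ENNReal.ofReal_le_ofReal ?_) ENNReal.ofReal_add_le
  rw [hgint]
  have z1 : ζ q ≤ η := min_le_right _ _
  have z2 : 0 ≤ ζ p := le_min (hf0 p) hη
  have z3 : M * (ζ q - ζ p) ≤ M * η := mul_le_mul_of_nonneg_left (by linarith) hM
  have z4 : k * v ≤ k * (q - p) := mul_le_mul_of_nonneg_left hv hk
  nlinarith

/-! ### Comparison of rates, and the floor path with its interpolation. -/

namespace StarNetwork

variable {N : ℕ} {net : StarNetwork N}

theorem serviceRate_pos {x : net.State} {e : net.Route} (h : 0 < x e) :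
    0 < net.serviceRate x e := by
  obtain ⟨i, j, hi, hj, -, heq⟩ := net.exists_serviceRate_eq e
  have hx : (0 : ℝ) < x e := by exact_mod_cast h
  have h1 := hx.trans_le (net.coe_le_load x hi)
  have h2 := hx.trans_le (net.coe_le_load x hj)
  have h3 := net.capacity_pos i
  have h4 := net.capacity_pos j
  have h5 := net.size_pos e.1
  rw [heq]
  have : 0 < min (net.capacity i / net.load x i) (net.capacity j / net.load x j) :=
    lt_min (by positivity) (by positivity)
  positivity

/-- The coordinate and the loads each contribute a factor 1 + κ / 3, and (1 + κ / 3)² ≤ 1 + κ for κ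
≤ 1. -/
theorem serviceRate_le_one_add_mul {x y : net.State} {e : net.Route} {κ η c : ℝ} (hκ : 0 < κ)
    (hκ1 : κ ≤ 1) (hc : 0 < c) (hy : η ≤ y e)
    (hxy : |(x e : ℝ) - y e| ≤ κ / 3 * η) (hlx : ∀ i ∈ e.1, c ≤ net.load x i)
    (hly : ∀ i ∈ e.1, c ≤ net.load y i)
    (hl : ∀ i ∈ e.1, |net.load x i - net.load y i| ≤ κ / 3 * c) :
    net.serviceRate x e ≤ (1 + κ) * net.serviceRate y e := by
  have h1 : net.serviceRate x e ≤ (1 + κ / 3) ^ 2 * net.serviceRate y e := by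
    refine net.serviceRate_le_mul (by positivity) ?_ (fun i hi => hc.trans_le (hlx i hi))
      (fun i hi => hc.trans_le (hly i hi)) fun i hi => ?_
    · have := (abs_le.1 hxy).2
      have : κ / 3 * η ≤ κ / 3 * y e := by gcongr
      linarith
    · have := (abs_le.1 (hl i hi)).1
      have : κ / 3 * c ≤ κ / 3 * net.load x i := by
        have := hlx i hi
        gcongr
      linarith
  refine h1.trans (mul_le_mul_of_nonneg_right ?_ (net.serviceRate_nonneg y e))
  nlinarith

theorem dualCost_serviceRate_le {x y : net.State} {e : net.Route} {κ η c : ℝ} (D : ℝ)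
    (hκ : 0 < κ) (hκ1 : κ ≤ 1) (hη : 0 < η) (hc : 0 < c) (hx : η ≤ x e) (hy : η ≤ y e)
    (hxy : |(x e : ℝ) - y e| ≤ κ / 3 * η) (hlx : ∀ i ∈ e.1, c ≤ net.load x i)
    (hly : ∀ i ∈ e.1, c ≤ net.load y i)
    (hl : ∀ i ∈ e.1, |net.load x i - net.load y i| ≤ κ / 3 * c) :
    dualCost (net.arrival e.1) D (net.serviceRate x e)
      ≤ dualCost (net.arrival e.1) D (net.serviceRate y e)
        + ENNReal.ofReal (κ * |D| + 2 * κ * net.rateBound) := by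
  have hx0 : 0 < x e := by exact_mod_cast hη.trans_le hx
  have hy0 : 0 < y e := by exact_mod_cast hη.trans_le hy
  refine (dualCost_le_add (net.arrival_nonneg e.1) (serviceRate_pos hx0) (serviceRate_pos hy0) hκ.le
    (serviceRate_le_one_add_mul hκ hκ1 hc hy hxy hlx hly hl)
    (serviceRate_le_one_add_mul hκ hκ1 hc hx (by rwa [abs_sub_comm]) hly hlx
      fun i hi => by rw [abs_sub_comm]; exact hl i hi)).trans ?_
  refine add_le_add_right (ENNReal.ofReal_le_ofReal ?_) _
  have h1 := mul_le_mul_of_nonneg_left (net.arrival_le e) hκ.le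
  have h2 := mul_le_mul_of_nonneg_left (net.serviceRate_le y e) hκ.le
  linarith

end StarNetwork

namespace StarNetwork

variable {N : ℕ} {net : StarNetwork N}

/-- The state obtained from `x` by emptying the links of `S` and by raising the other coordinates
to the level `η`. -/
noncomputable def floorState (S : Finset (Fin N)) (η : ℝ≥0) (x : net.State) : net.State :=
  open Classical in fun e => if ∃ i ∈ e.1, i ∈ S then 0 else max (x e) η

/-- A bound for the cost per unit of time of the route `e` along the interpolation of the floor
path of `φ`. -/
noncomputable def floorDensity (S : Finset (Fin N)) (η : ℝ≥0) (κ c : ℝ) (φ : ℝ → net.State)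
    (e : net.Route) (t : ℝ) : ℝ≥0∞ :=
  open Classical in
  if ∀ i ∈ e.1, i ∈ S then 0
  else if ∃ i ∈ e.1, i ∈ S then ENNReal.ofReal (net.arrival e.1)
  else (if φ t e ≤ η then ENNReal.ofReal (net.arrival e.1 + 4 * net.rateBound / c * η)
      else net.routeDensity φ e t
        + ENNReal.ofReal (κ * |deriv (fun s => (φ s e : ℝ)) t| + 2 * κ * net.rateBound))
    + ENNReal.ofReal (κ * |deriv (fun s => (φ s e : ℝ)) t| + 2 * κ * net.rateBound)

theorem floorState_of_mem {S : Finset (Fin N)} {η : ℝ≥0} {x : net.State} {e : net.Route}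
    (h : ∃ i ∈ e.1, i ∈ S) : floorState S η x e = 0 := if_pos h

theorem floorState_of_notMem {S : Finset (Fin N)} {η : ℝ≥0} {x : net.State} {e : net.Route}
    (h : ¬ ∃ i ∈ e.1, i ∈ S) : floorState S η x e = max (x e) η := if_neg h

theorem abs_floorState_sub_le (S : Finset (Fin N)) (η : ℝ≥0) {x : net.State} {ω : ℝ}
    (hω : ∀ e : net.Route, (∃ i ∈ e.1, i ∈ S) → (x e : ℝ) ≤ ω) (hω0 : 0 ≤ ω) (e : net.Route) :
    |(floorState S η x e : ℝ) - x e| ≤ ω + η := by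
  have hη := η.coe_nonneg
  have hx := (x e).coe_nonneg
  by_cases h : ∃ i ∈ e.1, i ∈ S
  · rw [floorState_of_mem h, NNReal.coe_zero, zero_sub, abs_neg, abs_of_nonneg hx]
    linarith [hω e h]
  · rw [floorState_of_notMem h, NNReal.coe_max, abs_of_nonneg (sub_nonneg.2 (le_max_left _ _))]
    rcases le_total (x e : ℝ) η with h1 | h1
    · rw [max_eq_right h1]; linarith
    · rw [max_eq_left h1]; linarith

theorem abs_floorState_sub_floorState_le (S : Finset (Fin N)) (η : ℝ≥0) (x y : net.State)
    (e : net.Route) :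
    |(floorState S η x e : ℝ) - floorState S η y e| ≤ |(x e : ℝ) - y e| := by
  by_cases h : ∃ i ∈ e.1, i ∈ S
  · rw [floorState_of_mem h, floorState_of_mem h]
    simp
  · rw [floorState_of_notMem h, floorState_of_notMem h, NNReal.coe_max, NNReal.coe_max]
    exact abs_max_sub_max_le_abs _ _ _

theorem measurable_floorDensity (S : Finset (Fin N)) (η : ℝ≥0) (κ c : ℝ) {φ : ℝ → net.State}
    (hφ : Measurable φ) (e : net.Route) : Measurable (floorDensity S η κ c φ e) := by
  have hd : Measurable fun t => ENNReal.ofReal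
      (κ * |deriv (fun s => (φ s e : ℝ)) t| + 2 * κ * net.rateBound) := by
    have h1 : Measurable (deriv fun s => (φ s e : ℝ)) := measurable_deriv _
    exact ((h1.abs.const_mul κ).add_const _).ennreal_ofReal
  have hs : MeasurableSet {t | φ t e ≤ η} :=
    measurableSet_le ((measurable_pi_apply e).comp hφ) measurable_const
  unfold floorDensity
  split_ifs with h1 h2
  · exact measurable_const
  · exact measurable_const
  · exact (Measurable.ite hs measurable_const
      ((net.measurable_routeDensity hφ e).add hd)).add hd

/-- Cost of one step of the interpolation of the floor path. -/
theorem join_floorState {S : Finset (Fin N)} {η : ℝ≥0} {κ c ω ρ : ℝ} {φ : ℝ → net.State} {u v : ℝ}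
    (huv : u < v) (hm : Measurable φ) (hφ : CoordAC φ u v) (hκ : 0 < κ) (hκ1 : κ ≤ 1) (hη : 0 < η) (hc : 0 < c)
    (hω0 : 0 ≤ ω) (hρη : ρ ≤ κ / 3 * η)
    (hsmall : Fintype.card net.Route * (ω + η + 2 * ρ) ≤ κ / 6 * c)
    (hρ : ∀ s ∈ Icc u v, ∀ t ∈ Icc u v, ∀ e, |(φ s e : ℝ) - φ t e| ≤ ρ)
    (hload : ∀ t ∈ Icc u v, ∀ i ∉ S, c ≤ net.load (φ t) i)
    (hω : ∀ t ∈ Icc u v, ∀ e : net.Route, (∃ i ∈ e.1, i ∈ S) → (φ t e : ℝ) ≤ ω) :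
    Join (fun t z => ∀ e, |(z e : ℝ) - φ t e| ≤ ω + η + 2 * ρ) u (floorState S η (φ u)) v
      (floorState S η (φ v)) (∫⁻ t in Icc u v, ∑ e, floorDensity S η κ c φ e t) := by
  classical
  have hvu : 0 < v - u := sub_pos.2 huv
  have hmemu : u ∈ Icc u v := ⟨le_rfl, huv.le⟩
  have hmemv : v ∈ Icc u v := ⟨huv.le, le_rfl⟩
  have hB := net.rateBound_pos
  have hηr : (0 : ℝ) < η := by exact_mod_cast hη
  have hρ0 : ∀ e : net.Route, 0 ≤ ρ := fun e => by simpa using hρ u hmemu u hmemu e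
  set x := floorState S η (φ u) with hx
  set x' := floorState S η (φ v) with hx'
  set D : net.Route → ℝ := fun e => ((x' e : ℝ) - x e) / (v - u) with hD
  have hxx : ∀ t ∈ Icc u v, ∀ e, |(floorState S η (φ t) e : ℝ) - x e| ≤ ρ := fun t ht e =>
    (abs_floorState_sub_floorState_le S η _ _ e).trans (hρ t ht u hmemu e)
  have hxφ : ∀ e, |(x e : ℝ) - φ u e| ≤ ω + η := abs_floorState_sub_le S η (hω u hmemu) hω0
  have hzx : ∀ t ∈ Icc u v, ∀ z : net.State, (∀ e, (z e : ℝ) = x e + (t - u) * D e) →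
      ∀ e, |(z e : ℝ) - x e| ≤ ρ := by
    intro t ht z hz e
    have h1 := hxx v hmemv e
    have h2 : (t - u) / (v - u) ≤ 1 := (div_le_one hvu).2 (by linarith [ht.2])
    have h3 : 0 ≤ (t - u) / (v - u) := div_nonneg (by linarith [ht.1]) hvu.le
    have e1 : (z e : ℝ) - x e = (t - u) / (v - u) * ((x' e : ℝ) - x e) := by
      rw [hz]; simp only [hD]; field_simp; ring
    rw [e1, abs_mul, abs_of_nonneg h3]
    exact (mul_le_of_le_one_left (abs_nonneg _) h2).trans h1
  have hzφ : ∀ t ∈ Icc u v, ∀ s ∈ Icc u v, ∀ z : net.State,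
      (∀ e, (z e : ℝ) = x e + (t - u) * D e) → ∀ e, |(z e : ℝ) - φ s e| ≤ ω + η + 2 * ρ := by
    intro t ht s hs z hz e
    have h1 := abs_le.1 (hzx t ht z hz e)
    have h2 := abs_le.1 (hxφ e)
    have h3 := abs_le.1 (hρ u hmemu s hs e)
    rw [abs_le]
    constructor <;> linarith [h1.1, h1.2, h2.1, h2.2, h3.1, h3.2]
  have hxz : ∀ e, (x e : ℝ) = x e + (u - u) * D e := fun e => by simp
  have hloadle : ∀ (z w : net.State), (∀ e, |(z e : ℝ) - w e| ≤ ω + η + 2 * ρ) →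
      ∀ e : net.Route, ∀ i ∈ e.1, |net.load z i - net.load w i| ≤ κ / 6 * c := by
    intro z w h e i _
    have h0 : 0 ≤ ω + η + 2 * ρ := (abs_nonneg _).trans (h e)
    exact (net.abs_load_sub_le z w i h0 fun f _ => h f).trans hsmall
  have hkeep : ∀ e : net.Route, (¬ ∃ i ∈ e.1, i ∈ S) → ∀ i ∈ e.1, i ∉ S := fun e h i hi hiS =>
    h ⟨i, hi, hiS⟩
  -- Loads along the segment stay above c / 2. As κ / 6 * c = κ / 3 * (c / 2), the comparison of
  -- rates applies with c / 2 in place of c.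
  have hκc : κ / 6 * c ≤ c / 2 := by nlinarith
  have hloadz : ∀ t ∈ Icc u v, ∀ z : net.State, (∀ e, (z e : ℝ) = x e + (t - u) * D e) →
      ∀ e : net.Route, (¬ ∃ i ∈ e.1, i ∈ S) → ∀ i ∈ e.1, c / 2 ≤ net.load z i := by
    intro t ht z hz e he i hi
    have h1 := hload t ht i (hkeep e he i hi)
    have h2 := (abs_le.1 (hloadle z (φ t) (hzφ t ht t ht z hz) e i hi)).1
    linarith
  have hxη : ∀ e : net.Route, (¬ ∃ i ∈ e.1, i ∈ S) → ∀ t, (η : ℝ) ≤ floorState S η (φ t) e := by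
    intro e he t
    rw [floorState_of_notMem he, NNReal.coe_max]
    exact le_max_right _ _
  have hzη : ∀ t ∈ Icc u v, ∀ z : net.State, (∀ e, (z e : ℝ) = x e + (t - u) * D e) →
      ∀ e : net.Route, (¬ ∃ i ∈ e.1, i ∈ S) → (η : ℝ) ≤ z e := by
    intro t ht z hz e he
    have e1 : (z e : ℝ) = ((v - t) * x e + (t - u) * x' e) / (v - u) := by
      rw [hz]; simp only [hD]; field_simp; ring
    rw [e1, le_div_iff₀ hvu]
    have h1 := mul_le_mul_of_nonneg_left (hxη e he u) (sub_nonneg.2 ht.2)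
    have h2 := mul_le_mul_of_nonneg_left (hxη e he v) (sub_nonneg.2 ht.1)
    simp only [hx, hx']
    linarith
  -- A route inside S has two empty links and is inactive. A route with only one link in S stays
  -- empty and blocks its arrivals. For the others the service rate is frozen at the initial state
  -- x, which makes the bound constant in time and prepares Jensen's inequality.
  set B : net.Route → ℝ → ℝ≥0∞ := fun e _ =>
    if ∀ i ∈ e.1, i ∈ S then 0
    else if ∃ i ∈ e.1, i ∈ S then ENNReal.ofReal (net.arrival e.1)
    else dualCost (net.arrival e.1) (D e) (net.serviceRate x e)
      + ENNReal.ofReal (κ * |D e| + 2 * κ * net.rateBound) with hBdef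
  have hseg : Join (fun t z => ∀ e, |(z e : ℝ) - φ t e| ≤ ω + η + 2 * ρ) u x v x'
      (∫⁻ t in Icc u v, ∑ e, B e t) := by
    refine join_segment huv (fun t ht z hz e => hzφ t ht t ht z hz e) fun t ht z hz e hact => ?_
    have htI := Ioo_subset_Icc_self ht
    simp only [hBdef]
    have hz0 : ∀ f : net.Route, (∃ i ∈ f.1, i ∈ S) → (z f : ℝ) = 0 := by
      intro f hf
      rw [hz f, hx, hx', floorState_of_mem hf, floorState_of_mem hf]
      simp
    split_ifs with h1 h2
    · exfalso
      obtain ⟨i, hi, hpos⟩ := hact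
      obtain ⟨f, hf, hzf⟩ := (net.load_pos_iff z i).1 hpos
      have := hz0 f ⟨i, hf, h1 i hi⟩
      exact hzf.ne' (by exact_mod_cast this)
    · have h3 : D e = 0 := by
        simp only [hD, hx, hx']
        rw [floorState_of_mem h2, floorState_of_mem h2]
        simp
      have h4 : z e = 0 := by exact_mod_cast hz0 e h2
      have h5 : ((x' e : ℝ) - x e) / (v - u) = 0 := h3
      rw [h5, net.serviceRate_eq_zero h4]
      simpa using dualCost_zero_le (net.arrival_nonneg e.1) le_rfl
    · refine dualCost_serviceRate_le (c := c / 2) (D e) hκ hκ1 hηr (by positivity)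
        (hzη t htI z hz e h2) (hxη e h2 u) ((hzx t htI z hz e).trans hρη)
        (hloadz t htI z hz e h2) (hloadz u hmemu x hxz e h2) fun i hi => ?_
      refine (hloadle z x (fun f => ?_) e i hi).trans (by linarith)
      have := hzx t htI z hz f
      have := hρ0 f
      linarith
  refine hseg.mono (fun _ _ _ h => h) ?_
  rw [lintegral_finsetSum _ fun e _ => measurable_const,
    lintegral_finsetSum _ fun e _ => measurable_floorDensity S η κ c hm e]
  refine Finset.sum_le_sum fun e _ => ?_
  simp only [floorDensity]
  split_ifs with h1 h2
  · exact le_rfl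
  · exact le_rfl
  have hχ : AbsolutelyContinuousOnInterval (fun t => max (φ t e : ℝ) η) u v :=
    (hφ e).max_const η
  have hχx : ∀ t, max (φ t e : ℝ) η = floorState S η (φ t) e := fun t => by
    rw [floorState_of_notMem h2, NNReal.coe_max]
  have hd : Measurable fun t => ENNReal.ofReal
      (κ * |deriv (fun s => (φ s e : ℝ)) t| + 2 * κ * net.rateBound) := by
    have h1 : Measurable (deriv fun s => (φ s e : ℝ)) := measurable_deriv _
    exact ((h1.abs.const_mul κ).add_const _).ennreal_ofReal
  rw [lintegral_add_right _ measurable_const, lintegral_add_right _ hd]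
  refine add_le_add ?_ ?_
  -- Jensen for the coordinate truncated at η, with frozen rate. Below η the truncation is at rest
  -- and costs at most lam plus a rate of order η; above it the frozen rate is compared with the
  -- rate of φ.
  · have hJ := ofReal_mul_dualCost_average_le (net.arrival e.1) (m := fun _ => net.serviceRate x e)
      huv hχ intervalIntegrable_const
    rw [intervalIntegral.integral_const, smul_eq_mul, mul_div_cancel_left₀ _ hvu.ne', hχx, hχx] at hJ
    rw [setLIntegral_const, Real.volume_Icc, mul_comm]
    refine hJ.trans (lintegral_mono_ae ?_)
    filter_upwards [ae_restrict_of_ae ((hφ e).ae_deriv_truncation η),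
      ae_restrict_mem measurableSet_Icc] with t ht htI
    have ht' := ht (by rwa [uIcc_of_le huv.le])
    split_ifs with hle
    · have hle' : (φ t e : ℝ) ≤ η := by exact_mod_cast hle
      rw [(ht'.1 hle').1]
      refine (dualCost_zero_le (net.arrival_nonneg e.1) (net.serviceRate_nonneg x e)).trans
        (ENNReal.ofReal_le_ofReal ?_)
      have hi := e.1.out_fst_mem
      have g1 := net.serviceRate_mul_load_le x hi
      have g2 := hloadz u hmemu x hxz e h2 _ hi
      have g3 : (x e : ℝ) ≤ 2 * η := by
        have k1 := (abs_le.1 (hxx t htI e)).1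
        have k2 : (floorState S η (φ t) e : ℝ) = η := by rw [← hχx, max_eq_right hle']
        have k3 : κ / 3 * η ≤ η := by nlinarith
        linarith
      have g4 : net.serviceRate x e * (c / 2) ≤ net.rateBound * (2 * η) :=
        (mul_le_mul_of_nonneg_left g2 (net.serviceRate_nonneg x e)).trans
          (g1.trans (mul_le_mul_of_nonneg_left g3 hB.le))
      have g5 : net.serviceRate x e ≤ 4 * net.rateBound / c * η := by
        rw [div_mul_eq_mul_div, le_div_iff₀ hc]
        linarith
      linarith
    · have hlt : (η : ℝ) < φ t e := by exact_mod_cast not_le.1 hle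
      rw [(ht'.2 hlt).1]
      have hφe : (floorState S η (φ t) e : ℝ) = φ t e := by rw [← hχx, max_eq_left hlt.le]
      have hpos : 0 < φ t e := by exact_mod_cast hηr.trans hlt
      rw [routeDensity, if_pos (net.active_of_pos hpos)]
      refine dualCost_serviceRate_le (c := c / 2) _ hκ hκ1 hηr (by positivity) (hxη e h2 u) hlt.le
        ?_ (hloadz u hmemu x hxz e h2) (fun i hi => ?_) fun i hi => ?_
      · rw [← hφe, abs_sub_comm]
        exact (hxx t htI e).trans hρη
      · linarith [hload t htI i (hkeep e h2 i hi)]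
      · exact (hloadle x (φ t) (hzφ u hmemu t htI x hxz) e i hi).trans (by linarith)
  · have hdi := (hφ e).intervalIntegrable_deriv
    rw [intervalIntegrable_iff_integrableOn_Icc_of_le huv.le] at hdi
    have hgi : IntegrableOn (fun t => κ * |deriv (fun s => (φ s e : ℝ)) t|
        + 2 * κ * net.rateBound) (Icc u v) volume :=
      (hdi.abs.const_mul κ).add (integrableOn_const (by simp))
    rw [setLIntegral_const, Real.volume_Icc, ← ENNReal.ofReal_mul (by positivity)]
    refine le_trans (ENNReal.ofReal_le_ofReal ?_) (ofReal_integral_le_lintegral_ofReal hgi)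
    rw [integral_add (hdi.abs.const_mul κ) (integrableOn_const (by simp)), integral_const_mul,
      setIntegral_const, smul_eq_mul, Real.volume_real_Icc_of_le huv.le]
    have k1 : |D e| * (v - u) = |(x' e : ℝ) - x e| := by
      simp only [hD]
      rw [abs_div, abs_of_pos hvu]
      field_simp
    have k2 : |(x' e : ℝ) - x e| ≤ |(φ v e : ℝ) - φ u e| :=
      abs_floorState_sub_floorState_le S η _ _ e
    have k3 : |(φ v e : ℝ) - φ u e| ≤ ∫ t in Icc u v, |deriv (fun s => (φ s e : ℝ)) t| := by
      rw [← (hφ e).integral_deriv_eq_sub, intervalIntegral.integral_of_le huv.le,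
        ← integral_Icc_eq_integral_Ioc]
      exact abs_integral_le_integral_abs
    have k4 := mul_le_mul_of_nonneg_left (k1.le.trans (k2.trans k3)) hκ.le
    nlinarith

end StarNetwork

/-! ### The cost of the floor path, compared with the original path. -/

namespace StarNetwork

variable {N : ℕ} {net : StarNetwork N}

/-- The bound of |D| by the cost with κ = 1; since exp 1 < 3, the constant is 2 · 3 + 2 = 8. -/
theorem lintegral_speed_le {φ : ℝ → net.State} (hm : Measurable φ) (e : net.Route) {κ p q : ℝ}
    (hκ : 0 ≤ κ) :
    ∫⁻ t in Icc p q, ENNReal.ofReal (κ * |deriv (fun s => (φ s e : ℝ)) t| + 2 * κ * net.rateBound)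
      ≤ ENNReal.ofReal κ * (∫⁻ t in Icc p q, net.routeDensity φ e t)
        + ENNReal.ofReal (8 * κ * net.rateBound) * ENNReal.ofReal (q - p) := by
  have hB := net.rateBound_pos
  have h : ∀ t, ENNReal.ofReal
      (κ * |deriv (fun s => (φ s e : ℝ)) t| + 2 * κ * net.rateBound)
      ≤ ENNReal.ofReal κ * net.routeDensity φ e t + ENNReal.ofReal (8 * κ * net.rateBound) := by
    intro t
    have h1 := net.mul_abs_deriv_le φ e t zero_le_one
    rw [one_mul] at h1
    rw [ENNReal.ofReal_add (by positivity) (by positivity), ENNReal.ofReal_mul hκ]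
    refine (add_le_add_left (mul_le_mul_right h1 _) _).trans ?_
    rw [mul_add, add_assoc, ← ENNReal.ofReal_mul hκ,
      ← ENNReal.ofReal_add (by positivity) (by positivity)]
    refine add_le_add_right (ENNReal.ofReal_le_ofReal ?_) _
    have h3 : Real.exp 1 ≤ 3 := Real.exp_one_lt_three.le
    have h4 : 0 ≤ κ * net.rateBound := by positivity
    nlinarith
  refine (lintegral_mono h).trans (le_of_eq ?_)
  rw [lintegral_add_right _ measurable_const,
    lintegral_const_mul _ (net.measurable_routeDensity hm e), setLIntegral_const, Real.volume_Icc]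

/-- The interpolation of the floor path is hardly more expensive than the path itself. -/
theorem lintegral_floorDensity_le {S : Finset (Fin N)} {η : ℝ≥0} {κ c ω M p q : ℝ}
    {φ : ℝ → net.State} (hpq : p ≤ q) (hm : Measurable φ) (hφ : CoordAC φ p q) (hκ : 0 ≤ κ)
    (hc : 0 < c) (hω0 : 0 ≤ ω) (hM : 0 ≤ M)
    (hload : ∀ t ∈ Icc p q, ∀ i ∉ S, c ≤ net.load (φ t) i)
    (hω : ∀ t ∈ Icc p q, ∀ i ∈ S, net.load (φ t) i ≤ ω)
    (hp : ∀ i ∈ S, net.load (φ p) i = 0) (hq : ∀ i ∈ S, net.load (φ q) i = 0) (e : net.Route) :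
    ∫⁻ t in Icc p q, floorDensity S η κ c φ e t
      ≤ ENNReal.ofReal (1 + 2 * κ) * (∫⁻ t in Icc p q, net.routeDensity φ e t)
        + ENNReal.ofReal ((16 * net.rateBound * κ + net.rateBound * Real.exp (-M)
            + net.rateBound / c * ω * Real.exp M
            + (net.rateBound / c * Real.exp M + 4 * net.rateBound / c) * η) * (q - p)
            + M * η) := by
  classical
  have hB := net.rateBound_pos
  have hqp : 0 ≤ q - p := sub_nonneg.2 hpq
  have hη := η.coe_nonneg
  set I := ∫⁻ t in Icc p q, net.routeDensity φ e t with hI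
  have hone : I ≤ ENNReal.ofReal (1 + 2 * κ) * I := by
    refine le_mul_of_one_le_left zero_le ?_
    rw [← ENNReal.ofReal_one]
    exact ENNReal.ofReal_le_ofReal (by linarith)
  have hlam := net.arrival_le e
  have hlam0 := net.arrival_nonneg e.1
  have hrd : ∀ t ∈ Icc p q, (∃ i ∈ e.1, i ∉ S) → net.routeDensity φ e t
      = dualCost (net.arrival e.1) (deriv (fun s => (φ s e : ℝ)) t) (net.serviceRate (φ t) e) := by
    rintro t ht ⟨i, hi, hiS⟩
    exact if_pos ⟨i, hi, hc.trans_le (hload t ht i hiS)⟩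
  have hIeq : (∃ i ∈ e.1, i ∉ S) → I = ∫⁻ t in Icc p q, dualCost (net.arrival e.1)
      (deriv (fun s => (φ s e : ℝ)) t) (net.serviceRate (φ t) e) := fun h =>
    setLIntegral_congr_fun measurableSet_Icc fun t ht => hrd t ht h
  have hrate : ∀ t ∈ Icc p q, ∀ r : ℝ, (∃ i ∈ e.1, i ∉ S) → (φ t e : ℝ) ≤ r →
      net.serviceRate (φ t) e ≤ net.rateBound / c * r := by
    rintro t ht r ⟨i, hi, hiS⟩ hr
    rw [div_mul_eq_mul_div, le_div_iff₀ hc]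
    refine (mul_le_mul_of_nonneg_left (hload t ht i hiS) (net.serviceRate_nonneg _ _)).trans ?_
    exact (net.serviceRate_mul_load_le (φ t) hi).trans (mul_le_mul_of_nonneg_left hr hB.le)
  have hmi := intervalIntegrable_serviceRate hm e p q
  by_cases h1 : ∀ i ∈ e.1, i ∈ S
  · have : ∀ t, floorDensity S η κ c φ e t = 0 := fun t => if_pos h1
    simp [this]
  have h1' : ∃ i ∈ e.1, i ∉ S := by push Not at h1; exact h1
  by_cases h2 : ∃ i ∈ e.1, i ∈ S
  -- Here φ goes from 0 to 0 with a service rate at most `rateBound / c * ω`, so it pays nearly the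
  -- blocking price lam that the emptied route pays.
  · have hfd : ∀ t, floorDensity S η κ c φ e t = ENNReal.ofReal (net.arrival e.1) := fun t => by
      rw [floorDensity, if_neg h1, if_pos h2]
    simp_rw [hfd]
    rw [setLIntegral_const, Real.volume_Icc, ← ENNReal.ofReal_mul hlam0]
    obtain ⟨i, hi, hiS⟩ := h2
    have hp0 : (φ p e : ℝ) = 0 :=
      le_antisymm ((net.coe_le_load _ hi).trans (hp i hiS).le) (NNReal.coe_nonneg _)
    have hq0 : (φ q e : ℝ) = 0 :=
      le_antisymm ((net.coe_le_load _ hi).trans (hq i hiS).le) (NNReal.coe_nonneg _)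
    have h := ofReal_mul_le_lintegral_of_loop (lam := net.arrival e.1) (M := M)
      (A := net.rateBound / c * ω) hpq (hφ e) hmi
      (fun t => net.serviceRate_nonneg _ _)
      (fun t ht => hrate t ht ω h1' ((net.coe_le_load _ hi).trans (hω t ht i hiS)))
      (by rw [hp0, hq0])
    rw [← hIeq h1'] at h
    refine h.trans (add_le_add hone (ENNReal.ofReal_le_ofReal ?_))
    have k1 : net.arrival e.1 * Real.exp (-M) ≤ net.rateBound * Real.exp (-M) := by gcongr
    have k2 : 0 ≤ (16 * net.rateBound * κ
      + (net.rateBound / c * Real.exp M + 4 * net.rateBound / c) * η) * (q - p) := by positivity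
    have k3 : 0 ≤ M * η := by positivity
    have k4 := mul_le_mul_of_nonneg_right k1 hqp
    linarith
  · have hi := e.1.out_fst_mem
    have hfe : Measurable fun t => (φ t e : ℝ) :=
      measurable_coe_nnreal_real.comp ((measurable_pi_apply e).comp hm)
    set E : Set ℝ := {t | (φ t e : ℝ) ≤ η} with hE
    have hEm : MeasurableSet E := measurableSet_le hfe measurable_const
    set K : ℝ → ℝ≥0∞ := fun t => ENNReal.ofReal
      (κ * |deriv (fun s => (φ s e : ℝ)) t| + 2 * κ * net.rateBound)
    have hKm : Measurable K := by
      have h1 : Measurable (deriv fun s => (φ s e : ℝ)) := measurable_deriv _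
      exact ((h1.abs.const_mul κ).add_const _).ennreal_ofReal
    have hrm := net.measurable_routeDensity hm e
    set C₁ : ℝ := 4 * net.rateBound / c * η with hC₁
    have hC₁0 : 0 ≤ C₁ := by positivity
    have hfd : ∀ t, floorDensity S η κ c φ e t ≤
        ((E.indicator (fun _ => ENNReal.ofReal (net.arrival e.1)) t
          + Eᶜ.indicator (net.routeDensity φ e) t) + ENNReal.ofReal C₁) + (K t + K t) := by
      intro t
      rw [floorDensity, if_neg h1, if_neg h2, ← add_assoc _ (K t)]
      refine add_le_add_left ?_ _
      by_cases htE : (φ t e : ℝ) ≤ η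
      · have htE' : φ t e ≤ η := by exact_mod_cast htE
        rw [if_pos htE', indicator_of_mem (show t ∈ E from htE),
          indicator_of_notMem (show t ∉ Eᶜ from fun h => h htE), add_zero,
          ENNReal.ofReal_add hlam0 hC₁0]
        exact le_self_add
      · have htE' : ¬ φ t e ≤ η := by exact_mod_cast htE
        rw [if_neg htE', indicator_of_notMem (show t ∉ E from htE),
          indicator_of_mem (show t ∈ Eᶜ from htE), zero_add]
        exact add_le_add_left le_self_add _
    refine (lintegral_mono hfd).trans ?_
    have hKK : Measurable fun t => K t + K t := hKm.add hKm
    rw [lintegral_add_right _ hKK, lintegral_add_right _ measurable_const,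
      lintegral_add_right _ (hrm.indicator hEm.compl), lintegral_add_right _ hKm,
      setLIntegral_const, Real.volume_Icc, ← ENNReal.ofReal_mul hC₁0]
    -- While the coordinate is at most η its service rate is of order η, because its links are
    -- outside S and loaded; so φ itself pays the blocking price during that time.
    have hfl := lintegral_indicator_le_of_floor (lam := net.arrival e.1) (M := M)
      (A := net.rateBound / c * η) (η := η) hpq hlam0 (hφ e) hfe hM (fun t => NNReal.coe_nonneg _)
      hη (fun t => net.serviceRate_nonneg (φ t) e) (by positivity)
      (fun t ht hle => hrate t ht η h1' hle)
    have hsp := lintegral_speed_le (net := net) hm e (p := p) (q := q) hκ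
    have hcomb : (∫⁻ t in Icc p q, E.indicator (fun t => dualCost (net.arrival e.1)
        (deriv (fun s => (φ s e : ℝ)) t) (net.serviceRate (φ t) e)) t)
        + ∫⁻ t in Icc p q, Eᶜ.indicator (net.routeDensity φ e) t = I := by
      rw [← lintegral_add_right _ (hrm.indicator hEm.compl), hI]
      refine setLIntegral_congr_fun measurableSet_Icc fun t ht => ?_
      by_cases htE : t ∈ E
      · rw [indicator_of_mem htE, indicator_of_notMem (show t ∉ Eᶜ from fun h => h htE), add_zero,
          hrd t ht h1']
      · rw [indicator_of_notMem htE, indicator_of_mem (show t ∈ Eᶜ from htE), zero_add]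
    have hsum := add_le_add (add_le_add_left (add_le_add_left hfl
      (∫⁻ t in Icc p q, Eᶜ.indicator (net.routeDensity φ e) t)) (ENNReal.ofReal (C₁ * (q - p))))
      (add_le_add hsp hsp)
    refine hsum.trans ?_
    set F : ℝ := (net.arrival e.1 * Real.exp (-M) + net.rateBound / c * η * Real.exp M) * (q - p)
      + M * η with hF
    have hF0 : 0 ≤ F := by positivity
    rw [← ENNReal.ofReal_mul (by positivity), ← hI, add_right_comm _ (ENNReal.ofReal F), hcomb]
    have e1 : ENNReal.ofReal (1 + 2 * κ) * I = I + (ENNReal.ofReal κ * I + ENNReal.ofReal κ * I) := by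
      rw [ENNReal.ofReal_add zero_le_one (by positivity), ENNReal.ofReal_one,
        ENNReal.ofReal_mul zero_le_two, ENNReal.ofReal_ofNat]
      ring
    rw [e1]
    have e2 : I + ENNReal.ofReal F + ENNReal.ofReal (C₁ * (q - p))
        + (ENNReal.ofReal κ * I + ENNReal.ofReal (8 * κ * net.rateBound * (q - p))
        + (ENNReal.ofReal κ * I + ENNReal.ofReal (8 * κ * net.rateBound * (q - p))))
        = I + (ENNReal.ofReal κ * I + ENNReal.ofReal κ * I)
        + (ENNReal.ofReal F + ENNReal.ofReal (C₁ * (q - p))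
          + (ENNReal.ofReal (8 * κ * net.rateBound * (q - p))
            + ENNReal.ofReal (8 * κ * net.rateBound * (q - p)))) := by ring
    rw [e2, ← ENNReal.ofReal_add hF0 (by positivity),
      ← ENNReal.ofReal_add (by positivity) (by positivity),
      ← ENNReal.ofReal_add (by positivity) (by positivity)]
    refine add_le_add_right (ENNReal.ofReal_le_ofReal ?_) _
    have k1 : net.arrival e.1 * Real.exp (-M) ≤ net.rateBound * Real.exp (-M) := by gcongr
    have k4 := mul_le_mul_of_nonneg_right k1 hqp
    have k5 : 0 ≤ net.rateBound / c * ω * Real.exp M * (q - p) := by positivity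
    simp only [hF, hC₁]
    linarith

/-- Paths with short steps can be chained. -/
theorem Join.of_steps {G : ℝ → net.State → Prop} {χ : ℝ → net.State} {β : ℝ → ℝ≥0∞} {p q δ : ℝ}
    (hpq : p ≤ q) (hδ : 0 < δ) (h0 : G p (χ p))
    (h : ∀ u v, p ≤ u → u < v → v ≤ q → v - u ≤ δ →
      Join G u (χ u) v (χ v) (∫⁻ t in Icc u v, β t)) :
    Join G p (χ p) q (χ q) (∫⁻ t in Icc p q, β t) := by
  have key : ∀ k : ℕ, Join G p (χ p) (min (p + k * δ) q) (χ (min (p + k * δ) q))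
      (∫⁻ t in Icc p (min (p + k * δ) q), β t) := by
    intro k
    induction k with
    | zero =>
      rw [Nat.cast_zero, zero_mul, add_zero, min_eq_left hpq]
      exact (Join.refl h0).mono (fun _ _ _ h => h) zero_le
    | succ k ih =>
      set a := min (p + k * δ) q
      set b := min (p + (k + 1 : ℕ) * δ) q
      have hpa : p ≤ a := le_min (by
        have : 0 ≤ (k : ℝ) * δ := by positivity
        linarith) hpq
      have hab : a ≤ b := by
        refine min_le_min_right q ?_
        push_cast
        nlinarith
      rcases hab.eq_or_lt with heq | hlt
      · rwa [← heq]
      · have hstep := h a b hpa hlt (min_le_right _ _) (by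
          have h1 : b ≤ p + (k + 1 : ℕ) * δ := min_le_left _ _
          have h2 : a = p + k * δ := by
            refine min_eq_left (le_of_not_ge fun hc => ?_)
            have : a = q := min_eq_right hc
            exact absurd (hlt.trans_le (min_le_right _ _)) (by rw [this]; exact lt_irrefl q)
          rw [h2]
          push_cast at h1
          linarith)
        refine (ih.trans hstep).mono (fun _ _ _ h => h) ?_
        exact (setLIntegral_Icc_add_le _ hpa hab).le
  obtain ⟨k, hk⟩ := exists_nat_gt ((q - p) / δ)
  have hk' : q ≤ p + k * δ := by
    rw [div_lt_iff₀ hδ] at hk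
    linarith
  have := key k
  rwa [min_eq_right hk'] at this

/-- Allows finitely many smallness conditions on a parameter to be met at once. -/
theorem eventually_mul_le (k : ℝ) {b : ℝ} (hb : 0 < b) : ∀ᶠ x : ℝ in 𝓝[>] 0, k * x ≤ b := by
  have h : Tendsto (fun x : ℝ => k * x) (𝓝[>] 0) (𝓝 0) := by
    have : Continuous fun x : ℝ => k * x := by fun_prop
    simpa using (this.tendsto 0).mono_left (nhdsWithin_le_nhds (s := Ioi 0))
  exact (h.eventually (gt_mem_nhds hb)).mono fun x hx => hx.le

/-- While some links have a large load and the other ones have a small load that vanishes at both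
ends, the path can be approximated. -/
theorem exists_approximable_of_load_le (S : Finset (Fin N)) {c σ : ℝ} (hc : 0 < c) (hσ : 0 < σ) :
    ∃ ω : ℝ, 0 < ω ∧ ∀ (φ : ℝ → net.State) (p q : ℝ), p ≤ q → Measurable φ → CoordAC φ p q →
      ContinuousOn φ (Icc p q) → (∀ t ∈ Icc p q, ∀ i ∉ S, c ≤ net.load (φ t) i) →
      (∀ t ∈ Icc p q, ∀ i ∈ S, net.load (φ t) i ≤ ω) →
      (∀ i ∈ S, net.load (φ p) i = 0) → (∀ i ∈ S, net.load (φ q) i = 0) →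
      Approximable φ σ p q := by
  set B := net.rateBound with hBdef
  have hB : 0 < B := net.rateBound_pos
  set n : ℝ := Fintype.card net.Route + 1
  have hn : 0 < n := by positivity
  -- The order of choice matters: κ and M depend on σ only, ω on these and c, and none of them on
  -- the path or on ε; η and ρ come last. The errors from κ, exp (-M), ω and η each receive a
  -- quarter of σ.
  obtain ⟨κ, ⟨hκσ, hκ1, hκB⟩, hκ⟩ := (((eventually_mul_le 2 hσ).and ((eventually_mul_le 1 one_pos).and
    (eventually_mul_le (n * (16 * B)) (show 0 < σ / 4 by positivity)))).and
    self_mem_nhdsWithin).exists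
  set M : ℝ := 4 * B * n / σ
  have hM : 0 < M := by positivity
  have hexp : n * (B * Real.exp (-M)) ≤ σ / 4 := by
    have h1 : M ≤ Real.exp M := (by linarith : M ≤ M + 1).trans (Real.add_one_le_exp M)
    have h2 : Real.exp (-M) ≤ 1 / M := by
      rw [Real.exp_neg, ← one_div]
      exact one_div_le_one_div_of_le hM h1
    calc n * (B * Real.exp (-M)) ≤ n * (B * (1 / M)) := by gcongr
      _ = σ / 4 := by simp only [M]; field_simp
  obtain ⟨ω, ⟨hωσ, hωn, hωB⟩, hω⟩ := (((eventually_mul_le 1 hσ).and ((eventually_mul_le n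
    (show 0 < κ * c / 24 by positivity)).and
    (eventually_mul_le (n * (B / c * Real.exp M)) (show 0 < σ / 4 by positivity)))).and
    self_mem_nhdsWithin).exists
  refine ⟨ω, hω, fun φ p q hpq hm hφ hcont hload hlω hp hq ε hε => ?_⟩
  obtain ⟨η, ⟨hηε, hηn, hηM, hηB⟩, hη⟩ := (((eventually_mul_le 1 (show 0 < ε / 4 by positivity)).and
    ((eventually_mul_le n (show 0 < κ * c / 24 by positivity)).and
    ((eventually_mul_le (n * M) hε).and
    (eventually_mul_le (n * (B / c * Real.exp M + 4 * B / c)) (show 0 < σ / 4 by positivity))))).and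
    self_mem_nhdsWithin).exists
  lift η to ℝ≥0 using hη.le
  obtain ⟨ρ, ⟨hρε, hρn, hρη⟩, hρ⟩ := (((eventually_mul_le 1 (show 0 < ε / 4 by positivity)).and
    ((eventually_mul_le n (show 0 < κ * c / 24 by positivity)).and
    (eventually_mul_le 1 (show 0 < κ / 3 * η by positivity)))).and
    self_mem_nhdsWithin).exists
  rw [one_mul] at hκ1 hωσ hηε hρε hρη
  obtain ⟨δ, hδ, hδ'⟩ := Metric.uniformContinuousOn_iff.1
    (isCompact_Icc.uniformContinuousOn_of_continuous hcont) ρ hρ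
  have hφω : ∀ t ∈ Icc p q, ∀ e : net.Route, (∃ i ∈ e.1, i ∈ S) → (φ t e : ℝ) ≤ ω := by
    rintro t ht e ⟨i, hi, hiS⟩
    exact (net.coe_le_load _ hi).trans (hlω t ht i hiS)
  -- Where the loads in S vanish, emptying changes nothing and only the raising by η is felt. So the
  -- endpoints are ε-close although ω does not depend on ε.
  have hkill : ∀ t, (∀ i ∈ S, net.load (φ t) i = 0) → dist (floorState S η (φ t)) (φ t) ≤ ε := by
    intro t ht
    refine (dist_pi_le_iff hε.le).2 fun e => ?_
    rw [NNReal.dist_eq]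
    refine (abs_floorState_sub_le S η (ω := 0) ?_ le_rfl e).trans (by linarith)
    rintro f ⟨i, hi, hiS⟩
    exact (net.coe_le_load _ hi).trans (ht i hiS).le
  have hjoin : Join (fun t z => ∀ e, |(z e : ℝ) - φ t e| ≤ ω + η + 2 * ρ) p (floorState S η (φ p)) q
      (floorState S η (φ q)) (∫⁻ t in Icc p q, ∑ e, floorDensity S η κ c φ e t) := by
    refine Join.of_steps (χ := fun t => floorState S η (φ t)) hpq (half_pos hδ) (fun e => ?_)
      fun u v hu huv hv hvu => ?_
    · refine (abs_floorState_sub_le S η (hφω p ⟨le_rfl, hpq⟩) hω.le e).trans ?_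
      linarith
    · have hsub : Icc u v ⊆ Icc p q := Icc_subset_Icc hu hv
      refine join_floorState huv hm (hφ.subinterval hu huv.le hv) hκ hκ1 (by exact_mod_cast hη) hc
        hω.le hρη ?_ (fun s hs t ht e => ?_) (fun t ht => hload t (hsub ht))
        (fun t ht => hφω t (hsub ht))
      · have : Fintype.card net.Route * (ω + η + 2 * ρ) ≤ n * (ω + η + 2 * ρ) := by
          gcongr
          simp [n]
        linarith
      · rw [← NNReal.dist_eq]
        refine (dist_le_pi_dist _ _ e).trans (hδ' s (hsub hs) t (hsub ht) ?_).le
        rw [Real.dist_eq, abs_lt]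
        constructor <;> linarith [hs.1, hs.2, ht.1, ht.2]
  have hsh := hjoin.shift (-p)
  rw [add_neg_cancel, ← sub_eq_add_neg] at hsh
  refine ⟨q - p, floorState S η (φ p), floorState S η (φ q), le_rfl, by linarith, hkill p hp,
    hkill q hq, hsh.mono (fun t ht z hz => ?_) ?_⟩
  · refine ⟨t + p, ⟨by linarith [ht.1], by linarith [ht.2]⟩, by simpa using hε.le,
      (dist_pi_le_iff (by positivity)).2 fun e => ?_⟩
    have h1 := hz e
    rw [sub_neg_eq_add] at h1
    rw [NNReal.dist_eq]
    linarith
  · rw [lintegral_finsetSum _ fun e _ => measurable_floorDensity S η κ c hm e]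
    refine (Finset.sum_le_sum fun e _ => lintegral_floorDensity_le (M := M) hpq hm hφ hκ.le hc hω.le
      hM.le hload hlω hp hq e).trans ?_
    rw [Finset.sum_add_distrib, ← Finset.mul_sum]
    refine add_le_add ?_ ?_
    · unfold pathCost
      simp_rw [density_eq_sum]
      rw [lintegral_finsetSum _ fun e _ => net.measurable_routeDensity hm e]
      gcongr
    · rw [Finset.sum_const, nsmul_eq_mul, Finset.card_univ, ← ENNReal.ofReal_natCast,
        ← ENNReal.ofReal_mul (by positivity)]
      refine ENNReal.ofReal_le_ofReal ?_
      have hqp : 0 ≤ q - p := sub_nonneg.2 hpq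
      have hs : n * (16 * B * κ + B * Real.exp (-M) + B / c * ω * Real.exp M
          + (B / c * Real.exp M + 4 * B / c) * η) ≤ σ := by linarith
      set s := 16 * B * κ + B * Real.exp (-M) + B / c * ω * Real.exp M
          + (B / c * Real.exp M + 4 * B / c) * η
      have hs0 : 0 ≤ s * (q - p) + M * η := by positivity
      calc (Fintype.card net.Route : ℝ) * (s * (q - p) + M * η)
          ≤ n * (s * (q - p) + M * η) := by
            gcongr
            simp [n]
        _ = (n * s) * (q - p) + n * M * η := by ring
        _ ≤ σ * (q - p) + ε := by gcongr

end StarNetwork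

/-! ### Induction on the links that may become empty, and the final approximation. -/

namespace StarNetwork

variable {N : ℕ} {net : StarNetwork N}

theorem continuousOn_load_comp {φ : ℝ → net.State} {s : Set ℝ} (hcont : ContinuousOn φ s)
    (i : Fin N) : ContinuousOn (fun t => net.load (φ t) i) s :=
  (net.continuous_load i).comp_continuousOn hcont

/-- Finitely many positive continuous loads are bounded below on a compact interval. -/
theorem exists_forall_le_load {φ : ℝ → net.State} {a b : ℝ} (hcont : ContinuousOn φ (Icc a b))
    (S : Finset (Fin N)) (hpos : ∀ t ∈ Icc a b, ∀ i ∉ S, 0 < net.load (φ t) i) :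
    ∃ c : ℝ, 0 < c ∧ ∀ t ∈ Icc a b, ∀ i ∉ S, c ≤ net.load (φ t) i := by
  have h : ∀ i, ∃ c : ℝ, 0 < c ∧ (i ∉ S → ∀ t ∈ Icc a b, c ≤ net.load (φ t) i) := by
    intro i
    by_cases hi : i ∈ S
    · exact ⟨1, one_pos, fun h => absurd hi h⟩
    obtain ⟨c, hc, hle⟩ := isCompact_Icc.exists_forall_le' (continuousOn_load_comp hcont i)
      (a := 0) (fun t ht => hpos t ht i hi)
    exact ⟨c, hc, fun _ => hle⟩
  choose c hc hle using h
  rcases isEmpty_or_nonempty (Fin N) with hN | hN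
  · exact ⟨1, one_pos, fun t _ i => isEmptyElim i⟩
  obtain ⟨j, hj⟩ := Finite.exists_min c
  exact ⟨c j, hc j, fun t ht i hi => (hj i).trans (hle i hi t ht)⟩

/-- The loads of a continuous path are uniformly continuous. -/
theorem exists_forall_abs_load_sub_le {φ : ℝ → net.State} {a b : ℝ}
    (hcont : ContinuousOn φ (Icc a b)) {ω : ℝ} (hω : 0 < ω) :
    ∃ ρ : ℝ, 0 < ρ ∧ ∀ i, ∀ s ∈ Icc a b, ∀ t ∈ Icc a b, |s - t| < ρ →
      |net.load (φ s) i - net.load (φ t) i| ≤ ω := by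
  have h : ∀ i, ∃ ρ : ℝ, 0 < ρ ∧ ∀ s ∈ Icc a b, ∀ t ∈ Icc a b, |s - t| < ρ →
      |net.load (φ s) i - net.load (φ t) i| ≤ ω := by
    intro i
    obtain ⟨ρ, hρ, h⟩ := Metric.uniformContinuousOn_iff.1
      (isCompact_Icc.uniformContinuousOn_of_continuous (continuousOn_load_comp hcont i)) ω hω
    exact ⟨ρ, hρ, fun s hs t ht hst => (h s hs t ht hst).le⟩
  choose ρ hρ hle using h
  rcases isEmpty_or_nonempty (Fin N) with hN | hN
  · exact ⟨1, one_pos, fun i => isEmptyElim i⟩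
  obtain ⟨j, hj⟩ := Finite.exists_min ρ
  exact ⟨ρ j, hρ j, fun i s hs t ht hst => hle i s hs t ht (hst.trans_le (hj i))⟩

/-- A path is approximable on every interval on which only the loads in a given set of links are
allowed to vanish. -/
theorem approximable_of_load_pos {φ : ℝ → net.State} {A B R σ : ℝ} (hm : Measurable φ)
    (hφ : CoordAC φ A B) (hcont : ContinuousOn φ (Icc A B)) (hR : ∀ t e, (φ t e : ℝ) ≤ R)
    (hσ : 0 < σ) (S : Finset (Fin N)) :
    ∀ a b, A ≤ a → a ≤ b → b ≤ B → (∀ t ∈ Icc a b, ∀ i ∉ S, 0 < net.load (φ t) i) →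
      Approximable φ σ a b := by
  induction S using Finset.strongInduction with
  | H S ih =>
  intro a b hAa hab hbB hpos
  have hsub : Icc a b ⊆ Icc A B := Icc_subset_Icc hAa hbB
  have hcab := hcont.mono hsub
  -- A link of S with positive load keeps it near t, so locally it can be removed from S and the
  -- induction hypothesis applies.
  have hnz : ∀ u v, a ≤ u → u ≤ v → v ≤ b →
      (∀ t ∈ Icc u v, ∃ i ∈ S, net.load (φ t) i ≠ 0) → Approximable φ σ u v := by
    intro u v hau huv hvb h
    refine Approximable.of_local hσ.le hR huv fun t ht => ?_
    obtain ⟨i, hi, hne⟩ := h t ht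
    have hti : t ∈ Icc a b := ⟨hau.trans ht.1, ht.2.trans hvb⟩
    have hl : 0 < net.load (φ t) i := (net.load_nonneg _ _).lt_of_ne' hne
    obtain ⟨ρ, hρ, hρ'⟩ := exists_forall_abs_load_sub_le hcab
      (show 0 < net.load (φ t) i / 2 by positivity)
    refine ⟨ρ, hρ, fun u' v' hu huv' hv h1 h2 => ?_⟩
    refine ih (S.erase i) (Finset.erase_ssubset hi) u' v' (hAa.trans (hau.trans hu)) huv'
      (hv.trans (hvb.trans hbB)) fun s hs j hj => ?_
    have hsab : s ∈ Icc a b := ⟨hau.trans (hu.trans hs.1), hs.2.trans (hv.trans hvb)⟩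
    by_cases hji : j = i
    · subst hji
      have := (abs_le.1 (hρ' j s hsab t hti
        (abs_lt.2 ⟨by linarith [hs.1], by linarith [hs.2]⟩))).1
      linarith
    · exact hpos s hsab j fun hjS => hj (Finset.mem_erase.2 ⟨hji, hjS⟩)
  obtain ⟨c, hc, hle⟩ := exists_forall_le_load hcab S hpos
  obtain ⟨ω, hω, hkey⟩ := exists_approximable_of_load_le (net := net) S hc hσ
  obtain ⟨ρ, hρ, hosc⟩ := exists_forall_abs_load_sub_le hcab hω
  refine Approximable.of_local hσ.le hR hab fun t ht => ⟨ρ / 2, by positivity, ?_⟩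
  intro u v hau huv hvb h1 h2
  -- Between the first and the last time at which all loads in S vanish, they stay below ω by the
  -- choice of ρ. If S is empty then F is the whole interval, so no separate base case is needed.
  set F : Set ℝ := Icc u v ∩ {s | ∀ i ∈ S, net.load (φ s) i = 0} with hF
  have hcuv : ContinuousOn φ (Icc u v) := hcab.mono (Icc_subset_Icc hau hvb)
  have hFc : IsCompact F := by
    have hFi : F = Icc u v ∩ (fun s => ∑ i ∈ S, net.load (φ s) i) ⁻¹' {0} := by
      ext s
      simp only [hF, mem_inter_iff, mem_ofPred_eq, mem_preimage, mem_singleton_iff,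
        Finset.sum_eq_zero_iff_of_nonneg fun i _ => net.load_nonneg (φ s) i]
    rw [hFi]
    refine isCompact_Icc.of_isClosed_subset (ContinuousOn.preimage_isClosed_of_isClosed
      (continuousOn_finsetSum S fun i _ => continuousOn_load_comp hcuv i) isClosed_Icc
      isClosed_singleton) inter_subset_left
  rcases F.eq_empty_or_nonempty with hempty | hne
  · refine hnz u v hau huv hvb fun s hs => ?_
    by_contra! hcon
    exact (hempty ▸ (⟨hs, hcon⟩ : s ∈ F) : s ∈ (∅ : Set ℝ))
  obtain ⟨hpF, hpmin⟩ := hFc.isLeast_sInf hne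
  obtain ⟨hqF, hqmax⟩ := hFc.isGreatest_sSup hne
  set p := sInf F
  set q := sSup F
  have hpq : p ≤ q := hpmin hqF
  -- At each time before p some load in S is positive, but at p none is; hence the passage to
  -- subintervals that stay away from p.
  have e1 : Approximable φ σ u p := by
    refine Approximable.of_forall_subinterval hσ.le hR hpF.1.1
      (hcuv.mono (Icc_subset_Icc_right hpF.1.2)) fun s s' hs hss hs' => ?_
    refine hnz s s' (by linarith) hss (by linarith [hpF.1.2]) fun r hr => ?_
    by_contra! hcon
    have := hpmin (a := r) ⟨⟨by linarith [hr.1], by linarith [hr.2, hpF.1.2]⟩, hcon⟩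
    linarith [hr.2]
  have e2 : Approximable φ σ q v := by
    refine Approximable.of_forall_subinterval hσ.le hR hqF.1.2
      (hcuv.mono (Icc_subset_Icc_left hqF.1.1)) fun s s' hs hss hs' => ?_
    refine hnz s s' (by linarith [hqF.1.1]) hss (by linarith) fun r hr => ?_
    by_contra! hcon
    have := hqmax (a := r) ⟨⟨by linarith [hr.1, hqF.1.1], by linarith [hr.2]⟩, hcon⟩
    linarith [hr.1]
  have hpab : p ∈ Icc a b := ⟨hau.trans hpF.1.1, hpF.1.2.trans hvb⟩
  have hpqab : Icc p q ⊆ Icc a b := Icc_subset_Icc hpab.1 (hqF.1.2.trans hvb)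
  have e3 : Approximable φ σ p q := by
    refine hkey φ p q hpq hm (hφ.subinterval (hAa.trans hpab.1) hpq
      (hqF.1.2.trans (hvb.trans hbB))) (hcab.mono hpqab) (fun s hs => hle s (hpqab hs))
      (fun s hs i hi => ?_) hpF.2 hqF.2
    have h3 := (abs_le.1 (hosc i s (hpqab hs) p hpab
      (abs_lt.2 ⟨by linarith [hs.1], by linarith [hs.2, hqF.1.2, hpF.1.1]⟩))).2
    rw [hpF.2 i hi] at h3
    linarith
  exact (e1.trans hσ.le hR hpF.1.1 hpq e3).trans hσ.le hR (hpF.1.1.trans hpq) hqF.1.2 e2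

theorem isAC_of_lipschitz {T L : ℝ} {φ : net.CadlagPath T} (hT : 0 ≤ T) (hL : 0 ≤ L)
    (h : ∀ s t, dist (φ s) (φ t) ≤ L * |(s : ℝ) - t|) : φ.IsAC := by
  have : LipschitzOnWith L.toNNReal φ.extend (uIcc 0 T) := by
    rw [uIcc_of_le hT]
    refine LipschitzOnWith.of_dist_le_mul fun s hs t ht => ?_
    rw [φ.extend_apply hs, φ.extend_apply ht, Real.coe_toNNReal _ hL, Real.dist_eq]
    exact h _ _
  exact this.absolutelyContinuousOnInterval

/-- Approximation of a path of finite cost by piecewise linear paths. -/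
theorem exists_isPiecewiseLinear {T : ℝ} (hT : 0 < T) {φ : C(Icc (0 : ℝ) T, net.State)}
    (hφ : pathRate (ofContinuous φ) < ⊤) {ε : ℝ} (hε : 0 < ε) :
    ∃ ψ : C(Icc (0 : ℝ) T, net.State), IsPiecewiseLinear ψ ∧ dist ψ φ ≤ ε ∧
      pathRate (ofContinuous ψ) ≤ pathRate (ofContinuous φ) + ENNReal.ofReal ε := by
  have hAC := isAC_of_pathRate_lt_top hφ
  set f := (ofContinuous φ).extend with hf
  have hfφ : ∀ t : Icc (0 : ℝ) T, f t = φ t := (ofContinuous φ).extend_coe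
  have hcont : ContinuousOn f (Icc 0 T) := by
    rw [continuousOn_iff_continuous_domRestrict]
    exact φ.continuous.congr fun t => (hfφ t).symm
  obtain ⟨R, hR⟩ : ∃ R : ℝ, ∀ t e, (f t e : ℝ) ≤ R := by
    refine ⟨dist φ 0, fun t e => ?_⟩
    by_cases ht : t ∈ Icc 0 T
    · have h1 := (dist_le_pi_dist (φ ⟨t, ht⟩) 0 e).trans 
        (ContinuousMap.dist_apply_le_dist (g := (0 : C(Icc (0 : ℝ) T, net.State))) ⟨t, ht⟩)
      rw [hfφ ⟨t, ht⟩]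
      simpa [NNReal.dist_eq] using h1
    · rw [show f t = 0 from dif_neg ht]
      exact dist_nonneg
  set I := pathRate (ofContinuous φ) with hI
  have hIf : pathCost f 0 T = I := (pathRate_eq_of_isAC hAC).symm
  set r := I.toReal
  have hr : 0 ≤ r := ENNReal.toReal_nonneg
  have hIr : I = ENNReal.ofReal r := (ENNReal.ofReal_toReal hφ.ne).symm
  -- Then σ I + σ T and σ itself are at most ε / 3, which covers both the excess cost and the
  -- distance.
  set σ : ℝ := ε / (3 * (r + T + 1)) with hσdef
  have hσ : 0 < σ := by positivity
  have hσr : σ * (r + T + 1) = ε / 3 := by rw [hσdef]; field_simp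
  obtain ⟨δ, hδ, hδ'⟩ := Metric.uniformContinuousOn_iff.1
    (isCompact_Icc.uniformContinuousOn_of_continuous hcont) (ε / 3) (by positivity)
  set ε' : ℝ := min (δ / 2) (ε / 3)
  have hε' : 0 < ε' := lt_min (by positivity) (by positivity)
  have hεδ : ε' < δ := (min_le_left _ _).trans_lt (by linarith)
  have hεε : ε' ≤ ε / 3 := min_le_right _ _
  have hσT : 0 ≤ σ * T := by positivity
  have hσr0 : 0 ≤ σ * r := by positivity
  -- With all links in S the positivity condition is void.
  have happ : Approximable f σ 0 T :=
    approximable_of_load_pos (hAC.measurable_extend hT.le) hAC.coordAC hcont hR hσ Finset.univ 0 T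
      le_rfl hT.le le_rfl fun t _ i hi => absurd (Finset.mem_univ i) hi
  obtain ⟨h, y, y', h1, -, -, -, g, hg, -, -, hgcost, hgd⟩ := happ ε' hε'
  rw [sub_zero] at h1 hgcost
  -- The approximation lasts at least T; cutting it off at T can only lower its cost.
  have hgT := hg.initial hT.le h1
  obtain ⟨L, hL, hlip⟩ := hgT.exists_lipschitz
  have hgc : ContinuousOn g (Icc 0 T) :=
    (LipschitzOnWith.of_dist_le_mul (K := L.toNNReal) fun s hs t ht => by
      rw [Real.coe_toNNReal _ hL, Real.dist_eq]
      exact hlip s hs t ht).continuousOn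
  set ψ : C(Icc (0 : ℝ) T, net.State) := ⟨fun t => g t, hgc.domRestrict⟩
  have hψAC : (ofContinuous ψ).IsAC := isAC_of_lipschitz hT.le hL fun s t => hlip s s.2 t t.2
  refine ⟨ψ, ?_, ?_, ?_⟩
  · obtain ⟨n, τ, hmono, h0, hn, hA⟩ := hgT.exists_subdivision
    refine ⟨n, τ, hmono, h0, hn, fun k hk => ?_⟩
    obtain ⟨a, v, hav⟩ := hA k hk
    exact ⟨a, v, fun t ht ht' e => hav t ⟨ht, ht'⟩ e⟩
  · refine (ContinuousMap.dist_le hε.le).2 fun t => ?_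
    obtain ⟨s, hs, hst, hd⟩ := hgd t ⟨t.2.1, t.2.2.trans h1⟩
    rw [sub_zero] at hst
    have h2 := (hδ' s hs t t.2 (hst.trans_lt hεδ)).le
    have h3 := dist_triangle (g t) (f s) (f t)
    rw [← hfφ t]
    change dist (g t) (f t) ≤ ε
    nlinarith
  · have h2 : pathRate (ofContinuous ψ) = pathCost g 0 T := by
      rw [pathRate_eq_of_isAC hψAC]
      exact pathCost_congr fun t ht => (ofContinuous ψ).extend_apply ⟨ht.1.le, ht.2.le⟩
    have h3 : pathCost g 0 T ≤ pathCost g 0 h := lintegral_mono_set (Icc_subset_Icc_right h1)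
    rw [h2]
    refine (h3.trans hgcost).trans ?_
    rw [hIf, hIr, ← ENNReal.ofReal_mul (by positivity), ← ENNReal.ofReal_add (by positivity)
      (by positivity), ← ENNReal.ofReal_add hr hε.le]
    exact ENNReal.ofReal_le_ofReal (by nlinarith)

end StarNetwork

/-! ### The four properties together. -/

theorem proposition3p9 {N : ℕ} (net : StarNetwork N) (T : ℝ) (hT : 0 < T) :
    -- uniform absolute continuity of paths with bounded cost
    (∀ (K : ℝ≥0) (ε : ℝ), 0 < ε → ∃ δ : ℝ, 0 < δ ∧
      ∀ φ : net.CadlagPath T, StarNetwork.pathRate φ ≤ K →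
        ∀ (n : ℕ) (a b : Fin n → Set.Icc (0 : ℝ) T), (∀ i, a i ≤ b i) →
          (Pairwise fun i j => Disjoint (Set.Ioo (a i : ℝ) (b i)) (Set.Ioo (a j : ℝ) (b j))) →
          ∑ i, ((b i : ℝ) - a i) ≤ δ →
          ∑ i, dist (φ (b i)) (φ (a i)) ≤ ε) ∧
    -- lower semicontinuity for the Skorokhod topology
    LowerSemicontinuous (fun φ : net.CadlagPath T => StarNetwork.pathRate φ) ∧
    -- unions of level sets over compact sets of initial points are compact in `C([0,T])`
    (∀ (K : ℝ≥0) (C : Set net.State), IsCompact C →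
      (⋃ x ∈ C, net.levelSet T K x) ⊆ Set.range StarNetwork.ofContinuous ∧
      IsCompact (StarNetwork.ofContinuous ⁻¹' (⋃ x ∈ C, net.levelSet T K x) :
        Set C(Set.Icc (0 : ℝ) T, net.State))) ∧
    -- approximation by piecewise linear paths
    (∀ φ : C(Set.Icc (0 : ℝ) T, net.State), (StarNetwork.ofContinuous φ).IsAC →
      StarNetwork.pathRate (StarNetwork.ofContinuous φ) < ⊤ →
      ∀ ε : ℝ, 0 < ε → ∃ ψ : C(Set.Icc (0 : ℝ) T, net.State),
        StarNetwork.IsPiecewiseLinear ψ ∧ dist ψ φ ≤ ε ∧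
        StarNetwork.pathRate (StarNetwork.ofContinuous ψ) ≤
          StarNetwork.pathRate (StarNetwork.ofContinuous φ) + ENNReal.ofReal ε) := by
  refine ⟨fun K ε hε => ?_, StarNetwork.lowerSemicontinuous_pathRate hT, fun K C hC =>
    ⟨StarNetwork.iUnion_levelSet_subset_range hT K C,
      StarNetwork.isCompact_preimage_levelSet hT K hC⟩,
    fun φ _ hφ ε hε => StarNetwork.exists_isPiecewiseLinear hT hφ hε⟩
  obtain ⟨δ, hδ, h⟩ := net.exists_forall_sum_dist_le K hε
  exact ⟨δ, hδ, fun φ hφ => h T φ hφ⟩
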